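/- Let $N>1$, let $(e_i)_{1\le i\le N}$ be the canonical basis of $\mathbb R^N$, $J_i=\mathbb R_+e_i$, and let $\mathcal G=\bigcup_{i=1}^N J_i$ carry the geodesic distance $d(x,y)=|x-y|$ if $x,y$ lie on a common edge $J_i$ and $d(x,y)=|x|+|y|$ otherwise. Let $\mathcal P_1(\mathcal G)$ be the set of Borel probability measures on $\mathcal G$ with finite first moment, with the Kantorovich–Rubinstein distance $d_1$. Fix $T>0$, $p\in(1,\infty)$ and a Borel probability measure $m_0$ on $\mathcal G$ with bounded support. Trajectories. Let $\Gamma[x]$ be the set of $y\in C([0,T];\mathcal G)\cap W^{1,p}(0,T;\mathbb R^N)$ with $y(0)=x$. For $C\ge 0$ let $\Gamma_C[x]=\{y\in\Gamma[x]:\|y\|_{L^\infty(0,T)}\le C,\ \|y'\|_{L^p(0,T)}\le C\}$, and let $\Gamma_C=\bigcup_{x\in\mathcal G}\Gamma_C[x]$, with the topology of uniform convergence. For a Borel probability measure $\mu$ on $\Gamma_C$ and $t\in[0,T]$ let $m^\mu(t)\in\mathcal P_1(\mathcal G)$ be the image of $\mu$ under $y\mapsto y(t)$. Let $\mathcal P_{m_0}(\Gamma_C)$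 be the set of those $\mu$ with $m^\mu(0)=m_0$, with the weak topology. Costs. For $1\le i\le N$ let $L_i\in C(\mathcal P_1(\mathcal G);C^1(\mathbb R_+\times\mathbb R))$, where $C^1(\mathbb R_+\times\mathbb R)$ carries the topology of $C^1$-convergence on compact sets, $G_i\in C_b(\mathcal P_1(\mathcal G);C_b(\mathbb R_+))$, and let $L_*,G_*\in C_b(\mathcal P_1(\mathcal G);\mathbb R)$. Assume: 1. there is $C_0>0$ such that $L_i[m](x,a)\ge C_0(|a|^p-1)$ and $L_*[m]\ge -C_0$ for all $i$, $m\in\mathcal P_1(\mathcal G)$, $x\ge0$, $a\in\mathbb R$; 2. for every $r>0$ there is a modulus of continuity $\omega_r$ such that $|L_i[m_1](x,a)-L_i[m_2](x,a)|\le(1+|a|^p)\,\omega_r(d_1(m_1,m_2))$ for all $i$, $m_1,m_2\in\mathcal P_1(\mathcal G)$, $x\in[0,r]$, $a\in\mathbb R$; 3. for every $r>0$ there is $\tilde c(r)\ge0$ such that $|\partial_xL_i[m](x,a)|\le\tilde c(r)(|a|^p+1)$ and $|\partial_aL_i[m](x,a)|\le\tilde c(r)(|a|^{p-1}+1)$ for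 all $i$, $m\in\mathcal P_1(\mathcal G)$, $x\in[0,r]$, $a\in\mathbb R$; 4. $a\mapsto L_i[m](x,a)$ is strictly convex for all $i$, $m\in\mathcal P_1(\mathcal G)$, $x\ge0$. For $y\in\Gamma[x]$, at almost every $s$ with $y(s)\in J_i\setminus\{0\}$ one has $y'(s)=\bar y'(s)e_i$ with $\bar y'(s)\in\mathbb R$. Set $L_0[m]=\min\{L_*[m],\min_iL_i[m](0,0)\}$, $$L[m](y(s),y'(s))=\sum_{i=1}^NL_i[m](|y(s)|,\bar y'(s))\,\mathbf 1_{y(s)\in J_i\setminus\{0\}}+L_0[m]\,\mathbf 1_{y(s)=0},$$ $$G[m](x)=\sum_{i=1}^NG_i[m](|x|)\,\mathbf 1_{x\in J_i\setminus\{0\}}+\min\{G_*[m],\min_iG_i[m](0)\}\,\mathbf 1_{x=0},$$ $$J^\mu(x;y)=\int_0^TL[m^\mu(\tau)](y(\tau),y'(\tau))\,d\tau+G[m^\mu(T)](y(T)),$$ and $$\Gamma_C^{\mu,\mathrm{opt}}[x]=\Bigl\{y\in\Gamma_C[x]:J^\mu(x;y)=\min_{\tilde y\in\Gamma[x]}J^\mu(x;\tilde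 y)\Bigr\}.$$ **Proposition** (closed graph of $(x,\mu)\rightrightarrows\Gamma_C^{\mu,\mathrm{opt}}[x]$). Let $C\ge0$, $\mu\in\mathcal P_{m_0}(\Gamma_C)$ and $x\in\operatorname{supp}(m_0)$. Let $\mu_n\in\mathcal P_{m_0}(\Gamma_C)$ converge weakly to $\mu$, let $x_n\in\mathcal G$ converge to $x$, and let $y_n\in\Gamma_C^{\mu_n,\mathrm{opt}}[x_n]$ converge uniformly on $[0,T]$ to some $y$. Then $y\in\Gamma_C^{\mu,\mathrm{opt}}[x]$. -/

import Mathlib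

open MeasureTheory Filter Topology Set
open scoped NNReal ENNReal ContDiff BoundedContinuousFunction

/-! ### Probability measures with finite first moment -/

/-- `𝒫₁(X)`: the Borel probability measures on `X` with finite first moment. -/
structure P1 (X : Type*) [PseudoMetricSpace X] [MeasurableSpace X] where
  /-- the underlying probability measure -/
  toProb : ProbabilityMeasure X
  /-- the first moment is finite -/
  moment : ∀ x₀ : X, Integrable (fun x => dist x x₀) (toProb : Measure X)

namespace P1

variable {X : Type*} [PseudoMetricSpace X] [MeasurableSpace X]

/-- The integral of a function against a measure in `𝒫₁(X)`. -/
noncomputable def integ (m : P1 X) (f : X → ℝ) : ℝ := ∫ x, f x ∂(m.toProb : Measure X)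

/-- The Kantorovich–Rubinstein distance: the supremum of `∫ f dm - ∫ f dn` over the
`1`-Lipschitz functions `f`. -/
noncomputable def d1 (m n : P1 X) : ℝ :=
  ⨆ f : {f : X → ℝ // LipschitzWith 1 f}, (m.integ f.1 - n.integ f.1)

lemma integrable_lip [OpensMeasurableSpace X] (m : P1 X) {f : X → ℝ} (hf : LipschitzWith 1 f) :
    Integrable f (m.toProb : Measure X) := by
  obtain ⟨x₀⟩ : Nonempty X := (m.toProb : Measure X).nonempty_of_neZero
  refine Integrable.mono' ((m.moment x₀).add (integrable_const |f x₀|))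
    hf.continuous.measurable.aestronglyMeasurable (Eventually.of_forall fun x => ?_)
  have h := hf.dist_le_mul x x₀
  rw [Real.dist_eq] at h
  simp only [NNReal.coe_one, one_mul] at h
  have h2 := abs_sub_abs_le_abs_sub (f x) (f x₀)
  simp only [Real.norm_eq_abs, Pi.add_apply]
  linarith

lemma bddAbove_d1 [OpensMeasurableSpace X] (m n : P1 X) :
    BddAbove (range fun f : {f : X → ℝ // LipschitzWith 1 f} => m.integ f.1 - n.integ f.1) := by
  obtain ⟨x₀⟩ : Nonempty X := (m.toProb : Measure X).nonempty_of_neZero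
  have key : ∀ (k : P1 X) (f : X → ℝ), LipschitzWith 1 f →
      |k.integ f - f x₀| ≤ k.integ (fun x => dist x x₀) := by
    intro k f hf
    have h1 : k.integ f - f x₀ = ∫ x, (f x - f x₀) ∂(k.toProb : Measure X) := by
      rw [integral_sub (k.integrable_lip hf) (integrable_const _)]
      simp [integ]
    rw [h1, ← Real.norm_eq_abs]
    refine norm_integral_le_of_norm_le (k.moment x₀) (Eventually.of_forall fun x => ?_)
    have h := hf.dist_le_mul x x₀
    rw [Real.dist_eq] at h
    simpa using h
  refine ⟨m.integ (fun x => dist x x₀) + n.integ (fun x => dist x x₀), ?_⟩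
  rintro _ ⟨f, rfl⟩
  have h1 := abs_le.1 (key m f.1 f.2)
  have h2 := abs_le.1 (key n f.1 f.2)
  simp only
  linarith [h1.2, h2.1]

noncomputable instance [OpensMeasurableSpace X] : PseudoMetricSpace (P1 X) where
  dist := d1
  dist_self m := by simp [d1]
  dist_comm m n := by
    have aux : ∀ m n : P1 X, d1 m n ≤ d1 n m := by
      intro m n
      have : Nonempty {f : X → ℝ // LipschitzWith 1 f} := ⟨⟨fun _ => 0, LipschitzWith.const' 0⟩⟩
      refine ciSup_le fun f => ?_
      have h := le_ciSup (bddAbove_d1 n m) ⟨fun x => - f.1 x, f.2.neg⟩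
      simp only [integ, integral_neg] at h
      simp only [d1, integ]
      linarith
    exact le_antisymm (aux m n) (aux n m)
  dist_triangle m n k := by
    have : Nonempty {f : X → ℝ // LipschitzWith 1 f} := ⟨⟨fun _ => 0, LipschitzWith.const' 0⟩⟩
    refine ciSup_le fun f => ?_
    have h1 := le_ciSup (bddAbove_d1 m n) f
    have h2 := le_ciSup (bddAbove_d1 n k) f
    simp only [d1]
    linarith

end P1

/-! ### The junction -/

/-- The closed half-line `J_i = ℝ₊ e_i` in `ℝ^N`. -/
def edge {N : ℕ} (i : Fin N) : Set (EuclideanSpace ℝ (Fin N)) :=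
  {x | ∃ r : ℝ, 0 ≤ r ∧ x = EuclideanSpace.single i r}

/-- The junction `𝒢 = ⋃ i, J_i`. -/
@[ext] structure Junction (N : ℕ) where
  /-- the point of `ℝ^N` -/
  val : EuclideanSpace ℝ (Fin N)
  /-- the point lies on one of the edges -/
  mem : ∃ i, val ∈ edge i

namespace Junction

variable {N : ℕ}

open scoped Classical in
/-- The geodesic distance: `|x - y|` if `x` and `y` lie on a common edge, `|x| + |y|` otherwise. -/
noncomputable def geoDist (x y : Junction N) : ℝ :=
  if ∃ i, x.val ∈ edge i ∧ y.val ∈ edge i then ‖x.val - y.val‖ else ‖x.val‖ + ‖y.val‖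

lemma geoDist_eq_sum (x y : Junction N) : geoDist x y = ∑ k, |x.val k - y.val k| := by
  unfold geoDist
  split_ifs with h
  · obtain ⟨i, ⟨r, -, hx⟩, ⟨s, -, hy⟩⟩ := h
    rw [hx, hy, Finset.sum_eq_single i]
    · have : EuclideanSpace.single i r - EuclideanSpace.single i s
          = EuclideanSpace.single i (r - s) := by
        ext k
        by_cases hk : k = i <;> simp [hk]
      rw [this]
      simp
    · intro k _ hk
      simp [hk]
    · simp
  · obtain ⟨i, r, hr, hx⟩ := x.mem
    obtain ⟨j, s, hs, hy⟩ := y.mem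
    have hij : i ≠ j := by
      rintro rfl
      exact h ⟨i, ⟨r, hr, hx⟩, ⟨s, hs, hy⟩⟩
    rw [hx, hy, Finset.sum_eq_add i j hij]
    · simp [hij, hij.symm]
    · intro k _ hk
      simp [hk.1, hk.2]
    · simp
    · simp

/-- The junction with its geodesic distance. -/
noncomputable instance : MetricSpace (Junction N) where
  dist := geoDist
  dist_self x := by simp [geoDist_eq_sum]
  dist_comm x y := by simp only [geoDist_eq_sum, abs_sub_comm]
  dist_triangle x y z := by
    simp only [geoDist_eq_sum, ← Finset.sum_add_distrib]
    exact Finset.sum_le_sum fun k _ => abs_sub_le _ _ _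
  eq_of_dist_eq_zero := by
    intro x y h
    change geoDist x y = 0 at h
    rw [geoDist_eq_sum, Finset.sum_eq_zero_iff_of_nonneg (fun _ _ => abs_nonneg _)] at h
    ext k
    exact sub_eq_zero.1 (abs_eq_zero.1 (h k (Finset.mem_univ k)))

noncomputable instance : MeasurableSpace (Junction N) := borel _
instance : BorelSpace (Junction N) := ⟨rfl⟩

end Junction

/-! ### Admissible trajectories -/

/-- `C([0,T];𝒢)`, with the topology of uniform convergence. -/
abbrev Traj (N : ℕ) (T : ℝ) : Type := C(Icc (0 : ℝ) T, Junction N)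

noncomputable instance {N : ℕ} {T : ℝ} : MeasurableSpace (Traj N T) := borel _
instance {N : ℕ} {T : ℝ} : BorelSpace (Traj N T) := ⟨rfl⟩

/-- Lebesgue measure on `[0,T]`. -/
noncomputable def leb (T : ℝ) : Measure (Icc (0 : ℝ) T) := Measure.comap Subtype.val volume

/-- The initial time `0` as an element of `[0,T]`. -/
def tInit (T : ℝ) [hT : Fact (0 < T)] : Icc (0 : ℝ) T := ⟨0, le_rfl, hT.out.le⟩

/-- The final time `T` as an element of `[0,T]`. -/
def tFinal (T : ℝ) [hT : Fact (0 < T)] : Icc (0 : ℝ) T := ⟨T, hT.out.le, le_rfl⟩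

/-- `v ∈ L¹(0,T;ℝ^N)` is the weak derivative of `y` on `(0,T)`: `∫ φ' y = - ∫ φ v` for all
test functions `φ ∈ C_c^∞((0,T))`. -/
def IsWeakDeriv {N : ℕ} {T : ℝ} (y : Traj N T)
    (v : Icc (0 : ℝ) T → EuclideanSpace ℝ (Fin N)) : Prop :=
  Integrable v (leb T) ∧
  ∀ φ : ℝ → ℝ, ContDiff ℝ ∞ φ → HasCompactSupport φ → tsupport φ ⊆ Ioo 0 T →
    ∫ s : Icc (0 : ℝ) T, deriv φ s • (y s).val ∂(leb T) = - ∫ s : Icc (0 : ℝ) T, φ s • v s ∂(leb T)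

/-- The weak derivative `y'`: it is unique up to null sets, when it exists. -/
noncomputable def weakDeriv {N : ℕ} {T : ℝ} (y : Traj N T) :
    Icc (0 : ℝ) T → EuclideanSpace ℝ (Fin N) :=
  Classical.epsilon (IsWeakDeriv y)

/-- `Γ = C([0,T];𝒢) ∩ W^{1,p}(0,T;ℝ^N)`: the admissible trajectories. -/
def Gam (N : ℕ) (T p : ℝ) : Set (Traj N T) :=
  {y | ∃ v, IsWeakDeriv y v ∧ MemLp v (ENNReal.ofReal p) (leb T)}

/-- `Γ[x]`: the admissible trajectories with `y(0) = x`. -/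
def GamFrom {N : ℕ} (T p : ℝ) [Fact (0 < T)] (x : Junction N) : Set (Traj N T) :=
  {y | y ∈ Gam N T p ∧ y (tInit T) = x}

/-- `Γ_C[x]`: the trajectories in `Γ[x]` with `‖y‖_{L^∞} ≤ C` and `‖y'‖_{L^p} ≤ C`. -/
def GamCFrom {N : ℕ} (T p C : ℝ) [Fact (0 < T)] (x : Junction N) : Set (Traj N T) :=
  {y | y ∈ GamFrom T p x ∧ (∀ s, ‖(y s).val‖ ≤ C) ∧
    eLpNorm (weakDeriv y) (ENNReal.ofReal p) (leb T) ≤ ENNReal.ofReal C}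

/-- `Γ_C = ⋃ x, Γ_C[x]`, with the topology of uniform convergence. -/
def GamC (N : ℕ) (T p C : ℝ) [Fact (0 < T)] : Set (Traj N T) :=
  ⋃ x : Junction N, GamCFrom T p C x

/-! ### Marginals -/

section marginals

variable {N : ℕ} {T p C : ℝ} [Fact (0 < T)]

/-- The evaluation map `e_t : Γ_C → 𝒢`. -/
noncomputable def evalAt (t : Icc (0 : ℝ) T) (y : GamC N T p C) : Junction N := y.1 t

lemma continuous_evalAt (t : Icc (0 : ℝ) T) :
    Continuous (evalAt t : GamC N T p C → Junction N) :=
  (continuous_eval_const t).comp continuous_subtype_val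

/-- `e_t ♯ μ` as a probability measure on `𝒢`. -/
noncomputable def marginalProb (μ : ProbabilityMeasure (GamC N T p C)) (t : Icc (0 : ℝ) T) :
    ProbabilityMeasure (Junction N) :=
  μ.map (continuous_evalAt t).measurable.aemeasurable

lemma Junction.dist_le_norm_add (x y : Junction N) : dist x y ≤ ‖x.val‖ + ‖y.val‖ := by
  change Junction.geoDist x y ≤ _
  unfold Junction.geoDist
  split_ifs
  · exact norm_sub_le _ _
  · exact le_rfl

/-- The marginal `m^μ(t) = e_t ♯ μ`, an element of `𝒫₁(𝒢)`. -/
noncomputable def marginal (μ : ProbabilityMeasure (GamC N T p C)) (t : Icc (0 : ℝ) T) :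
    P1 (Junction N) where
  toProb := marginalProb μ t
  moment x₀ := by
    rw [marginalProb, ProbabilityMeasure.toMeasure_map,
      integrable_map_measure (by fun_prop) (continuous_evalAt t).measurable.aemeasurable]
    refine Integrable.mono' (integrable_const (C + ‖x₀.val‖))
      ((Continuous.dist (continuous_evalAt t) continuous_const).aestronglyMeasurable)
      (Eventually.of_forall fun y => ?_)
    obtain ⟨x, hx⟩ := mem_iUnion.1 y.2
    have h1 := Junction.dist_le_norm_add (evalAt t y) x₀
    have h2 : ‖(evalAt t y).val‖ ≤ C := hx.2.1 t
    simp only [Function.comp_apply, Real.norm_eq_abs, abs_of_nonneg dist_nonneg]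
    linarith

end marginals

/-- `𝒫_{m₀}(Γ_C)`: the probability measures on `Γ_C` with `e_0 ♯ μ = m₀`. -/
def ProbFrom {N : ℕ} (T p C : ℝ) [Fact (0 < T)] (m₀ : ProbabilityMeasure (Junction N)) :
    Set (ProbabilityMeasure (GamC N T p C)) :=
  {μ | marginalProb μ (tInit T) = m₀}

/-! ### Costs -/

/-- The cost data: `L_i ∈ C(𝒫₁(𝒢); C¹(ℝ₊ × ℝ))`, where `C¹(ℝ₊ × ℝ)` carries `C¹`-convergence on
compact sets, `G_i ∈ C_b(𝒫₁(𝒢); C_b(ℝ₊))`, and `L_*, G_* ∈ C_b(𝒫₁(𝒢); ℝ)`.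
Only the values of `L i m x a` for `x ≥ 0` matter. -/
structure Costs (N : ℕ) where
  /-- the running costs on the edges -/
  L : Fin N → P1 (Junction N) → ℝ → ℝ → ℝ
  /-- the specific running cost at the vertex -/
  Lstar : P1 (Junction N) →ᵇ ℝ
  /-- the terminal costs on the edges -/
  G : Fin N → (P1 (Junction N) →ᵇ (ℝ≥0 →ᵇ ℝ))
  /-- the specific terminal cost at the vertex -/
  Gstar : P1 (Junction N) →ᵇ ℝ
  contDiff_L : ∀ i m, ContDiffOn ℝ 1 (fun z : ℝ × ℝ => L i m z.1 z.2) (Ici 0 ×ˢ univ)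
  cont_L : ∀ i m, ∀ K ⊆ Ici (0 : ℝ) ×ˢ (univ : Set ℝ), IsCompact K →
    TendstoUniformlyOn (fun n (z : ℝ × ℝ) => L i n z.1 z.2)
      (fun z => L i m z.1 z.2) (𝓝 m) K ∧
    TendstoUniformlyOn (fun n (z : ℝ × ℝ) => derivWithin (fun x => L i n x z.2) (Ici 0) z.1)
      (fun z => derivWithin (fun x => L i m x z.2) (Ici 0) z.1) (𝓝 m) K ∧
    TendstoUniformlyOn (fun n (z : ℝ × ℝ) => deriv (fun a => L i n z.1 a) z.2)
      (fun z => deriv (fun a => L i m z.1 a) z.2) (𝓝 m) K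

/-- A modulus of continuity. -/
def IsModulus (w : ℝ → ℝ) : Prop :=
  w 0 = 0 ∧ (∀ s, 0 ≤ s → 0 ≤ w s) ∧ Tendsto w (𝓝[≥] 0) (𝓝 0)

/-- The structural assumptions on the running costs, with exponent `p`. -/
structure Costs.HMFG1 {N : ℕ} (c : Costs N) (p : ℝ) : Prop where
  coercive : ∃ C₀ : ℝ, 0 < C₀ ∧
    (∀ i m x a, 0 ≤ x → C₀ * (|a| ^ p - 1) ≤ c.L i m x a) ∧ ∀ m, -C₀ ≤ c.Lstar m
  modulus : ∀ r : ℝ, 0 < r → ∃ w : ℝ → ℝ, IsModulus w ∧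
    ∀ i m₁ m₂, ∀ x ∈ Icc 0 r, ∀ a : ℝ,
      |c.L i m₁ x a - c.L i m₂ x a| ≤ (1 + |a| ^ p) * w (dist m₁ m₂)
  growth : ∀ r : ℝ, 0 < r → ∃ c' : ℝ, 0 ≤ c' ∧
    ∀ i m, ∀ x ∈ Icc 0 r, ∀ a : ℝ,
      |derivWithin (fun z => c.L i m z a) (Ici 0) x| ≤ c' * (|a| ^ p + 1) ∧
      |deriv (fun b => c.L i m x b) a| ≤ c' * (|a| ^ (p - 1) + 1)
  convex : ∀ i m x, 0 ≤ x → StrictConvexOn ℝ univ (fun a => c.L i m x a)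

namespace Costs

variable {N : ℕ} (c : Costs N)

/-- The running cost `L_0[m]` for staying at the vertex. -/
noncomputable def L0 (m : P1 (Junction N)) : ℝ := min (c.Lstar m) (⨅ i, c.L i m 0 0)

open scoped Classical in
/-- The running cost `L[m](x, α)` at the point `x` with velocity `α`. On `J_i ∖ {0}` the velocity
of an admissible trajectory is almost everywhere `α = ᾱ e_i`, so that `ᾱ` is the coordinate `α i`. -/
noncomputable def running (m : P1 (Junction N)) (x : Junction N)
    (α : EuclideanSpace ℝ (Fin N)) : ℝ :=
  (∑ i, if x.val ∈ edge i \ {0} then c.L i m ‖x.val‖ (α i) else 0) +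
    if x.val = 0 then c.L0 m else 0

open scoped Classical in
/-- The terminal cost `G[m](x)`. -/
noncomputable def terminal (m : P1 (Junction N)) (x : Junction N) : ℝ :=
  (∑ i, if x.val ∈ edge i \ {0} then c.G i m ‖x.val‖₊ else 0) +
    if x.val = 0 then min (c.Gstar m) (⨅ i, c.G i m 0) else 0

/-- The cost `J^μ(x; y)` of a trajectory `y ∈ Γ[x]`. -/
noncomputable def J {T p C : ℝ} [Fact (0 < T)] (μ : ProbabilityMeasure (GamC N T p C))
    (y : Traj N T) : ℝ :=
  (∫ s : Icc (0 : ℝ) T, c.running (marginal μ s) (y s) (weakDeriv y s) ∂(leb T)) +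
    c.terminal (marginal μ (tFinal T)) (y (tFinal T))

/-- `Γ_C^{μ,opt}[x]`: the trajectories in `Γ_C[x]` which minimize `J^μ(x; ·)` over `Γ[x]`. -/
def optimal {T p C' : ℝ} [Fact (0 < T)] (C : ℝ) (μ : ProbabilityMeasure (GamC N T p C'))
    (x : Junction N) : Set (Traj N T) :=
  {y | y ∈ GamCFrom T p C x ∧ ∀ z ∈ GamFrom T p x, c.J μ y ≤ c.J μ z}

end Costs

/-! ### Lebesgue measure on `[0,T]` -/

section leb

variable {T : ℝ}

/-! The proof is a Γ-convergence argument. It needs a liminf inequality along `y_n`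
(`Costs.HMFG1.eventually_J_ge`) and, for each competitor `z ∈ Γ[x]`, a recovery sequence `z_n ∈
Γ[x_n]` with `J^{μ_n}(z_n) → J^μ(z)` (`Costs.HMFG1.exists_recovery`). Then `J^μ(y) - ε ≤
J^{μ_n}(y_n) ≤ J^{μ_n}(z_n)` for large `n`, and letting `n → ∞`, then `ε → 0`, gives optimality of
`y`. That `y` stays in `Γ_C[x]` is the weak lower semicontinuity of the `L^p` norm
(`eLpNorm_coordDeriv_le_of_tendsto`).

Marginals: trajectories in `Γ_C` stay in a fixed ball, where `d₁` is controlled by the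
Lévy–Prokhorov distance, so `m^{μ_n}(t) → m^μ(t)` for each `t`. The `L^p` bound makes them
equi-Hölder in `t`, so the convergence is joint in `n` and `t` (`tendsto_marginal_prod`).

Liminf inequality: the derivatives `y_n'` converge only weakly, and the running cost jumps at the
vertex. Convexity and coercivity give, for large `n` and all `b` at once, `L_i[m_n](x_n, b) ≥
L_i[m](x, a) + ∂_a L_i[m](x, a) (b - a) - ε`. With `a = y'(s)` and `b = y_n'(s)`, the linear term
has integral tending to zero once the slope is truncated to be bounded. Almost everywhere on `{y =
0}` one has `y' = 0`, and `L_0[m] ≤ L_i[m](0, 0)`, so the supporting line at `a = 0` serves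
whichever edge carries `y_n(s)`. A Fatou argument concludes.

Recovery: because of the jump, `z_n` must sit at the vertex for large `n`, at almost every time at
which `z` does. If `x ≠ 0`, a dilation of `z` centred at the vertex does this. If `x = 0`, `z_n`
starts at `x_n`, at distance `r_n → 0` from the vertex, and coincides with `z` after time `r_n`. In
both cases `|z_n'|` is bounded by a multiple of `|z'| + 1` and the costs converge by dominated
convergence. -/

lemma map_coe_leb : (leb T).map Subtype.val = volume.restrict (Icc 0 T) :=
  map_comap_subtype_coe measurableSet_Icc _

lemma measurableEmbedding_coe_Icc : MeasurableEmbedding (Subtype.val : Icc (0 : ℝ) T → ℝ) :=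
  MeasurableEmbedding.subtype_coe measurableSet_Icc

instance : IsFiniteMeasure (leb T) := by
  constructor
  have h := congrArg (fun m : Measure ℝ => m univ) (map_coe_leb (T := T))
  simp only [measurableEmbedding_coe_Icc.map_apply, preimage_univ, Measure.restrict_apply_univ]
    at h
  rw [h]
  exact measure_Icc_lt_top

lemma ae_leb_iff {P : ℝ → Prop} :
    (∀ᵐ s : Icc (0 : ℝ) T ∂leb T, P s) ↔ ∀ᵐ t : ℝ, t ∈ Icc 0 T → P t := by
  rw [← ae_restrict_iff' measurableSet_Icc, ← map_coe_leb,
    measurableEmbedding_coe_Icc.ae_map_iff]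

variable {E : Type*} [NormedAddCommGroup E]

lemma integral_leb [NormedSpace ℝ E] (hT : 0 ≤ T) (f : ℝ → E) :
    ∫ s : Icc (0 : ℝ) T, f s ∂leb T = ∫ t in 0..T, f t := by
  rw [intervalIntegral.integral_of_le hT, ← integral_Icc_eq_integral_Ioc, ← map_coe_leb,
    measurableEmbedding_coe_Icc.integral_map]

lemma setIntegral_leb [NormedSpace ℝ E] (f : ℝ → E) {A : Set ℝ} (hA : MeasurableSet A) :
    ∫ s in Subtype.val ⁻¹' A, f s ∂leb T = ∫ t in A ∩ Icc 0 T, f t := by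
  rw [← Measure.restrict_restrict hA, ← map_coe_leb, measurableEmbedding_coe_Icc.setIntegral_map]

lemma setIntegral_leb_uIoc [NormedSpace ℝ E] (f : ℝ → E) {a b : ℝ} (ha : a ∈ Icc 0 T)
    (hb : b ∈ Icc 0 T) :
    ∫ s in Subtype.val ⁻¹' (uIoc a b), f s ∂leb T = ∫ t in uIoc a b, f t := by
  rw [setIntegral_leb f measurableSet_uIoc, inter_eq_left.2]
  exact uIoc_subset_uIcc.trans (uIcc_subset_Icc ha hb)

lemma integrable_leb_iff (hT : 0 ≤ T) {f : ℝ → E} :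
    Integrable (fun s : Icc (0 : ℝ) T => f s) (leb T) ↔ IntervalIntegrable f volume 0 T := by
  rw [intervalIntegrable_iff_integrableOn_Icc_of_le hT, IntegrableOn, ← map_coe_leb,
    measurableEmbedding_coe_Icc.integrable_map_iff]
  rfl

lemma leb_preimage_coe {A : Set ℝ} : leb T (Subtype.val ⁻¹' A) = volume.restrict (Icc 0 T) A := by
  rw [← map_coe_leb, measurableEmbedding_coe_Icc.map_apply]

end leb

/-! ### The lemma of du Bois-Reymond -/

/-- The primitive from `0` vanishes to the left of `K` because `h` does, and to the right of `K`
because `h` has mean zero. -/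
lemma exists_test_function_deriv_eq {T : ℝ} {h : ℝ → ℝ} {K : Set ℝ}
    (hh : ContDiff ℝ ∞ h) (hK : IsCompact K) (hne : K.Nonempty) (hKT : K ⊆ Ioo 0 T)
    (hs : Function.support h ⊆ K) (h0 : ∫ t, h t = 0) :
    ∃ φ : ℝ → ℝ, ContDiff ℝ ∞ φ ∧ HasCompactSupport φ ∧ tsupport φ ⊆ Ioo 0 T ∧ deriv φ = h := by
  have ha := hKT (hK.sInf_mem hne)
  have hb := hKT (hK.sSup_mem hne)
  have hsub : K ⊆ Icc (sInf K) (sSup K) := fun t ht =>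
    ⟨csInf_le hK.bddBelow ht, le_csSup hK.bddAbove ht⟩
  have hd : ∀ t, HasDerivAt (fun t => ∫ s in 0..t, h s) (h t) t := fun t =>
    hh.continuous.integral_hasStrictDerivAt 0 t |>.hasDerivAt
  have hder : deriv (fun t => ∫ s in 0..t, h s) = h := funext fun t => (hd t).deriv
  have hsupp : Function.support (fun t => ∫ s in 0..t, h s) ⊆ Icc (sInf K) (sSup K) := by
    intro t ht
    by_contra hcon
    refine ht ?_
    simp only [mem_Icc, not_and_or, not_le] at hcon
    rcases hcon with hlt | hgt
    · refine intervalIntegral.integral_zero_ae (Eventually.of_forall fun s hs' => ?_)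
      by_contra hne'
      have h1 := (hsub (hs hne')).1
      have h2 := hs'.2
      have : max 0 t < sInf K := max_lt ha.1 hlt
      exact absurd (h1.trans h2) (not_le.2 this)
    · refine Eq.trans ?_ h0
      refine intervalIntegral.integral_eq_integral_of_support_subset fun s hs' => ?_
      have := hsub (hs hs')
      exact ⟨ha.1.trans_le this.1, this.2.trans hgt.le⟩
  have hts : tsupport (fun t => ∫ s in 0..t, h s) ⊆ Icc (sInf K) (sSup K) :=
    closure_minimal hsupp isClosed_Icc
  refine ⟨fun t => ∫ s in 0..t, h s, ?_, ?_, ?_, hder⟩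
  · rw [contDiff_infty_iff_deriv, hder]
    exact ⟨fun t => (hd t).differentiableAt, hh⟩
  · exact HasCompactSupport.of_support_subset_isCompact isCompact_Icc hsupp
  · exact hts.trans fun t ht => ⟨ha.1.trans_le ht.1, ht.2.trans_lt hb.2⟩

/-- **The lemma of du Bois-Reymond.** -/
theorem exists_eqOn_const_of_integral_deriv_mul_eq_zero {T : ℝ} (hT : 0 < T) {u : ℝ → ℝ}
    (hu : ContinuousOn u (Icc 0 T))
    (h : ∀ φ : ℝ → ℝ, ContDiff ℝ ∞ φ → HasCompactSupport φ → tsupport φ ⊆ Ioo 0 T →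
      ∫ t in 0..T, deriv φ t * u t = 0) :
    ∃ c, ∀ t ∈ Icc 0 T, u t = c := by
  -- The radius `T / 4` around `T / 2` keeps the support of the bump inside `(0, T)`.
  let B : ContDiffBump (T / 2) := ⟨T / 8, T / 4, by positivity, by linarith⟩
  let η : ℝ → ℝ := B.normed volume
  have hη : ContDiff ℝ ∞ η := B.contDiff_normed
  have hηi : ∫ t, η t = 1 := B.integral_normed
  have hηs : tsupport η = Metric.closedBall (T / 2) (T / 4) := B.tsupport_normed_eq
  have hηT : tsupport η ⊆ Ioo 0 T := by
    rw [hηs, Real.closedBall_eq_Icc]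
    intro t ht
    constructor <;> linarith [ht.1, ht.2]
  have hηc : HasCompactSupport η := B.hasCompactSupport_normed
  have hii : ∀ g : ℝ → ℝ, Continuous g → IntervalIntegrable (fun t => g t * u t) volume 0 T := by
    intro g hg
    refine ContinuousOn.intervalIntegrable ?_
    rw [uIcc_of_le hT.le]
    exact hg.continuousOn.mul hu
  refine ⟨∫ t in 0..T, η t * u t, ?_⟩
  set c := ∫ t in 0..T, η t * u t with hc
  have hae : ∀ᵐ t, t ∈ Ioo 0 T → u t - c = 0 := by
    refine isOpen_Ioo.ae_eq_zero_of_integral_contDiff_smul_eq_zero ?_ ?_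
    · exact ((hu.mono Ioo_subset_Icc_self).sub continuousOn_const).locallyIntegrableOn
        measurableSet_Ioo
    · intro g hg hgc hgT
      have hgsub : Function.support g ⊆ Ioc 0 T := fun t ht =>
        Ioo_subset_Ioc_self (hgT (subset_tsupport g ht))
      have hgi : Integrable g := hg.continuous.integrable_of_hasCompactSupport hgc
      have hηint : Integrable η := hη.continuous.integrable_of_hasCompactSupport hηc
      have hsupp : Function.support (fun t => g t - (∫ t, g t) * η t) ⊆ tsupport g ∪ tsupport η := by
        intro t ht
        by_contra hcon
        simp only [mem_union, not_or] at hcon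
        refine ht ?_
        simp [image_eq_zero_of_notMem_tsupport hcon.1, image_eq_zero_of_notMem_tsupport hcon.2]
      have h0 : ∫ t, (g t - (∫ t, g t) * η t) = 0 := by
        rw [integral_sub hgi (hηint.const_mul _), integral_const_mul, hηi]
        ring
      -- Subtracting `(∫ g) η` gives mean zero, so the difference is the derivative of a test
      -- function.
      obtain ⟨φ, hφ, hφc, hφT, hφd⟩ := exists_test_function_deriv_eq (T := T)
        (h := fun t => g t - (∫ t, g t) * η t) (K := tsupport g ∪ tsupport η)
        (hg.sub (contDiff_const.mul hη)) (hgc.isCompact.union hηc.isCompact)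
        ⟨T / 2, Or.inr (by rw [hηs]; exact Metric.mem_closedBall_self (by positivity))⟩
        (union_subset hgT hηT) hsupp h0
      · have h1 := h φ hφ hφc hφT
        rw [hφd] at h1
        have h2 : ∫ t in 0..T, (g t - (∫ t, g t) * η t) * u t
            = (∫ t in 0..T, g t * u t) - (∫ t, g t) * c := by
          rw [hc, ← intervalIntegral.integral_const_mul, ← intervalIntegral.integral_sub
            (hii g hg.continuous) ((hii η hη.continuous).const_mul _)]
          congr 1
          ext t
          ring
        rw [h2] at h1
        have h3 : ∫ t, g t = ∫ t in 0..T, g t :=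
          (intervalIntegral.integral_eq_integral_of_support_subset hgsub).symm
        have h4 : ∫ t, g t • (u t - c) = ∫ t in 0..T, g t * (u t - c) := by
          refine (intervalIntegral.integral_eq_integral_of_support_subset ?_).symm
          exact (Function.support_mul_subset_left _ _).trans hgsub
        rw [h4]
        simp only [mul_sub]
        rw [intervalIntegral.integral_sub (hii g hg.continuous)
          ((hg.continuous.intervalIntegrable _ _).mul_const c),
          intervalIntegral.integral_mul_const, ← h3]
        exact h1
  have heq : u =ᵐ[volume.restrict (Icc 0 T)] fun _ => c := by
    rw [← restrict_Ioo_eq_restrict_Icc, EventuallyEq, ae_restrict_iff' measurableSet_Ioo]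
    filter_upwards [hae] with t ht h'
    exact sub_eq_zero.1 (ht h')
  exact fun t ht => Measure.eqOn_Icc_of_ae_eq volume hT.ne heq hu continuousOn_const ht

/-! ### Coordinates on the junction -/

namespace Junction

variable {N : ℕ}

lemma dist_eq_sum (x y : Junction N) : dist x y = ∑ k, |x.val k - y.val k| :=
  geoDist_eq_sum x y

lemma abs_sub_le_dist (x y : Junction N) (k : Fin N) : |x.val k - y.val k| ≤ dist x y := by
  rw [dist_eq_sum]
  exact Finset.single_le_sum (f := fun k => |x.val k - y.val k|) (fun _ _ => abs_nonneg _)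
    (Finset.mem_univ k)

lemma continuous_coord (k : Fin N) : Continuous fun x : Junction N => x.val k := by
  refine LipschitzWith.continuous (K := 1) (LipschitzWith.of_dist_le_mul fun x y => ?_)
  simpa [Real.dist_eq] using abs_sub_le_dist x y k

lemma continuous_val : Continuous (Junction.val : Junction N → EuclideanSpace ℝ (Fin N)) := by
  have h : Continuous fun x : Junction N => (WithLp.ofLp x.val : Fin N → ℝ) :=
    continuous_pi fun k => continuous_coord k
  exact (PiLp.continuous_toLp 2 _).comp h

lemma tendsto_iff_coord {ι : Type*} {l : Filter ι} {u : ι → Junction N} {x : Junction N} :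
    Tendsto u l (𝓝 x) ↔ ∀ k, Tendsto (fun n => (u n).val k) l (𝓝 (x.val k)) := by
  refine ⟨fun h k => ((continuous_coord k).tendsto x).comp h, fun h => ?_⟩
  rw [tendsto_iff_dist_tendsto_zero]
  simp only [dist_eq_sum]
  have : Tendsto (fun n => ∑ k, |(u n).val k - x.val k|) l (𝓝 (∑ k : Fin N, (0 : ℝ))) := by
    refine tendsto_finsetSum _ fun k _ => ?_
    have := ((h k).sub_const (x.val k)).abs
    simpa using this
  simpa using this

/-- Both topologies are those of coordinatewise convergence. The embedding makes the junction second
countable, as the comparison of weak and Lévy–Prokhorov convergence requires. -/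
lemma isEmbedding_val :
    IsEmbedding (Junction.val : Junction N → EuclideanSpace ℝ (Fin N)) := by
  refine ⟨isInducing_iff_nhds.2 fun x => le_antisymm ?_ ?_, fun x y h => Junction.ext h⟩
  · exact (continuous_val.tendsto x).le_comap
  · have h : Tendsto (id : Junction N → Junction N) (comap val (𝓝 x.val)) (𝓝 x) := by
      rw [tendsto_iff_coord]
      intro k
      exact (((EuclideanSpace.proj k : EuclideanSpace ℝ (Fin N) →L[ℝ] ℝ).continuous.tendsto
        x.val).comp tendsto_comap)
    exact h

instance : SecondCountableTopology (Junction N) := isEmbedding_val.secondCountableTopology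

lemma coord_nonneg (x : Junction N) (k : Fin N) : 0 ≤ x.val k := by
  obtain ⟨i, r, hr, hx⟩ := x.mem
  rw [hx]
  by_cases h : k = i <;> simp [h, hr]

lemma coord_eq_zero_of_pos {x : Junction N} {i k : Fin N} (hi : 0 < x.val i) (hk : k ≠ i) :
    x.val k = 0 := by
  obtain ⟨j, r, hr, hx⟩ := x.mem
  have hij : i = j := by
    by_contra hne
    rw [hx] at hi
    simp [hne] at hi
  subst hij
  rw [hx]
  simp [hk]

lemma val_eq_single {x : Junction N} {i : Fin N} (hi : 0 < x.val i) :
    x.val = EuclideanSpace.single i (x.val i) := by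
  ext k
  by_cases hk : k = i
  · subst hk
    simp
  · simp [hk, coord_eq_zero_of_pos hi hk]

lemma norm_val_of_pos {x : Junction N} {i : Fin N} (hi : 0 < x.val i) : ‖x.val‖ = x.val i := by
  rw [val_eq_single hi]
  simp [hi.le]

lemma mem_edge_diff_zero_iff {x : Junction N} {i : Fin N} :
    x.val ∈ edge i \ {0} ↔ 0 < x.val i := by
  constructor
  · rintro ⟨⟨r, hr, hx⟩, h0⟩
    refine lt_of_le_of_ne (x.coord_nonneg i) fun h => h0 ?_
    have : r = 0 := by rw [hx] at h; simpa using h.symm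
    rw [mem_singleton_iff, hx, this]
    ext k
    simp
  · intro hi
    refine ⟨⟨x.val i, hi.le, val_eq_single hi⟩, fun h => ?_⟩
    rw [mem_singleton_iff] at h
    rw [h] at hi
    simp at hi

lemma eq_zero_or_exists_pos (x : Junction N) : x.val = 0 ∨ ∃ i, 0 < x.val i := by
  by_cases h : ∃ i, 0 < x.val i
  · exact Or.inr h
  · push Not at h
    left
    ext k
    exact le_antisymm (h k) (x.coord_nonneg k)

lemma coord_le_norm (x : Junction N) (k : Fin N) : x.val k ≤ ‖x.val‖ :=
  (le_abs_self _).trans (PiLp.norm_apply_le x.val k)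

end Junction

/-! ### Absolutely continuous coordinates -/

lemma AbsolutelyContinuousOnInterval.of_dist_le {a b : ℝ} {ι : Type*} {F : Finset ι}
    {g : ι → ℝ → ℝ} {f : ℝ → ℝ} (hg : ∀ k ∈ F, AbsolutelyContinuousOnInterval (g k) a b)
    (h : ∀ s ∈ uIcc a b, ∀ t ∈ uIcc a b, dist (f s) (f t) ≤ ∑ k ∈ F, dist (g k s) (g k t)) :
    AbsolutelyContinuousOnInterval f a b := by
  have hlim := tendsto_finsetSum F hg
  simp only [Finset.sum_const_zero] at hlim
  refine squeeze_zero' (Eventually.of_forall fun E => Finset.sum_nonneg fun i _ => dist_nonneg)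
    ?_ hlim
  filter_upwards [mem_inf_of_right (mem_principal_self _)] with E hE
  rw [Finset.sum_comm]
  exact Finset.sum_le_sum fun i hi => h _ (hE.1 i hi).1 _ (hE.1 i hi).2

lemma absolutelyContinuousOnInterval_id (a b : ℝ) :
    AbsolutelyContinuousOnInterval (fun t => t) a b :=
  (LipschitzWith.id.lipschitzOnWith (s := uIcc a b)).absolutelyContinuousOnInterval

lemma integrable_coe_val {N : ℕ} {T : ℝ} (y : Traj N T) {g : Icc (0 : ℝ) T → ℝ} (hg : Continuous g) :
    Integrable (fun s => g s • (y s).val) (leb T) := by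
  have hc : Continuous fun s => g s • (y s).val :=
    hg.smul (Junction.continuous_val.comp y.continuous)
  exact hc.integrable_of_hasCompactSupport (HasCompactSupport.of_compactSpace _)

section coord

variable {N : ℕ} {T p : ℝ} [hT : Fact (0 < T)]

/-- The `i`-th coordinate of a trajectory, as a function on the real line, constant outside
`[0,T]`. -/
noncomputable def coord (y : Traj N T) (i : Fin N) (t : ℝ) : ℝ :=
  (y (projIcc 0 T hT.out.le t)).val i

@[simp] lemma coord_coe (y : Traj N T) (i : Fin N) (s : Icc (0 : ℝ) T) :
    coord y i s = (y s).val i := by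
  simp [coord]

lemma coord_of_mem (y : Traj N T) (i : Fin N) {t : ℝ} (ht : t ∈ Icc 0 T) :
    coord y i t = (y ⟨t, ht⟩).val i := by
  simp [coord, projIcc_of_mem, ht]

lemma coord_nonneg (y : Traj N T) (i : Fin N) (t : ℝ) : 0 ≤ coord y i t :=
  Junction.coord_nonneg _ i

lemma continuous_coord (y : Traj N T) (i : Fin N) : Continuous (coord y i) :=
  (Junction.continuous_coord i).comp (y.continuous.comp continuous_projIcc)

/-- The derivative of a trajectory, coordinate by coordinate. -/
noncomputable def coordDeriv (y : Traj N T) (s : Icc (0 : ℝ) T) : EuclideanSpace ℝ (Fin N) :=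
  WithLp.toLp 2 fun i => deriv (coord y i) s

@[simp] lemma coordDeriv_apply (y : Traj N T) (s : Icc (0 : ℝ) T) (i : Fin N) :
    coordDeriv y s i = deriv (coord y i) s := rfl

/-- After an integration by parts, the coordinate minus the primitive of `v` is orthogonal to every
`φ'`, hence constant by du Bois-Reymond. The projection `projIcc` only extends `v` from `[0,T]` to
the line. -/
lemma IsWeakDeriv.exists_coord_eq {y : Traj N T} {v : Icc (0 : ℝ) T → EuclideanSpace ℝ (Fin N)}
    (h : IsWeakDeriv y v) (i : Fin N) :
    IntervalIntegrable (fun t => v (projIcc 0 T hT.out.le t) i) volume 0 T ∧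
    ∃ c, ∀ t ∈ Icc 0 T,
      coord y i t = c + ∫ s in 0..t, v (projIcc 0 T hT.out.le s) i := by
  set w : ℝ → ℝ := fun t => v (projIcc 0 T hT.out.le t) i with hw
  have hwi : IntervalIntegrable w volume 0 T := by
    rw [← integrable_leb_iff hT.out.le]
    simpa [hw] using (integrable_piLp_iff.1 h.1) i
  refine ⟨hwi, ?_⟩
  have hAC := hwi.absolutelyContinuousOnInterval_intervalIntegral (c := 0) left_mem_uIcc
  have hWc : ContinuousOn (fun t => ∫ s in 0..t, w s) (Icc 0 T) := by
    simpa [uIcc_of_le hT.out.le] using hAC.continuousOn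
  suffices hmain : ∀ φ : ℝ → ℝ, ContDiff ℝ ∞ φ → HasCompactSupport φ → tsupport φ ⊆ Ioo 0 T →
      ∫ t in 0..T, deriv φ t * (coord y i t - ∫ s in 0..t, w s) = 0 by
    obtain ⟨c, hc⟩ := exists_eqOn_const_of_integral_deriv_mul_eq_zero hT.out
      ((continuous_coord y i).continuousOn.sub hWc) hmain
    exact ⟨c, fun t ht => by have := hc t ht; simp only [Pi.sub_apply] at this; linarith⟩
  intro φ hφ hφc hφT
  have hφ0 : φ 0 = 0 := image_eq_zero_of_notMem_tsupport fun h0 => lt_irrefl _ (hφT h0).1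
  have hφT' : φ T = 0 := image_eq_zero_of_notMem_tsupport fun h0 => lt_irrefl _ (hφT h0).2
  have hφAC : AbsolutelyContinuousOnInterval φ 0 T :=
    (hφ.of_le (by norm_cast)).contDiffOn.absolutelyContinuousOnInterval
  have hdc : Continuous (deriv φ) := hφ.continuous_deriv (by norm_cast)
  have h1 := congrArg (fun z : EuclideanSpace ℝ (Fin N) => z i) (h.2 φ hφ hφc hφT)
  simp only [PiLp.neg_apply] at h1
  have hb : Integrable (fun s : Icc (0 : ℝ) T => φ s • v s) (leb T) := by
    obtain ⟨M, hM⟩ := hφ.continuous.bounded_above_of_compact_support hφc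
    exact h.1.bdd_smul M (hφ.continuous.comp continuous_subtype_val).aestronglyMeasurable
      (Eventually.of_forall fun s => hM s)
  rw [eval_integral_piLp (integrable_piLp_iff.1
      (integrable_coe_val y (g := fun s => deriv φ s) (hdc.comp continuous_subtype_val))),
    eval_integral_piLp (integrable_piLp_iff.1 hb)] at h1
  have h2 : ∫ t in 0..T, deriv φ t * coord y i t = - ∫ t in 0..T, φ t * w t := by
    rw [← integral_leb hT.out.le, ← integral_leb hT.out.le]
    simpa [hw] using h1
  have h3 := hφAC.integral_mul_deriv_eq_deriv_mul hAC
  have h4 : ∫ t in 0..T, φ t * deriv (fun t => ∫ s in 0..t, w s) t = ∫ t in 0..T, φ t * w t := by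
    refine intervalIntegral.integral_congr_ae ?_
    filter_upwards [hwi.ae_hasDerivAt_integral] with t ht htm
    rw [(ht (uIoc_subset_uIcc htm) 0 left_mem_uIcc).deriv]
  rw [h4, hφ0, hφT'] at h3
  have h5 : ∀ g : ℝ → ℝ, ContinuousOn g (Icc 0 T) →
      IntervalIntegrable (fun t => deriv φ t * g t) volume 0 T := fun g hg =>
    ContinuousOn.intervalIntegrable (by
      rw [uIcc_of_le hT.out.le]; exact hdc.continuousOn.mul hg)
  simp only [mul_sub]
  rw [intervalIntegral.integral_sub (h5 _ (continuous_coord y i).continuousOn) (h5 _ hWc), h2, h3]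
  ring

lemma IsWeakDeriv.absolutelyContinuous_coord {y : Traj N T}
    {v : Icc (0 : ℝ) T → EuclideanSpace ℝ (Fin N)} (h : IsWeakDeriv y v) (i : Fin N) :
    AbsolutelyContinuousOnInterval (coord y i) 0 T := by
  obtain ⟨hwi, c, hc⟩ := h.exists_coord_eq i
  refine AbsolutelyContinuousOnInterval.of_dist_le (F := {()}) (fun _ _ =>
    hwi.absolutelyContinuousOnInterval_intervalIntegral (c := 0) left_mem_uIcc) fun s hs t ht => ?_
  rw [uIcc_of_le hT.out.le] at hs ht
  rw [hc s hs, hc t ht]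
  simp

lemma IsWeakDeriv.ae_eq_coordDeriv {y : Traj N T}
    {v : Icc (0 : ℝ) T → EuclideanSpace ℝ (Fin N)} (h : IsWeakDeriv y v) :
    v =ᵐ[leb T] coordDeriv y := by
  have h1 : ∀ i, ∀ᵐ s : Icc (0 : ℝ) T ∂leb T,
      v (projIcc 0 T hT.out.le s) i = deriv (coord y i) s := by
    intro i
    rw [ae_leb_iff (P := fun t => v (projIcc 0 T hT.out.le t) i = deriv (coord y i) t)]
    obtain ⟨hwi, c, hc⟩ := h.exists_coord_eq i
    -- The endpoints are discarded: the extended coordinate is constant outside `[0,T]`, so its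
    -- two-sided derivative there need not be the one of the primitive.
    have h0 : ∀ᵐ t : ℝ, t ≠ 0 := by simp [ae_iff, measure_singleton]
    have hT0 : ∀ᵐ t : ℝ, t ≠ T := by simp [ae_iff, measure_singleton]
    filter_upwards [hwi.ae_hasDerivAt_integral, h0, hT0] with t ht ht0 htT htm
    have h2 := (ht (by rwa [uIcc_of_le hT.out.le]) 0 left_mem_uIcc).const_add c
    have h3 : coord y i =ᶠ[𝓝 t] fun t => c + ∫ s in 0..t, v (projIcc 0 T hT.out.le s) i := by
      filter_upwards [Icc_mem_nhds (lt_of_le_of_ne htm.1 ht0.symm) (lt_of_le_of_ne htm.2 htT)]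
        with r hr using hc r hr
    exact ((h2.congr_of_eventuallyEq h3).deriv).symm
  filter_upwards [ae_all_iff.2 h1] with s hs
  ext i
  simpa using hs i

lemma isWeakDeriv_coordDeriv {y : Traj N T}
    (h : ∀ i, AbsolutelyContinuousOnInterval (coord y i) 0 T) : IsWeakDeriv y (coordDeriv y) := by
  have hi : Integrable (coordDeriv y) (leb T) := integrable_piLp_iff.2 fun i =>
    (integrable_leb_iff hT.out.le).2 (h i).intervalIntegrable_deriv
  refine ⟨hi, fun φ hφ hφc hφT => ?_⟩
  have hφ0 : φ 0 = 0 := image_eq_zero_of_notMem_tsupport fun h0 => lt_irrefl _ (hφT h0).1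
  have hφT' : φ T = 0 := image_eq_zero_of_notMem_tsupport fun h0 => lt_irrefl _ (hφT h0).2
  have hφAC : AbsolutelyContinuousOnInterval φ 0 T :=
    (hφ.of_le (by norm_cast)).contDiffOn.absolutelyContinuousOnInterval
  have hdc : Continuous (deriv φ) := hφ.continuous_deriv (by norm_cast)
  have hb : Integrable (fun s : Icc (0 : ℝ) T => φ s • coordDeriv y s) (leb T) := by
    obtain ⟨M, hM⟩ := hφ.continuous.bounded_above_of_compact_support hφc
    exact hi.bdd_smul M (hφ.continuous.comp continuous_subtype_val).aestronglyMeasurable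
      (Eventually.of_forall fun s => hM s)
  ext i
  rw [PiLp.neg_apply, eval_integral_piLp (integrable_piLp_iff.1
      (integrable_coe_val y (g := fun s => deriv φ s) (hdc.comp continuous_subtype_val))),
    eval_integral_piLp (integrable_piLp_iff.1 hb)]
  have h3 := hφAC.integral_mul_deriv_eq_deriv_mul (h i)
  rw [hφ0, hφT', ← integral_leb hT.out.le, ← integral_leb hT.out.le] at h3
  simp only [PiLp.smul_apply, smul_eq_mul, coordDeriv_apply, coord_coe] at h3 ⊢
  linarith

/-- Whatever weak derivative `Classical.epsilon` selects, it agrees almost everywhere with the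
classical one. -/
lemma weakDeriv_ae_eq {y : Traj N T}
    (h : ∀ i, AbsolutelyContinuousOnInterval (coord y i) 0 T) :
    weakDeriv y =ᵐ[leb T] coordDeriv y :=
  (Classical.epsilon_spec (p := IsWeakDeriv y) ⟨_, isWeakDeriv_coordDeriv h⟩).ae_eq_coordDeriv

/-- Membership in `Γ` becomes a condition on absolutely continuous coordinates and their classical
derivatives. From here on `coordDeriv`, an honestly measurable function, stands for the weak
derivative. -/
lemma mem_Gam_iff {y : Traj N T} :
    y ∈ Gam N T p ↔ (∀ i, AbsolutelyContinuousOnInterval (coord y i) 0 T) ∧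
      MemLp (coordDeriv y) (ENNReal.ofReal p) (leb T) :=
  ⟨fun ⟨_, hv, hp⟩ => ⟨hv.absolutelyContinuous_coord, hp.ae_eq hv.ae_eq_coordDeriv⟩,
    fun h => ⟨_, isWeakDeriv_coordDeriv h.1, h.2⟩⟩

lemma ae_hasDerivAt_coord {y : Traj N T}
    (h : ∀ i, AbsolutelyContinuousOnInterval (coord y i) 0 T) :
    ∀ᵐ s : Icc (0 : ℝ) T ∂leb T, ∀ i, HasDerivAt (coord y i) (coordDeriv y s i) s := by
  refine ae_all_iff.2 fun i => ?_
  have := ae_leb_iff (P := fun t => HasDerivAt (coord y i) (deriv (coord y i) t) t) (T := T)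
  refine this.2 ?_
  filter_upwards [(h i).ae_differentiableAt] with t ht htm
  exact (ht (by rwa [uIcc_of_le hT.out.le])).hasDerivAt

/-- The derivative of a coordinate vanishes almost everywhere where the coordinate does. -/
lemma coordDeriv_eq_zero {y : Traj N T} {s : Icc (0 : ℝ) T} {i : Fin N}
    (h : HasDerivAt (coord y i) (coordDeriv y s i) s) (h0 : (y s).val i = 0) :
    coordDeriv y s i = 0 := by
  -- Coordinates are nonnegative, so a zero is a minimum.
  refine IsLocalMin.hasDerivAt_eq_zero (f := coord y i) (a := s)
    (Eventually.of_forall fun t => ?_) h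
  rw [coord_coe, h0]
  exact coord_nonneg y i t

lemma abs_coord_sub_le {y : Traj N T}
    (h : ∀ i, AbsolutelyContinuousOnInterval (coord y i) 0 T) (i : Fin N) {a b : ℝ}
    (ha : a ∈ Icc 0 T) (hb : b ∈ Icc 0 T) :
    |coord y i a - coord y i b| ≤
      ∫ s in Subtype.val ⁻¹' (uIoc a b), ‖coordDeriv y s‖ ∂leb T := by
  have hi := (isWeakDeriv_coordDeriv h).1
  have hab : AbsolutelyContinuousOnInterval (coord y i) a b :=
    (h i).mono (uIcc_subset_uIcc (by rwa [uIcc_of_le hT.out.le]) (by rwa [uIcc_of_le hT.out.le]))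
  rw [abs_sub_comm, ← hab.integral_deriv_eq_sub, ← Real.norm_eq_abs,
    intervalIntegral.norm_intervalIntegral_eq, ← setIntegral_leb_uIoc _ ha hb]
  exact norm_integral_le_of_norm_le hi.norm.integrableOn
    (Eventually.of_forall fun s => PiLp.norm_apply_le (coordDeriv y s) i)

end coord

/-! ### Hölder's inequality on a set -/

lemma setIntegral_norm_le_of_eLpNorm_le {α E : Type*} [MeasurableSpace α] {ν : Measure α}
    [IsFiniteMeasure ν] [NormedAddCommGroup E] {v : α → E} {p C : ℝ} (hp : 1 < p) (hC : 0 ≤ C)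
    (hv : AEStronglyMeasurable v ν) (h : eLpNorm v (ENNReal.ofReal p) ν ≤ ENNReal.ofReal C)
    (A : Set α) : ∫ s in A, ‖v s‖ ∂ν ≤ C * (ν.real A) ^ (1 - 1 / p) := by
  have h1 := eLpNorm_le_eLpNorm_mul_rpow_measure_univ (μ := ν.restrict A) (p := 1)
    (q := ENNReal.ofReal p) (by simpa using hp.le) hv.restrict
  have h2 : eLpNorm v (ENNReal.ofReal p) (ν.restrict A) ≤ ENNReal.ofReal C :=
    (eLpNorm_mono_measure v Measure.restrict_le_self).trans h
  rw [integral_norm_eq_lintegral_enorm hv.restrict]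
  rw [eLpNorm_one_eq_lintegral_enorm, ENNReal.toReal_ofReal (by linarith), ENNReal.toReal_one,
    Measure.restrict_apply_univ, div_one] at h1
  have h3 := h1.trans (mul_le_mul_left h2 _)
  have hpos : 0 ≤ 1 - 1 / p := by
    rw [sub_nonneg, div_le_one (by linarith)]
    exact hp.le
  have h4 := ENNReal.toReal_mono
    (ENNReal.mul_ne_top ENNReal.ofReal_ne_top
      (ENNReal.rpow_ne_top_of_nonneg hpos (measure_ne_top ν A))) h3
  rwa [ENNReal.toReal_mul, ENNReal.toReal_ofReal hC, ← ENNReal.toReal_rpow] at h4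

/-! ### Weak convergence and the Kantorovich–Rubinstein distance -/

lemma integrableOn_measureReal_of_antitone {X : Type*} [MeasurableSpace X] (ν : Measure X) [IsFiniteMeasure ν] {S : ℝ → Set X}
    (hS : Antitone S) (a b : ℝ) : IntegrableOn (fun t => ν.real (S t)) (Ioc a b) := by
  refine Measure.integrableOn_of_bounded (M := ν.real univ) measure_Ioc_lt_top.ne ?_ ?_
  · exact (Measurable.ennreal_toReal (Antitone.measurable fun s t h =>
      measure_mono (hS h))).aestronglyMeasurable
  · refine Eventually.of_forall fun t => ?_
    simp only [Real.norm_eq_abs, abs_of_nonneg measureReal_nonneg]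
    exact measureReal_mono (subset_univ _)

section kantorovich

variable {X : Type*} [PseudoMetricSpace X] [MeasurableSpace X] [OpensMeasurableSpace X]

/-- Layer-cake formula: the `ε`-thickening of `{f ≥ t}` lies in `{f + ε ≥ t}` for a `1`-Lipschitz
`f`, so its measures integrate in `t` to at most `∫ (f + ε) dQ`. -/
lemma integral_le_integral_add_of_levyProkhorovEDist_lt {P Q : Measure X}
    [IsProbabilityMeasure P] [IsProbabilityMeasure Q] {ε : ℝ} (hε : 0 < ε)
    (h : levyProkhorovEDist P Q < ENNReal.ofReal ε) (f : X →ᵇ ℝ) (hf : LipschitzWith 1 f)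
    (h0 : ∀ x, 0 ≤ f x) : ∫ x, f x ∂P ≤ ∫ x, f x ∂Q + ε + ε * ‖f‖ := by
  have h1 := BoundedContinuousFunction.integral_le_of_levyProkhorovEDist_lt P Q hε h f
    (Eventually.of_forall h0)
  let g : X →ᵇ ℝ := f + BoundedContinuousFunction.const X ε
  have hg : ∀ x, g x = f x + ε := fun x => rfl
  have hfg : ‖f‖ ≤ ‖g‖ := by
    refine (BoundedContinuousFunction.norm_le (norm_nonneg _)).2 fun x => ?_
    have := BoundedContinuousFunction.apply_le_norm g x
    rw [hg] at this
    rw [Real.norm_eq_abs, abs_of_nonneg (h0 x)]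
    linarith
  have h2 := BoundedContinuousFunction.integral_eq_integral_meas_le g Q
    (Eventually.of_forall fun x => by simpa [hg] using add_nonneg (h0 x) hε.le)
  have h3 : ∫ x, g x ∂Q = ∫ x, f x ∂Q + ε := by
    simp only [hg]
    rw [integral_add (f.integrable Q) (integrable_const _)]
    simp
  have hanti : Antitone fun t : ℝ => {a | t ≤ g a} := fun s t hst a ha => hst.trans ha
  have hanti' : Antitone fun t : ℝ => Metric.thickening ε {a | t ≤ f a} := fun s t hst =>
    Metric.thickening_subset_of_subset ε fun a ha => hst.trans ha
  have h4 : ∫ t in Ioc 0 ‖f‖, Q.real (Metric.thickening ε {a | t ≤ f a})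
      ≤ ∫ t in Ioc 0 ‖g‖, Q.real {a | t ≤ g a} := by
    refine (setIntegral_mono (integrableOn_measureReal_of_antitone Q hanti' _ _)
      (integrableOn_measureReal_of_antitone Q hanti _ _) fun t => ?_).trans
      (setIntegral_mono_set (integrableOn_measureReal_of_antitone Q hanti _ _)
        (Eventually.of_forall fun t => measureReal_nonneg)
        (Ioc_subset_Ioc_right hfg).eventuallyLE)
    refine measureReal_mono fun a ha => ?_
    obtain ⟨b, hb, hab⟩ := Metric.mem_thickening_iff.1 ha
    have hd := hf.dist_le_mul a b
    simp only [NNReal.coe_one, one_mul, Real.dist_eq] at hd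
    have := (abs_le.1 hd).1
    simp only [mem_ofPred_eq, hg] at hb ⊢
    linarith
  linarith

/-- On probability measures carried by a fixed ball, the Kantorovich–Rubinstein distance is
controlled by the Lévy–Prokhorov distance. -/
lemma P1.dist_le_of_levyProkhorovEDist_lt {m n : P1 X} {x₀ : X} {R ε : ℝ} (hε : 0 < ε)
    (h : levyProkhorovEDist (m.toProb : Measure X) n.toProb < ENNReal.ofReal ε)
    (hR : 0 ≤ R) (hm : ∀ᵐ x ∂(m.toProb : Measure X), dist x x₀ ≤ R)
    (hn : ∀ᵐ x ∂(n.toProb : Measure X), dist x x₀ ≤ R) : dist m n ≤ ε + ε * (2 * R) := by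
  have : Nonempty {f : X → ℝ // LipschitzWith 1 f} := ⟨⟨fun _ => 0, LipschitzWith.const' 0⟩⟩
  refine ciSup_le fun f => ?_
  -- On the ball of radius `R` about `x₀` the values of `f - f x₀ + R` lie in `[0, 2R]`. The clamp
  -- therefore changes no integral, but makes the test function bounded and nonnegative.
  have hlip : LipschitzWith 1 fun x => max (min (f.1 x - f.1 x₀ + R) (2 * R)) 0 := by
    refine LipschitzWith.max_const (LipschitzWith.min_const ?_ _) _
    refine LipschitzWith.of_dist_le_mul fun x y => ?_
    have := f.2.dist_le_mul x y
    simpa [Real.dist_eq] using this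
  have hb : ∀ x, ‖max (min (f.1 x - f.1 x₀ + R) (2 * R)) 0‖ ≤ 2 * R := by
    intro x
    rw [Real.norm_eq_abs, abs_of_nonneg (le_max_right _ _)]
    exact max_le (min_le_right _ _) (by positivity)
  let g : X →ᵇ ℝ := BoundedContinuousFunction.ofNormedAddCommGroup _ hlip.continuous _ hb
  have hgn : ‖g‖ ≤ 2 * R := BoundedContinuousFunction.norm_ofNormedAddCommGroup_le _ (by positivity) hb
  have key : ∀ k : P1 X, (∀ᵐ x ∂(k.toProb : Measure X), dist x x₀ ≤ R) →
      ∫ x, g x ∂(k.toProb : Measure X) = k.integ f.1 - f.1 x₀ + R := by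
    intro k hk
    have h1 : ∫ x, g x ∂(k.toProb : Measure X)
        = ∫ x, (f.1 x + (- f.1 x₀ + R)) ∂(k.toProb : Measure X) := by
      refine integral_congr_ae ?_
      filter_upwards [hk] with x hx
      have hd := f.2.dist_le_mul x x₀
      simp only [NNReal.coe_one, one_mul, Real.dist_eq] at hd
      have hd' := abs_le.1 (hd.trans hx)
      change max (min (f.1 x - f.1 x₀ + R) (2 * R)) 0 = _
      rw [min_eq_left (by linarith), max_eq_left (by linarith)]
      ring
    rw [h1, integral_add (k.integrable_lip f.2) (integrable_const _)]
    simp [P1.integ]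
    ring
  have h1 := integral_le_integral_add_of_levyProkhorovEDist_lt hε h g hlip
    (fun x => le_max_right _ _)
  rw [key m hm, key n hn] at h1
  have := mul_le_mul_of_nonneg_left hgn hε.le
  linarith

lemma P1.tendsto_of_tendsto_toProb [SecondCountableTopology X] {ι : Type*} {l : Filter ι}
    {ms : ι → P1 X} {m : P1 X} (h : Tendsto (fun n => (ms n).toProb) l (𝓝 m.toProb)) {x₀ : X}
    {R : ℝ} (hR : 0 ≤ R) (hm : ∀ᵐ x ∂(m.toProb : Measure X), dist x x₀ ≤ R)
    (hms : ∀ n, ∀ᵐ x ∂((ms n).toProb : Measure X), dist x x₀ ≤ R) :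
    Tendsto ms l (𝓝 m) := by
  have h1 := (LevyProkhorov.continuous_ofMeasure_probabilityMeasure.tendsto m.toProb).comp h
  rw [tendsto_iff_edist_tendsto_0] at h1
  rw [Metric.tendsto_nhds]
  intro δ hδ
  -- The choice makes `ε + ε * (2 * R)` equal to `δ / 2`.
  have hε : 0 < δ / 2 / (1 + 2 * R) := by positivity
  filter_upwards [h1.eventually (gt_mem_nhds (ENNReal.ofReal_pos.2 hε))] with n hn
  refine (P1.dist_le_of_levyProkhorovEDist_lt hε hn hR (hms n) hm).trans_lt ?_
  have : δ / 2 / (1 + 2 * R) + δ / 2 / (1 + 2 * R) * (2 * R) = δ / 2 := by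
    field_simp
  linarith

end kantorovich

/-! ### Marginals of measures on trajectories -/

lemma leb_real_uIoc {T a b : ℝ} (ha : a ∈ Icc 0 T) (hb : b ∈ Icc 0 T) :
    (leb T).real (Subtype.val ⁻¹' (uIoc a b)) = |a - b| := by
  rw [measureReal_def, leb_preimage_coe, Measure.restrict_apply measurableSet_uIoc,
    inter_eq_left.2 (uIoc_subset_uIcc.trans (uIcc_subset_Icc ha hb)), uIoc, Real.volume_Ioc,
    ENNReal.toReal_ofReal (by simp), max_sub_min_eq_abs, abs_sub_comm]

lemma tendsto_holder_bound {T p : ℝ} (hp : 1 < p) (N : ℕ) (K : ℝ) (t : Icc (0 : ℝ) T) :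
    Tendsto (fun s : Icc (0 : ℝ) T => N * (K * |(s : ℝ) - t| ^ (1 - 1 / p))) (𝓝 t) (𝓝 0) := by
  have hpos : 0 < 1 - 1 / p := by
    rw [sub_pos, div_lt_one (by linarith)]
    exact hp
  have hc : Continuous fun s : Icc (0 : ℝ) T => N * (K * |(s : ℝ) - t| ^ (1 - 1 / p)) := by
    refine continuous_const.mul (continuous_const.mul ?_)
    exact Continuous.rpow_const (by fun_prop) fun s => Or.inr hpos.le
  have := hc.tendsto t
  simpa only [sub_self, abs_zero, Real.zero_rpow hpos.ne', mul_zero] using this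

section marginalConvergence

variable {N : ℕ} {T p C : ℝ} [hT : Fact (0 < T)]

lemma mem_GamCFrom_iff {x : Junction N} {y : Traj N T} :
    y ∈ GamCFrom T p C x ↔ y ∈ Gam N T p ∧ y (tInit T) = x ∧ (∀ s, ‖(y s).val‖ ≤ C) ∧
      eLpNorm (coordDeriv y) (ENNReal.ofReal p) (leb T) ≤ ENNReal.ofReal C := by
  constructor
  · rintro ⟨⟨h1, h2⟩, h3, h4⟩
    exact ⟨h1, h2, h3, by rwa [← eLpNorm_congr_ae (weakDeriv_ae_eq (mem_Gam_iff.1 h1).1)]⟩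
  · rintro ⟨h1, h2, h3, h4⟩
    exact ⟨⟨h1, h2⟩, h3, by rwa [eLpNorm_congr_ae (weakDeriv_ae_eq (mem_Gam_iff.1 h1).1)]⟩

lemma norm_le_of_mem_GamC (y : GamC N T p C) (t : Icc (0 : ℝ) T) : ‖(y.1 t).val‖ ≤ C := by
  obtain ⟨x, hx⟩ := mem_iUnion.1 y.2
  exact hx.2.1 t

/-- Hölder's inequality bounds each coordinate increment; the factor `N` appears because the
geodesic distance is the sum of the coordinate distances. -/
lemma dist_le_of_mem_GamC (hp : 1 < p) (hC : 0 ≤ C) (y : GamC N T p C) (s t : Icc (0 : ℝ) T) :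
    dist (y.1 s) (y.1 t) ≤ N * (C * |(s : ℝ) - t| ^ (1 - 1 / p)) := by
  obtain ⟨x, hx⟩ := mem_iUnion.1 y.2
  obtain ⟨hG, -, -, hL⟩ := mem_GamCFrom_iff.1 hx
  rw [Junction.dist_eq_sum]
  have h : ∀ i ∈ Finset.univ, |(y.1 s).val i - (y.1 t).val i|
      ≤ C * |(s : ℝ) - t| ^ (1 - 1 / p) := by
    intro i _
    have h1 := abs_coord_sub_le (mem_Gam_iff.1 hG).1 i s.2 t.2
    rw [coord_coe, coord_coe] at h1
    refine h1.trans ?_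
    rw [← leb_real_uIoc s.2 t.2]
    exact setIntegral_norm_le_of_eLpNorm_le hp hC (mem_Gam_iff.1 hG).2.1 hL _
  simpa using Finset.sum_le_card_nsmul _ _ _ h

lemma toMeasure_marginal (μ : ProbabilityMeasure (GamC N T p C)) (t : Icc (0 : ℝ) T) :
    ((marginal μ t).toProb : Measure (Junction N))
      = (μ : Measure (GamC N T p C)).map (evalAt t) :=
  ProbabilityMeasure.toMeasure_map _ (continuous_evalAt t).measurable.aemeasurable

lemma integ_marginal (μ : ProbabilityMeasure (GamC N T p C)) (t : Icc (0 : ℝ) T)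
    {f : Junction N → ℝ} (hf : Continuous f) :
    (marginal μ t).integ f = ∫ y, f (y.1 t) ∂(μ : Measure (GamC N T p C)) := by
  rw [P1.integ, toMeasure_marginal, integral_map (continuous_evalAt t).measurable.aemeasurable
    hf.aestronglyMeasurable]
  rfl

lemma dist_marginal_le (hp : 1 < p) (hC : 0 ≤ C) (μ : ProbabilityMeasure (GamC N T p C))
    (s t : Icc (0 : ℝ) T) :
    dist (marginal μ s) (marginal μ t) ≤ N * (C * |(s : ℝ) - t| ^ (1 - 1 / p)) := by
  have : Nonempty {f : Junction N → ℝ // LipschitzWith 1 f} :=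
    ⟨⟨fun _ => 0, LipschitzWith.const' 0⟩⟩
  refine ciSup_le fun f => ?_
  have hi : ∀ r : Icc (0 : ℝ) T,
      Integrable (fun y : GamC N T p C => f.1 (y.1 r)) (μ : Measure (GamC N T p C)) := fun r =>
    ((marginal μ r).integrable_lip f.2).comp_aemeasurable
      (continuous_evalAt r).measurable.aemeasurable
  rw [integ_marginal μ s f.2.continuous, integ_marginal μ t f.2.continuous,
    ← integral_sub (hi s) (hi t)]
  have h1 : ∀ y : GamC N T p C, f.1 (y.1 s) - f.1 (y.1 t)
      ≤ N * (C * |(s : ℝ) - t| ^ (1 - 1 / p)) := by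
    intro y
    have hd := f.2.dist_le_mul (y.1 s) (y.1 t)
    simp only [NNReal.coe_one, one_mul, Real.dist_eq] at hd
    exact (le_abs_self _).trans (hd.trans (dist_le_of_mem_GamC hp hC y s t))
  calc ∫ y, (f.1 (y.1 s) - f.1 (y.1 t)) ∂(μ : Measure (GamC N T p C))
      ≤ ∫ y, N * (C * |(s : ℝ) - t| ^ (1 - 1 / p)) ∂(μ : Measure (GamC N T p C)) :=
        integral_mono ((hi s).sub (hi t)) (integrable_const _) h1
    _ = _ := by simp

lemma continuous_marginal (hp : 1 < p) (hC : 0 ≤ C) (μ : ProbabilityMeasure (GamC N T p C)) :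
    Continuous (marginal μ) := by
  refine continuous_iff_continuousAt.2 fun t => tendsto_iff_dist_tendsto_zero.2 ?_
  exact squeeze_zero (fun _ => dist_nonneg) (fun s => dist_marginal_le hp hC μ s t)
    (tendsto_holder_bound hp N C t)

lemma ae_marginal_dist_le (μ : ProbabilityMeasure (GamC N T p C)) (t : Icc (0 : ℝ) T)
    (x₀ : Junction N) :
    ∀ᵐ x ∂((marginal μ t).toProb : Measure (Junction N)), dist x x₀ ≤ C + ‖x₀.val‖ := by
  rw [toMeasure_marginal, ae_map_iff (continuous_evalAt t).measurable.aemeasurable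
    (isClosed_le (by fun_prop) continuous_const).measurableSet]
  refine Eventually.of_forall fun y => (Junction.dist_le_norm_add _ _).trans ?_
  have := norm_le_of_mem_GamC y t
  rw [evalAt]
  linarith

lemma tendsto_marginal (hC : 0 ≤ C) {μs : ℕ → ProbabilityMeasure (GamC N T p C)}
    {μ : ProbabilityMeasure (GamC N T p C)} (h : Tendsto μs atTop (𝓝 μ)) (t : Icc (0 : ℝ) T) :
    Tendsto (fun n => marginal (μs n) t) atTop (𝓝 (marginal μ t)) := by
  obtain ⟨x₀⟩ : Nonempty (Junction N) :=
    ((marginal μ t).toProb : Measure (Junction N)).nonempty_of_neZero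
  refine P1.tendsto_of_tendsto_toProb (x₀ := x₀) (R := C + ‖x₀.val‖) ?_
    (add_nonneg hC (norm_nonneg _)) (ae_marginal_dist_le μ t x₀)
    fun n => ae_marginal_dist_le (μs n) t x₀
  exact ProbabilityMeasure.tendsto_map_of_tendsto_of_continuous μs μ h (continuous_evalAt t)

/-- The marginals of a weakly convergent sequence converge jointly in the index and the time. -/
lemma tendsto_marginal_prod (hp : 1 < p) (hC : 0 ≤ C)
    {μs : ℕ → ProbabilityMeasure (GamC N T p C)} {μ : ProbabilityMeasure (GamC N T p C)}
    (h : Tendsto μs atTop (𝓝 μ)) (t : Icc (0 : ℝ) T) :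
    Tendsto (fun q : ℕ × Icc (0 : ℝ) T => marginal (μs q.1) q.2) (atTop ×ˢ 𝓝 t)
      (𝓝 (marginal μ t)) := by
  rw [tendsto_iff_dist_tendsto_zero]
  have h1 := (tendsto_holder_bound hp N C t).comp
    (tendsto_snd (f := (atTop : Filter ℕ)) (g := 𝓝 t))
  have h2 := (tendsto_iff_dist_tendsto_zero.1 (tendsto_marginal hC h t)).comp
    (tendsto_fst (f := (atTop : Filter ℕ)) (g := 𝓝 t))
  have h3 := h1.add h2
  rw [add_zero] at h3
  refine squeeze_zero (fun _ => dist_nonneg) (fun q => ?_) h3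
  exact (dist_triangle _ (marginal (μs q.1) t) _).trans
    (add_le_add_left (dist_marginal_le hp hC _ _ _) _)

end marginalConvergence

/-! ### The costs -/

namespace Costs

variable {N : ℕ} (c : Costs N) {p : ℝ}

lemma running_of_pos (m : P1 (Junction N)) {x : Junction N} {i : Fin N} (hi : 0 < x.val i)
    (α : EuclideanSpace ℝ (Fin N)) : c.running m x α = c.L i m (x.val i) (α i) := by
  have h0 : x.val ≠ 0 := fun h => by simp [h] at hi
  unfold running
  simp only [Junction.mem_edge_diff_zero_iff]
  rw [if_neg h0, add_zero, Finset.sum_eq_single i]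
  · rw [if_pos hi, Junction.norm_val_of_pos hi]
  · intro k _ hk
    rw [if_neg (by rw [Junction.coord_eq_zero_of_pos hi hk]; exact lt_irrefl _)]
  · simp

lemma running_of_eq_zero (m : P1 (Junction N)) {x : Junction N} (h0 : x.val = 0)
    (α : EuclideanSpace ℝ (Fin N)) : c.running m x α = c.L0 m := by
  unfold running
  simp only [Junction.mem_edge_diff_zero_iff]
  simp [h0]

lemma terminal_of_pos (m : P1 (Junction N)) {x : Junction N} {i : Fin N} (hi : 0 < x.val i) :
    c.terminal m x = c.G i m ‖x.val‖₊ := by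
  have h0 : x.val ≠ 0 := fun h => by simp [h] at hi
  unfold terminal
  simp only [Junction.mem_edge_diff_zero_iff]
  rw [if_neg h0, add_zero, Finset.sum_eq_single i]
  · rw [if_pos hi]
  · intro k _ hk
    rw [if_neg (by rw [Junction.coord_eq_zero_of_pos hi hk]; exact lt_irrefl _)]
  · simp

lemma terminal_of_eq_zero (m : P1 (Junction N)) {x : Junction N} (h0 : x.val = 0) :
    c.terminal m x = min (c.Gstar m) (⨅ i, c.G i m 0) := by
  unfold terminal
  simp only [Junction.mem_edge_diff_zero_iff]
  simp [h0]

/-- A locally uniform limit of continuous functions may be evaluated along convergent arguments. The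
`max` extends the cost from the half-line, so that continuity is stated on a full product. -/
lemma continuous_L (i : Fin N) :
    Continuous fun q : P1 (Junction N) × ℝ × ℝ => c.L i q.1 (max q.2.1 0) q.2.2 := by
  refine continuous_iff_continuousAt.2 fun ⟨m, x, a⟩ => ?_
  set K : Set (ℝ × ℝ) := Metric.closedBall (max x 0, a) 1 ∩ Ici 0 ×ˢ univ with hK
  have hKc : IsCompact K :=
    (isCompact_closedBall _ _).inter_right (isClosed_Ici.prod isClosed_univ)
  have hunif := (c.cont_L i m K inter_subset_right hKc).1
  have hc : ContinuousWithinAt (fun z : ℝ × ℝ => c.L i m z.1 z.2) K (max x 0, a) :=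
    ((c.contDiff_L i m).continuousOn.mono inter_subset_right) _
      ⟨Metric.mem_closedBall_self zero_le_one, mem_Ici.2 (le_max_right _ _), mem_univ _⟩
  have hg : Tendsto (fun q : P1 (Junction N) × ℝ × ℝ => (max q.2.1 0, q.2.2)) (𝓝 (m, x, a))
      (𝓝[K] (max x 0, a)) := by
    have hcont : Continuous fun q : P1 (Junction N) × ℝ × ℝ => (max q.2.1 0, q.2.2) := by
      fun_prop
    refine tendsto_nhdsWithin_iff.2 ⟨hcont.tendsto (m, x, a), ?_⟩
    filter_upwards [(hcont.tendsto (m, x, a)).eventually (Metric.closedBall_mem_nhds _ one_pos)]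
      with q hq using ⟨hq, mem_Ici.2 (le_max_right _ _), mem_univ _⟩
  refine tendsto_comp_of_locally_uniform_limit_within (F := fun (q : P1 (Junction N) × ℝ × ℝ)
    (z : ℝ × ℝ) => c.L i q.1 z.1 z.2) hc hg fun u hu => ⟨K, self_mem_nhdsWithin, ?_⟩
  exact (continuous_fst.tendsto (m, x, a)).eventually (hunif u hu)

lemma tendsto_L {ι : Type*} {l : Filter ι} {i : Fin N} {ms : ι → P1 (Junction N)}
    {m : P1 (Junction N)} {xs as : ι → ℝ} {x a : ℝ} (hm : Tendsto ms l (𝓝 m))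
    (hx : Tendsto xs l (𝓝 x)) (ha : Tendsto as l (𝓝 a)) (h0 : ∀ n, 0 ≤ xs n) (h0' : 0 ≤ x) :
    Tendsto (fun n => c.L i (ms n) (xs n) (as n)) l (𝓝 (c.L i m x a)) := by
  have h := ((c.continuous_L i).tendsto (m, x, a)).comp (hm.prodMk_nhds (hx.prodMk_nhds ha))
  simpa [Function.comp_def, h0, h0'] using h

lemma continuous_iInf_fin [Nonempty (Fin N)] {X : Type*} [TopologicalSpace X] {f : Fin N → X → ℝ}
    (hf : ∀ i, Continuous (f i)) : Continuous fun x => ⨅ i, f i x := by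
  simp only [← Finset.inf'_univ_eq_ciInf]
  exact Continuous.finset_inf'_apply _ fun i _ => hf i

lemma continuous_L0 [Nonempty (Fin N)] : Continuous c.L0 := by
  refine c.Lstar.continuous.min (continuous_iInf_fin fun i => ?_)
  refine continuous_iff_continuousAt.2 fun m => ?_
  exact c.tendsto_L tendsto_id tendsto_const_nhds tendsto_const_nhds (fun _ => le_rfl) le_rfl

/-- The running cost is discontinuous at the vertex. Hypothesis `h0` excludes approximants that
reach the vertex without being there. -/
lemma tendsto_running [Nonempty (Fin N)] {ι : Type*} {l : Filter ι} {ms : ι → P1 (Junction N)}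
    {m : P1 (Junction N)} {xs : ι → Junction N} {x : Junction N}
    {αs : ι → EuclideanSpace ℝ (Fin N)} {α : EuclideanSpace ℝ (Fin N)}
    (hm : Tendsto ms l (𝓝 m)) (hx : Tendsto xs l (𝓝 x)) (hα : Tendsto αs l (𝓝 α))
    (h0 : x.val = 0 → ∀ᶠ n in l, (xs n).val = 0) :
    Tendsto (fun n => c.running (ms n) (xs n) (αs n)) l (𝓝 (c.running m x α)) := by
  rcases x.eq_zero_or_exists_pos with hz | ⟨i, hi⟩
  · rw [c.running_of_eq_zero m hz]
    refine ((c.continuous_L0.tendsto m).comp hm).congr' ?_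
    filter_upwards [h0 hz] with n hn
    exact (c.running_of_eq_zero (ms n) hn _).symm
  · rw [c.running_of_pos m hi]
    have hxi := Junction.tendsto_iff_coord.1 hx i
    have hαi : Tendsto (fun n => αs n i) l (𝓝 (α i)) :=
      ((EuclideanSpace.proj i : EuclideanSpace ℝ (Fin N) →L[ℝ] ℝ).continuous.tendsto α).comp hα
    refine (c.tendsto_L hm hxi hαi (fun n => Junction.coord_nonneg _ _) hi.le).congr' ?_
    filter_upwards [hxi.eventually (lt_mem_nhds hi)] with n hn
    exact (c.running_of_pos (ms n) hn _).symm

lemma tendsto_G {ι : Type*} {l : Filter ι} {i : Fin N} {ms : ι → P1 (Junction N)}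
    {m : P1 (Junction N)} {xs : ι → ℝ≥0} {x : ℝ≥0} (hm : Tendsto ms l (𝓝 m))
    (hx : Tendsto xs l (𝓝 x)) : Tendsto (fun n => c.G i (ms n) (xs n)) l (𝓝 (c.G i m x)) := by
  have h1 := ((c.G i).continuous.tendsto m).comp hm
  have h : Continuous fun q : (ℝ≥0 →ᵇ ℝ) × ℝ≥0 => q.1 q.2 := continuous_eval
  exact (h.tendsto (c.G i m, x)).comp (h1.prodMk_nhds hx)

lemma tendsto_terminal_zero [Nonempty (Fin N)] {ι : Type*} {l : Filter ι}
    {ms : ι → P1 (Junction N)} {m : P1 (Junction N)} {xs : ι → ℝ≥0} (hm : Tendsto ms l (𝓝 m))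
    (hx : Tendsto xs l (𝓝 0)) :
    Tendsto (fun n => min (c.Gstar (ms n)) (⨅ i, c.G i (ms n) (xs n))) l
      (𝓝 (min (c.Gstar m) (⨅ i, c.G i m 0))) := by
  have h : Continuous fun q : P1 (Junction N) × ℝ≥0 =>
      min (c.Gstar q.1) (⨅ i, c.G i q.1 q.2) := by
    refine (c.Gstar.continuous.comp continuous_fst).min (continuous_iInf_fin fun i => ?_)
    exact continuous_iff_continuousAt.2 fun q =>
      c.tendsto_G (continuous_fst.tendsto q) (continuous_snd.tendsto q)
  exact (h.tendsto (m, 0)).comp (hm.prodMk_nhds hx)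

lemma tendsto_nnnorm_val {ι : Type*} {l : Filter ι} {xs : ι → Junction N} {x : Junction N}
    (hx : Tendsto xs l (𝓝 x)) : Tendsto (fun n => ‖(xs n).val‖₊) l (𝓝 ‖x.val‖₊) :=
  ((Junction.continuous_val.tendsto x).comp hx).nnnorm

lemma tendsto_terminal [Nonempty (Fin N)] {ι : Type*} {l : Filter ι} {ms : ι → P1 (Junction N)}
    {m : P1 (Junction N)} {xs : ι → Junction N} {x : Junction N}
    (hm : Tendsto ms l (𝓝 m)) (hx : Tendsto xs l (𝓝 x))
    (h0 : x.val = 0 → ∀ᶠ n in l, (xs n).val = 0) :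
    Tendsto (fun n => c.terminal (ms n) (xs n)) l (𝓝 (c.terminal m x)) := by
  rcases x.eq_zero_or_exists_pos with hz | ⟨i, hi⟩
  · rw [c.terminal_of_eq_zero m hz]
    refine (c.tendsto_terminal_zero hm tendsto_const_nhds).congr' ?_
    filter_upwards [h0 hz] with n hn
    exact (c.terminal_of_eq_zero (ms n) hn).symm
  · rw [c.terminal_of_pos m hi]
    refine (c.tendsto_G hm (tendsto_nnnorm_val hx)).congr' ?_
    filter_upwards [(Junction.tendsto_iff_coord.1 hx i).eventually (lt_mem_nhds hi)] with n hn
    exact (c.terminal_of_pos (ms n) hn).symm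

/-- The left side is a continuous minorant of the terminal cost, with equality at the vertex; this
gives lower semicontinuity there. -/
lemma terminal_ge_of_min (m : P1 (Junction N)) (x : Junction N) :
    min (c.Gstar m) (⨅ i, c.G i m ‖x.val‖₊) ≤ c.terminal m x := by
  rcases x.eq_zero_or_exists_pos with hz | ⟨i, hi⟩
  · rw [c.terminal_of_eq_zero m hz, hz, nnnorm_zero]
  · rw [c.terminal_of_pos m hi]
    exact (min_le_right _ _).trans (ciInf_le (finite_range _).bddBelow i)

/-- The terminal cost is jointly lower semicontinuous. -/
lemma eventually_terminal_ge [Nonempty (Fin N)] {ι : Type*} {l : Filter ι}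
    {ms : ι → P1 (Junction N)} {m : P1 (Junction N)} {xs : ι → Junction N} {x : Junction N}
    (hm : Tendsto ms l (𝓝 m)) (hx : Tendsto xs l (𝓝 x)) {ε : ℝ} (hε : 0 < ε) :
    ∀ᶠ n in l, c.terminal m x - ε ≤ c.terminal (ms n) (xs n) := by
  by_cases hz : x.val = 0
  · have h1 := tendsto_nnnorm_val hx
    rw [hz, nnnorm_zero] at h1
    have h2 := c.tendsto_terminal_zero hm h1
    rw [← c.terminal_of_eq_zero m hz] at h2
    filter_upwards [h2.eventually (lt_mem_nhds (sub_lt_self _ hε))] with n hn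
    exact hn.le.trans (c.terminal_ge_of_min _ _)
  · have h2 := c.tendsto_terminal hm hx fun h => absurd h hz
    filter_upwards [h2.eventually (lt_mem_nhds (sub_lt_self _ hε))] with n hn using hn.le

/-! ### Bounds -/

lemma differentiable_L (i : Fin N) (m : P1 (Junction N)) {x : ℝ} (hx : 0 ≤ x) :
    Differentiable ℝ fun a => c.L i m x a := by
  have h := (c.contDiff_L i m).differentiableOn one_ne_zero
  have h2 : DifferentiableOn ℝ (fun a : ℝ => (x, a)) univ := by fun_prop
  have := h.comp h2 fun a _ => ⟨hx, mem_univ _⟩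
  exact differentiableOn_univ.1 this

lemma differentiableOn_L (i : Fin N) (m : P1 (Junction N)) (a : ℝ) :
    DifferentiableOn ℝ (fun x => c.L i m x a) (Ici 0) := by
  have h := (c.contDiff_L i m).differentiableOn one_ne_zero
  have h2 : DifferentiableOn ℝ (fun x : ℝ => (x, a)) (Ici 0) := by fun_prop
  exact h.comp h2 fun x hx => ⟨hx, mem_univ _⟩

end Costs

lemma Real.abs_le_one_add_rpow {p : ℝ} (hp : 1 ≤ p) (a : ℝ) : |a| ≤ 1 + |a| ^ p := by
  rcases le_total |a| 1 with h | h
  · linarith [Real.rpow_nonneg (abs_nonneg a) p]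
  · have := Real.rpow_le_rpow_of_exponent_le h hp
    rw [Real.rpow_one] at this
    linarith

namespace Costs

variable {N : ℕ} {c : Costs N} {p : ℝ}

/-- The growth conditions are integrated from `(x, a)` to `(x, 0)` and then to `(0, 0)`. All
dependence on the measure is left in `L_i[m](0, 0)`. -/
lemma HMFG1.exists_abs_L_le (hc : c.HMFG1 p) (hp : 1 < p) {r : ℝ} (hr : 0 < r) :
    ∃ K, 0 ≤ K ∧ ∀ i m, ∀ x ∈ Icc 0 r, ∀ a,
      |c.L i m x a| ≤ |c.L i m 0 0| + K * (1 + |a| ^ p) := by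
  obtain ⟨c', hc', hg⟩ := hc.growth r hr
  -- The term `c' * r` pays for moving `x` to `0` at zero velocity; `2 * c'` pays for moving `a` to
  -- `0`, since `|a| ^ p + |a| ≤ 2 * (1 + |a| ^ p)`.
  refine ⟨c' * r + 2 * c', by positivity, fun i m x hx a => ?_⟩
  have h1 : |c.L i m x a - c.L i m x 0| ≤ c' * (|a| ^ (p - 1) + 1) * |a| := by
    have := Convex.norm_image_sub_le_of_norm_deriv_le (f := fun b => c.L i m x b)
      (s := Icc (-|a|) |a|) (x := 0) (y := a) (C := c' * (|a| ^ (p - 1) + 1))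
      (fun b _ => (c.differentiable_L i m hx.1) b) (fun b hb => ?_) (convex_Icc _ _)
      ⟨by simp, abs_nonneg a⟩ ⟨neg_abs_le a, le_abs_self a⟩
    · simpa using this
    · refine ((hg i m x hx b).2).trans (mul_le_mul_of_nonneg_left ?_ hc')
      have : |b| ≤ |a| := abs_le.2 hb
      have := Real.rpow_le_rpow (abs_nonneg b) this (by linarith : 0 ≤ p - 1)
      linarith
  have h2 : |c.L i m x 0 - c.L i m 0 0| ≤ c' * r := by
    have := Convex.norm_image_sub_le_of_norm_hasDerivWithin_le (f := fun z => c.L i m z 0)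
      (f' := derivWithin (fun z => c.L i m z 0) (Ici 0)) (s := Icc 0 r) (x := 0) (y := x) (C := c')
      (fun z hz => (((c.differentiableOn_L i m 0) z hz.1).hasDerivWithinAt).mono
        Icc_subset_Ici_self) (fun z hz => ?_) (convex_Icc _ _) ⟨le_rfl, hr.le⟩ hx
    · refine this.trans (mul_le_mul_of_nonneg_left ?_ hc')
      simpa [abs_of_nonneg hx.1] using hx.2
    · have := (hg i m z hz 0).1
      rwa [abs_zero, Real.zero_rpow (by linarith), zero_add, mul_one] at this
  have h3 : |a| ^ (p - 1) * |a| = |a| ^ p := by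
    rcases eq_or_ne a 0 with rfl | ha
    · simp [Real.zero_rpow (by linarith : p ≠ 0)]
    · rw [← Real.rpow_add_one (abs_ne_zero.2 ha), sub_add_cancel]
  have h4 := Real.abs_le_one_add_rpow hp.le a
  have h5 : c' * (|a| ^ (p - 1) + 1) * |a| ≤ 2 * c' * (1 + |a| ^ p) := by
    have : c' * (|a| ^ (p - 1) + 1) * |a| = c' * (|a| ^ p + |a|) := by rw [← h3]; ring
    rw [this]
    have := mul_le_mul_of_nonneg_left h4 hc'
    nlinarith
  have h6 : c' * r ≤ c' * r * (1 + |a| ^ p) :=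
    le_mul_of_one_le_right (by positivity) (by linarith [Real.rpow_nonneg (abs_nonneg a) p])
  have h7 : c.L i m x a = (c.L i m x a - c.L i m x 0) + (c.L i m x 0 - c.L i m 0 0)
      + c.L i m 0 0 := by ring
  have h8 : |c.L i m x a| ≤ |c.L i m x a - c.L i m x 0| + |c.L i m x 0 - c.L i m 0 0|
      + |c.L i m 0 0| := by
    conv_lhs => rw [h7]
    exact abs_add_three _ _ _
  linarith

lemma HMFG1.exists_abs_running_le [Nonempty (Fin N)] (hc : c.HMFG1 p) (hp : 1 < p) {r : ℝ}
    (hr : 0 < r) :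
    ∃ K, 0 ≤ K ∧ ∀ m B, (∀ i, |c.L i m 0 0| ≤ B) → ∀ x α, ‖x.val‖ ≤ r →
      |c.running m x α| ≤ B + K * (1 + ‖α‖ ^ p) := by
  obtain ⟨K, hK, h⟩ := hc.exists_abs_L_le hp hr
  refine ⟨K + ‖c.Lstar‖, by positivity, fun m B hB x α hx => ?_⟩
  have hα : 0 ≤ ‖α‖ ^ p := Real.rpow_nonneg (norm_nonneg _) _
  have hL := norm_nonneg c.Lstar
  rcases x.eq_zero_or_exists_pos with hz | ⟨i, hi⟩
  · rw [c.running_of_eq_zero m hz]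
    have h1 : |c.Lstar m| ≤ ‖c.Lstar‖ := c.Lstar.norm_coe_le_norm m
    have h2 : |⨅ i, c.L i m 0 0| ≤ B := by
      obtain ⟨i⟩ := ‹Nonempty (Fin N)›
      rw [abs_le]
      exact ⟨le_ciInf fun j => (abs_le.1 (hB j)).1,
        (ciInf_le (finite_range _).bddBelow i).trans (abs_le.1 (hB i)).2⟩
    have h3 : |c.L0 m| ≤ max |c.Lstar m| |⨅ i, c.L i m 0 0| := abs_min_le_max_abs_abs
    have h4 : 0 ≤ B := (abs_nonneg _).trans h2
    have h5 : max |c.Lstar m| |⨅ i, c.L i m 0 0| ≤ ‖c.Lstar‖ + B :=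
      max_le (by linarith) (by linarith)
    nlinarith [mul_nonneg hL hα, mul_nonneg hK hα]
  · rw [c.running_of_pos m hi]
    have h1 := h i m (x.val i) ⟨hi.le, (x.coord_le_norm i).trans hx⟩ (α i)
    have h2 : |α i| ^ p ≤ ‖α‖ ^ p :=
      Real.rpow_le_rpow (abs_nonneg _) (PiLp.norm_apply_le α i) (by linarith)
    have h3 := mul_le_mul_of_nonneg_left h2 hK
    have h4 := hB i
    nlinarith [mul_nonneg hL hα]

lemma neg_le_L0 [Nonempty (Fin N)] (hp : 1 < p) {C₀ : ℝ}
    (h : ∀ i m x a, 0 ≤ x → C₀ * (|a| ^ p - 1) ≤ c.L i m x a) (h' : ∀ m, -C₀ ≤ c.Lstar m)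
    (m : P1 (Junction N)) : -C₀ ≤ c.L0 m := by
  refine le_min (h' m) (le_ciInf fun i => ?_)
  have := h i m 0 0 le_rfl
  rw [abs_zero, Real.zero_rpow (by linarith)] at this
  linarith

lemma neg_le_running [Nonempty (Fin N)] (hp : 1 < p) {C₀ : ℝ} (h0 : 0 < C₀)
    (h : ∀ i m x a, 0 ≤ x → C₀ * (|a| ^ p - 1) ≤ c.L i m x a) (h' : ∀ m, -C₀ ≤ c.Lstar m)
    (m : P1 (Junction N)) (x : Junction N) (α : EuclideanSpace ℝ (Fin N)) :
    -C₀ ≤ c.running m x α := by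
  rcases x.eq_zero_or_exists_pos with hz | ⟨i, hi⟩
  · rw [c.running_of_eq_zero m hz]
    exact neg_le_L0 hp h h' m
  · rw [c.running_of_pos m hi]
    refine le_trans ?_ (h i m _ (α i) hi.le)
    nlinarith [Real.rpow_nonneg (abs_nonneg (α i)) p]

lemma exists_norm_le {T : ℝ} (y : Traj N T) : ∃ r, 0 < r ∧ ∀ s, ‖(y s).val‖ ≤ r := by
  obtain ⟨r, hr⟩ := isCompact_univ.exists_bound_of_continuousOn
    (f := fun s => (y s).val) (Junction.continuous_val.comp y.continuous).continuousOn
  exact ⟨max r 1, lt_max_of_lt_right one_pos, fun s => (hr s (mem_univ _)).trans (le_max_left _ _)⟩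

/-! ### Costs along a trajectory: uniform bounds, measurability, integrability. -/

section trajectories

variable {T C : ℝ} [hT : Fact (0 < T)]

/-- Along a weakly convergent sequence of measures, the running costs at the vertex with zero
velocity are eventually bounded, uniformly in time. -/
lemma exists_eventually_abs_L_le (c : Costs N) (hp : 1 < p) (hC : 0 ≤ C)
    {μs : ℕ → ProbabilityMeasure (GamC N T p C)} {μ : ProbabilityMeasure (GamC N T p C)}
    (h : Tendsto μs atTop (𝓝 μ)) :
    ∃ B, ∀ᶠ n in atTop, ∀ t i, |c.L i (marginal (μs n) t) 0 0| ≤ B := by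
  have key : ∃ B, ∀ᶠ n in atTop, ∀ t ∈ (univ : Set (Icc (0 : ℝ) T)), ∀ i,
      |c.L i (marginal (μs n) t) 0 0| ≤ B := by
    -- Joint convergence in `(n, t)` gives a bound near each time for all large `n`; compactness of
    -- `[0,T]` makes both the bound and the rank uniform in time.
    refine isCompact_univ.induction_on (p := fun S => ∃ B, ∀ᶠ n in atTop, ∀ t ∈ S, ∀ i,
      |c.L i (marginal (μs n) t) 0 0| ≤ B) ⟨0, by simp⟩ ?_ ?_ ?_
    · rintro S S' hS ⟨B, hB⟩
      exact ⟨B, hB.mono fun n hn t ht => hn t (hS ht)⟩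
    · rintro S S' ⟨B, hB⟩ ⟨B', hB'⟩
      refine ⟨max B B', ?_⟩
      filter_upwards [hB, hB'] with n h1 h2 t ht i
      rcases ht with ht | ht
      · exact (h1 t ht i).trans (le_max_left _ _)
      · exact (h2 t ht i).trans (le_max_right _ _)
    · intro t _
      have hlim : ∀ i, Tendsto (fun q : ℕ × Icc (0 : ℝ) T => |c.L i (marginal (μs q.1) q.2) 0 0|)
          (atTop ×ˢ 𝓝 t) (𝓝 |c.L i (marginal μ t) 0 0|) := fun i =>
        (c.tendsto_L (tendsto_marginal_prod hp hC h t) tendsto_const_nhds tendsto_const_nhds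
          (fun _ => le_rfl) le_rfl).abs
      have hev : ∀ i, ∀ᶠ q : ℕ × Icc (0 : ℝ) T in atTop ×ˢ 𝓝 t,
          |c.L i (marginal (μs q.1) q.2) 0 0| ≤ ∑ j, |c.L j (marginal μ t) 0 0| + 1 := by
        intro i
        refine ((hlim i).eventually (gt_mem_nhds (lt_add_one _))).mono fun q hq => hq.le.trans ?_
        have := Finset.single_le_sum (f := fun j => |c.L j (marginal μ t) 0 0|)
          (fun _ _ => abs_nonneg _) (Finset.mem_univ i)
        linarith
      obtain ⟨pa, hpa, pb, hpb, hab⟩ := eventually_prod_iff.1 (eventually_all.2 hev)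
      refine ⟨{s | pb s}, mem_nhdsWithin_of_mem_nhds hpb,
        ∑ j, |c.L j (marginal μ t) 0 0| + 1, ?_⟩
      filter_upwards [hpa] with n hn s hs i using hab hn hs i
  obtain ⟨B, hB⟩ := key
  exact ⟨B, hB.mono fun n hn t => hn t (mem_univ _)⟩

lemma aestronglyMeasurable_running (c : Costs N) [Nonempty (Fin N)] (hp : 1 < p) (hC : 0 ≤ C)
    (μ : ProbabilityMeasure (GamC N T p C)) (y : Traj N T)
    {v : Icc (0 : ℝ) T → EuclideanSpace ℝ (Fin N)} (hv : AEStronglyMeasurable v (leb T)) :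
    AEStronglyMeasurable (fun s => c.running (marginal μ s) (y s) (v s)) (leb T) := by
  have hm := continuous_marginal hp hC μ
  have hy : ∀ i, Continuous fun s => (y s).val i := fun i =>
    (Junction.continuous_coord i).comp y.continuous
  -- Each open edge and the vertex carry a continuous cost, so the running cost is a sum of
  -- indicators of measurable sets of times. The `max` is harmless as coordinates are nonnegative.
  have hrep : (fun s => c.running (marginal μ s) (y s) (v s)) = fun s =>
      (∑ i, {s | 0 < (y s).val i}.indicator
        (fun s => c.L i (marginal μ s) (max ((y s).val i) 0) (v s i)) s) +
      {s | (y s).val = 0}.indicator (fun s => c.L0 (marginal μ s)) s := by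
    funext s
    rcases (y s).eq_zero_or_exists_pos with hz | ⟨i, hi⟩
    · rw [c.running_of_eq_zero _ hz]
      simp [indicator, hz]
    · have h0 : (y s).val ≠ 0 := fun h => by simp [h] at hi
      rw [c.running_of_pos _ hi, Finset.sum_eq_single i]
      · simp [indicator, hi, h0, hi.le]
      · intro k _ hk
        simp [indicator, Junction.coord_eq_zero_of_pos hi hk]
      · simp
  rw [hrep]
  refine AEStronglyMeasurable.add (Finset.aestronglyMeasurable_fun_sum _ fun i _ => ?_) ?_
  · refine AEStronglyMeasurable.indicator ?_
      (isOpen_lt continuous_const (hy i)).measurableSet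
    have hvi : AEStronglyMeasurable (fun s => v s i) (leb T) :=
      (EuclideanSpace.proj i : EuclideanSpace ℝ (Fin N) →L[ℝ] ℝ).continuous.comp_aestronglyMeasurable
        hv
    exact (c.continuous_L i).comp_aestronglyMeasurable
      (hm.aestronglyMeasurable.prodMk ((hy i).aestronglyMeasurable.prodMk hvi))
  · refine AEStronglyMeasurable.indicator (c.continuous_L0.comp hm).aestronglyMeasurable ?_
    exact (isClosed_eq (Junction.continuous_val.comp y.continuous) continuous_const).measurableSet

lemma integrable_rpow_coordDeriv (hp : 1 < p) {y : Traj N T} (hy : y ∈ Gam N T p) :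
    Integrable (fun s => ‖coordDeriv y s‖ ^ p) (leb T) := by
  have := (mem_Gam_iff.1 hy).2.integrable_norm_rpow (by simpa using (by linarith : 0 < p))
    ENNReal.ofReal_ne_top
  rwa [ENNReal.toReal_ofReal (by linarith)] at this

lemma HMFG1.integrable_running [Nonempty (Fin N)] (hc : c.HMFG1 p) (hp : 1 < p) (hC : 0 ≤ C)
    (μ : ProbabilityMeasure (GamC N T p C)) {y : Traj N T} (hy : y ∈ Gam N T p) :
    Integrable (fun s => c.running (marginal μ s) (y s) (coordDeriv y s)) (leb T) := by
  obtain ⟨r, hr, hyr⟩ := exists_norm_le y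
  obtain ⟨K, hK, hb⟩ := hc.exists_abs_running_le hp hr
  obtain ⟨B, hB⟩ := c.exists_eventually_abs_L_le hp hC (tendsto_const_nhds (x := μ))
  obtain ⟨n, hn⟩ := hB.exists
  refine Integrable.mono' ((integrable_const B).add (((integrable_const (1 : ℝ)).add
    (integrable_rpow_coordDeriv hp hy)).const_mul K))
    (c.aestronglyMeasurable_running hp hC μ y (mem_Gam_iff.1 hy).2.1)
    (Eventually.of_forall fun s => ?_)
  exact hb _ B (hn s) _ _ (hyr s)

lemma J_eq (c : Costs N) (μ : ProbabilityMeasure (GamC N T p C)) {y : Traj N T}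
    (hy : y ∈ Gam N T p) :
    c.J μ y = (∫ s, c.running (marginal μ s) (y s) (coordDeriv y s) ∂(leb T)) +
      c.terminal (marginal μ (tFinal T)) (y (tFinal T)) := by
  unfold J
  congr 1
  refine integral_congr_ae ?_
  filter_upwards [weakDeriv_ae_eq (mem_Gam_iff.1 hy).1] with s hs
  rw [hs]

end trajectories

end Costs

/-! ### Weak convergence in `L¹` -/

section weakConvergence

variable {α : Type*} [m0 : MeasurableSpace α] {ν : Measure α} [IsFiniteMeasure ν]

/-- Uniformly integrable functions whose integrals over a generating `π`-system tend to zero have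
all their set integrals tending to zero. -/
theorem tendsto_setIntegral_zero_of_isPiSystem {S : Set (Set α)}
    (hS : m0 = MeasurableSpace.generateFrom S) (hpi : IsPiSystem S) {w : ℕ → α → ℝ}
    (hw : ∀ n, Integrable (w n) ν)
    (hui : ∀ ε > 0, ∀ᶠ A in comap ν (𝓝 0), ∀ n, ∫ s in A, |w n s| ∂ν ≤ ε)
    (h0 : ∀ A ∈ S, Tendsto (fun n => ∫ s in A, w n s ∂ν) atTop (𝓝 0))
    (huniv : Tendsto (fun n => ∫ s, w n s ∂ν) atTop (𝓝 0)) {A : Set α} (hA : MeasurableSet A) :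
    Tendsto (fun n => ∫ s in A, w n s ∂ν) atTop (𝓝 0) := by
  induction A, hA using MeasurableSpace.induction_on_inter hS hpi with
  | empty => simp
  | basic A hA => exact h0 A hA
  | compl A hA ih =>
    have := huniv.sub ih
    rw [sub_zero] at this
    refine this.congr fun n => ?_
    rw [← integral_add_compl hA (hw n)]
    ring
  | iUnion A hd hA ih =>
    rw [Metric.tendsto_nhds]
    intro ε hε
    -- The tail of the disjoint union has small measure, so uniform integrability controls it for
    -- all `n` at once; the finitely many remaining sets fall under the induction hypothesis.
    have htail : Tendsto (fun K : ℕ => ν (⋃ k ≥ K, A k)) atTop (𝓝 0) :=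
      tendsto_measure_biUnion_Ici_zero_of_pairwise_disjoint
        (fun k => (hA k).nullMeasurableSet) hd
    obtain ⟨K, hK⟩ := ((tendsto_comap_iff.2 htail).eventually (hui (ε / 2) (by positivity))).exists
    have hfin : Tendsto (fun n => ∑ k ∈ Finset.range K, ∫ s in A k, w n s ∂ν) atTop (𝓝 0) := by
      have := tendsto_finsetSum (Finset.range K) fun k _ => ih k
      simpa using this
    filter_upwards [Metric.tendsto_nhds.1 hfin (ε / 2) (by positivity)] with n hn
    have hU : ⋃ k, A k = (⋃ k ∈ Finset.range K, A k) ∪ ⋃ k ≥ K, A k := by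
      ext s
      simp only [mem_iUnion, mem_union, Finset.mem_range, exists_prop, ge_iff_le]
      constructor
      · rintro ⟨k, hk⟩
        rcases lt_or_ge k K with h | h
        · exact Or.inl ⟨k, h, hk⟩
        · exact Or.inr ⟨k, h, hk⟩
      · rintro (⟨k, -, hk⟩ | ⟨k, -, hk⟩) <;> exact ⟨k, hk⟩
    have hdisj : Disjoint (⋃ k ∈ Finset.range K, A k) (⋃ k ≥ K, A k) := by
      simp only [disjoint_iUnion_left, disjoint_iUnion_right]
      intro j hj k hk
      exact hd (ne_of_lt ((Finset.mem_range.1 hk).trans_le hj))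
    rw [hU, setIntegral_union hdisj (MeasurableSet.iUnion fun k => MeasurableSet.iUnion fun _ => hA k)
      (hw n).integrableOn (hw n).integrableOn, integral_biUnion_finset _ (fun k _ => hA k)
      (fun i _ j _ hij => hd hij) (fun k _ => (hw n).integrableOn)]
    have h1 : |∫ s in ⋃ k ≥ K, A k, w n s ∂ν| ≤ ε / 2 :=
      (abs_integral_le_integral_abs).trans (hK n)
    rw [Real.dist_eq, sub_zero] at hn ⊢
    exact (abs_add_le _ _).trans_lt (by linarith)

end weakConvergence

/-- Testing with bounded measurable functions. -/
theorem tendsto_integral_mul_zero_of_setIntegral {α : Type*} [MeasurableSpace α] {ν : Measure α}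
    {w : ℕ → α → ℝ} (hw : ∀ n, Integrable (w n) ν) {D : ℝ}
    (hD : ∀ n, ∫ s, |w n s| ∂ν ≤ D) (h : ∀ A, MeasurableSet A → Tendsto (fun n => ∫ s in A, w n s ∂ν) atTop (𝓝 0))
    {q : α → ℝ} (hq : Measurable q) {M : ℝ} (hM : ∀ s, |q s| ≤ M) :
    Tendsto (fun n => ∫ s, q s * w n s ∂ν) atTop (𝓝 0) := by
  have hD0 : 0 ≤ D := (integral_nonneg fun s => abs_nonneg _).trans (hD 0)
  rw [Metric.tendsto_nhds]
  intro ε hε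
  -- Rounding `q` down to a multiple of `η` costs at most `η * D ≤ ε / 2`, and the rounded function
  -- is a finite combination of indicators.
  set η : ℝ := ε / 2 / (D + 1) with hη
  have hηpos : 0 < η := by positivity
  set F : Finset ℤ := Finset.Icc ⌊-(M / η)⌋ ⌊M / η⌋ with hF
  set B : ℤ → Set α := fun k => {s | ⌊q s / η⌋ = k} with hB
  have hBm : ∀ k, MeasurableSet (B k) := fun k =>
    (Int.measurable_floor.comp (hq.div_const η)) (measurableSet_singleton k)
  have hlim : Tendsto (fun n => ∑ k ∈ F, η * k * ∫ s in B k, w n s ∂ν) atTop (𝓝 0) := by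
    have := tendsto_finsetSum F fun k _ => (h (B k) (hBm k)).const_mul (η * (k : ℝ))
    simpa using this
  filter_upwards [Metric.tendsto_nhds.1 hlim (ε / 2) (by positivity)] with n hn
  have hfl : ∀ s, ⌊q s / η⌋ ∈ F := by
    intro s
    have := abs_le.1 (hM s)
    refine Finset.mem_Icc.2 ⟨Int.floor_le_floor ?_, Int.floor_le_floor ?_⟩
    · rw [← neg_div]
      exact div_le_div_of_nonneg_right this.1 hηpos.le
    · exact div_le_div_of_nonneg_right this.2 hηpos.le
  have hstep : ∀ s, ∑ k ∈ F, η * k * (B k).indicator (w n) s = η * ⌊q s / η⌋ * w n s := by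
    intro s
    rw [Finset.sum_eq_single ⌊q s / η⌋]
    · simp [hB]
    · intro k _ hk
      simp [hB, hk.symm]
    · exact fun h => absurd (hfl s) h
  have hint : ∑ k ∈ F, η * k * ∫ s in B k, w n s ∂ν = ∫ s, η * ⌊q s / η⌋ * w n s ∂ν := by
    simp only [← hstep]
    rw [integral_finsetSum _ fun k _ => ((hw n).indicator (hBm k)).const_mul _]
    refine Finset.sum_congr rfl fun k _ => ?_
    rw [integral_const_mul, integral_indicator (hBm k)]
  have hi1 : Integrable (fun s => q s * w n s) ν :=
    (hw n).bdd_mul hq.aestronglyMeasurable (Eventually.of_forall hM)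
  have hi2 : Integrable (fun s => η * ⌊q s / η⌋ * w n s) ν := by
    simp only [← hstep]
    exact integrable_finsetSum _ fun k _ => ((hw n).indicator (hBm k)).const_mul _
  have herr : |∫ s, q s * w n s ∂ν - ∫ s, η * ⌊q s / η⌋ * w n s ∂ν| ≤ η * D := by
    rw [← integral_sub hi1 hi2]
    refine (abs_integral_le_integral_abs).trans ?_
    refine le_trans ?_ (mul_le_mul_of_nonneg_left (hD n) hηpos.le)
    rw [← integral_const_mul]
    refine integral_mono (hi1.sub hi2).abs ((hw n).abs.const_mul η) fun s => ?_
    rw [← sub_mul, abs_mul]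
    refine mul_le_mul_of_nonneg_right ?_ (abs_nonneg _)
    have h1 := Int.floor_le (q s / η)
    have h2 := Int.lt_floor_add_one (q s / η)
    have h3 : q s = η * (q s / η) := by field_simp
    rw [abs_le]
    constructor <;> nlinarith
  have hηD : η * D ≤ ε / 2 := by
    rw [hη, div_mul_eq_mul_div, div_le_iff₀ (by positivity)]
    nlinarith
  rw [hint, Real.dist_eq, sub_zero] at hn
  rw [Real.dist_eq, sub_zero]
  have := abs_sub_abs_le_abs_sub (∫ s, q s * w n s ∂ν) (∫ s, η * ⌊q s / η⌋ * w n s ∂ν)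
  linarith

/-! ### Bounds in `L^p` -/

lemma eLpNorm_le_ofReal_iff {α E : Type*} [MeasurableSpace α] {ν : Measure α}
    [NormedAddCommGroup E] {f : α → E} {p C : ℝ} (hp : 1 < p) (hC : 0 ≤ C)
    (hf : MemLp f (ENNReal.ofReal p) ν) :
    eLpNorm f (ENNReal.ofReal p) ν ≤ ENNReal.ofReal C ↔ ∫ s, ‖f s‖ ^ p ∂ν ≤ C ^ p := by
  have hp0 : 0 < p := by linarith
  rw [hf.eLpNorm_eq_integral_rpow_norm (by simpa using hp0) ENNReal.ofReal_ne_top,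
    ENNReal.toReal_ofReal hp0.le, ENNReal.ofReal_le_ofReal_iff hC]
  have hI : 0 ≤ ∫ s, ‖f s‖ ^ p ∂ν := integral_nonneg fun s => Real.rpow_nonneg (norm_nonneg _) _
  exact Real.rpow_inv_le_iff_of_pos hI hC hp0

lemma tendsto_rpow_measureReal_comap {α : Type*} [MeasurableSpace α] (ν : Measure α) (C : ℝ)
    {θ : ℝ} (hθ : 0 < θ) :
    Tendsto (fun A => C * (ν.real A) ^ θ) (comap ν (𝓝 0)) (𝓝 0) := by
  have h1 : Tendsto (fun A => ν.real A) (comap ν (𝓝 0)) (𝓝 0) := by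
    have := (ENNReal.tendsto_toReal ENNReal.zero_ne_top).comp (tendsto_comap (f := ν) (x := 𝓝 0))
    exact this
  have h2 := (h1.rpow_const (p := θ) (Or.inr hθ.le)).const_mul C
  rwa [Real.zero_rpow hθ.ne', mul_zero] at h2

/-- Young's inequality for the conjugate exponents `p / (p - 1)` and `p`. -/
lemma rpow_sub_one_mul_le {p : ℝ} (hp : 1 < p) {a b : ℝ} (ha : 0 ≤ a) (hb : 0 ≤ b) :
    a ^ (p - 1) * b ≤ (1 - 1 / p) * a ^ p + 1 / p * b ^ p := by
  have hp0 : 0 < p := by linarith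
  have h := Real.geom_mean_le_arith_mean2_weighted (w₁ := 1 - 1 / p) (w₂ := 1 / p)
    (p₁ := a ^ p) (p₂ := b ^ p) (by rw [sub_nonneg, div_le_one hp0]; exact hp.le) (by positivity)
    (Real.rpow_nonneg ha _) (Real.rpow_nonneg hb _) (by ring)
  rwa [← Real.rpow_mul ha, ← Real.rpow_mul hb, mul_one_div_cancel hp0.ne', Real.rpow_one,
    show p * (1 - 1 / p) = p - 1 by field_simp] at h

/-! ### Limits of trajectories with bounded energy -/

section limits

variable {N : ℕ} {T p C : ℝ} [hT : Fact (0 < T)]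

lemma measurable_coordDeriv (y : Traj N T) : Measurable (coordDeriv y) := by
  have h : Measurable fun s : Icc (0 : ℝ) T => fun i => deriv (coord y i) (s : ℝ) :=
    measurable_pi_lambda _ fun i => (measurable_deriv _).comp measurable_subtype_coe
  exact (WithLp.measurable_toLp 2 _).comp h

lemma integrable_coordDeriv {y : Traj N T} (hy : y ∈ Gam N T p) :
    Integrable (coordDeriv y) (leb T) :=
  (isWeakDeriv_coordDeriv (mem_Gam_iff.1 hy).1).1

lemma setIntegral_Ioi_coordDeriv {y : Traj N T}
    (h : ∀ i, AbsolutelyContinuousOnInterval (coord y i) 0 T) (i : Fin N) (a : Icc (0 : ℝ) T) :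
    ∫ s in Ioi a, coordDeriv y s i ∂leb T = (y (tFinal T)).val i - (y a).val i := by
  have hab : AbsolutelyContinuousOnInterval (coord y i) a T :=
    (h i).mono (uIcc_subset_uIcc (by rw [uIcc_of_le hT.out.le]; exact a.2) right_mem_uIcc)
  have hset : Ioi a = Subtype.val ⁻¹' (uIoc (a : ℝ) T) := by
    ext s
    simp only [mem_Ioi, mem_preimage, uIoc_of_le a.2.2, mem_Ioc, s.2.2, and_true]
    rfl
  have h1 := setIntegral_leb_uIoc (deriv (coord y i)) a.2 (right_mem_Icc.2 hT.out.le)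
  rw [hset]
  refine h1.trans ?_
  rw [uIoc_of_le a.2.2, ← intervalIntegral.integral_of_le a.2.2, hab.integral_deriv_eq_sub,
    coord_coe, coord_of_mem y i (right_mem_Icc.2 hT.out.le)]
  rfl

lemma integral_coordDeriv {y : Traj N T}
    (h : ∀ i, AbsolutelyContinuousOnInterval (coord y i) 0 T) (i : Fin N) :
    ∫ s, coordDeriv y s i ∂leb T = (y (tFinal T)).val i - (y (tInit T)).val i := by
  refine (integral_leb hT.out.le (deriv (coord y i))).trans ?_
  rw [(h i).integral_deriv_eq_sub, coord_of_mem y i (right_mem_Icc.2 hT.out.le),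
    coord_of_mem y i (left_mem_Icc.2 hT.out.le)]
  rfl

variable {ys : ℕ → Traj N T} {y : Traj N T}

/-- By Hölder, the increments over disjoint intervals of total length `σ` sum to at most `C * σ ^ (1
- 1 / p)` for every `n`. Such a common modulus survives pointwise limits. -/
lemma absolutelyContinuous_coord_of_tendsto (hp : 1 < p) (hC : 0 ≤ C)
    (hys : ∀ n, ys n ∈ Gam N T p)
    (hL : ∀ n, eLpNorm (coordDeriv (ys n)) (ENNReal.ofReal p) (leb T) ≤ ENNReal.ofReal C)
    (hlim : ∀ s, Tendsto (fun n => ys n s) atTop (𝓝 (y s))) (i : Fin N) :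
    AbsolutelyContinuousOnInterval (coord y i) 0 T := by
  have hθ : 0 < 1 - 1 / p := by
    rw [sub_pos, div_lt_one (by linarith)]
    exact hp
  rw [absolutelyContinuousOnInterval_iff]
  intro ε hε
  have hcont : Tendsto (fun x : ℝ => C * x ^ (1 - 1 / p)) (𝓝 0) (𝓝 0) := by
    have := ((continuous_id.rpow_const fun x : ℝ => Or.inr hθ.le).const_mul C).tendsto 0
    simpa only [id, Real.zero_rpow hθ.ne', mul_zero] using this
  obtain ⟨δ, hδ, hball⟩ := Metric.eventually_nhds_iff.1 (hcont.eventually (gt_mem_nhds hε))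
  refine ⟨δ, hδ, fun E hE hsum => ?_⟩
  set σ := ∑ k ∈ Finset.range E.1, dist (E.2 k).1 (E.2 k).2 with hσ
  have hσ0 : 0 ≤ σ := Finset.sum_nonneg fun k _ => dist_nonneg
  have hσε : C * σ ^ (1 - 1 / p) < ε := hball (by rwa [Real.dist_eq, sub_zero, abs_of_nonneg hσ0])
  have hmem := hE.1
  rw [uIcc_of_le hT.out.le] at hmem
  refine lt_of_le_of_lt ?_ hσε
  have htend : Tendsto (fun n => ∑ k ∈ Finset.range E.1,
      dist (coord (ys n) i (E.2 k).1) (coord (ys n) i (E.2 k).2)) atTop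
      (𝓝 (∑ k ∈ Finset.range E.1, dist (coord y i (E.2 k).1) (coord y i (E.2 k).2))) :=
    tendsto_finsetSum _ fun k _ =>
      (Junction.tendsto_iff_coord.1 (hlim _) i).dist (Junction.tendsto_iff_coord.1 (hlim _) i)
  refine le_of_tendsto' htend fun n => ?_
  set A : ℕ → Set (Icc (0 : ℝ) T) := fun k => Subtype.val ⁻¹' (uIoc (E.2 k).1 (E.2 k).2)
  have hAm : ∀ k, MeasurableSet (A k) := fun k => measurable_subtype_coe measurableSet_uIoc
  have hint := (integrable_coordDeriv (hys n)).norm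
  calc ∑ k ∈ Finset.range E.1, dist (coord (ys n) i (E.2 k).1) (coord (ys n) i (E.2 k).2)
      ≤ ∑ k ∈ Finset.range E.1, ∫ s in A k, ‖coordDeriv (ys n) s‖ ∂leb T :=
        Finset.sum_le_sum fun k hk =>
          abs_coord_sub_le (mem_Gam_iff.1 (hys n)).1 i (hmem k hk).1 (hmem k hk).2
    _ = ∫ s in ⋃ k ∈ Finset.range E.1, A k, ‖coordDeriv (ys n) s‖ ∂leb T := by
        rw [integral_biUnion_finset _ (fun k _ => hAm k) ?_ fun k _ => hint.integrableOn]
        intro k hk j hj hkj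
        exact (hE.2 hk hj hkj).preimage _
    _ ≤ C * (leb T).real (⋃ k ∈ Finset.range E.1, A k) ^ (1 - 1 / p) :=
        setIntegral_norm_le_of_eLpNorm_le hp hC (mem_Gam_iff.1 (hys n)).2.1 (hL n) _
    _ ≤ C * σ ^ (1 - 1 / p) := by
        refine mul_le_mul_of_nonneg_left (Real.rpow_le_rpow measureReal_nonneg ?_ hθ.le) hC
        refine (measureReal_biUnion_finset_le _ _).trans (Finset.sum_le_sum fun k hk => ?_)
        rw [leb_real_uIoc (hmem k hk).1 (hmem k hk).2, Real.dist_eq]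

/-- The derivatives converge weakly. -/
lemma tendsto_integral_mul_coordDeriv_sub (hp : 1 < p) (hC : 0 ≤ C)
    (hys : ∀ n, ys n ∈ Gam N T p)
    (hL : ∀ n, eLpNorm (coordDeriv (ys n)) (ENNReal.ofReal p) (leb T) ≤ ENNReal.ofReal C)
    (hlim : ∀ s, Tendsto (fun n => ys n s) atTop (𝓝 (y s))) (i : Fin N)
    {q : Icc (0 : ℝ) T → ℝ} (hq : Measurable q) {M : ℝ} (hM : ∀ s, |q s| ≤ M) :
    Tendsto (fun n => ∫ s, q s * (coordDeriv (ys n) s i - coordDeriv y s i) ∂leb T)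
      atTop (𝓝 0) := by
  have hθ : 0 < 1 - 1 / p := by
    rw [sub_pos, div_lt_one (by linarith)]
    exact hp
  have hAC := absolutelyContinuous_coord_of_tendsto hp hC hys hL hlim
  have hACn := fun n => (mem_Gam_iff.1 (hys n)).1
  have hvn : ∀ n, Integrable (fun s => coordDeriv (ys n) s i) (leb T) := fun n =>
    integrable_piLp_iff.1 (integrable_coordDeriv (hys n)) i
  have hv : Integrable (fun s => coordDeriv y s i) (leb T) :=
    integrable_piLp_iff.1 (isWeakDeriv_coordDeriv hAC).1 i
  -- This yields the uniform integrability: the bound does not depend on `n` and tends to zero with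
  -- the measure of `A`.
  have hbound : ∀ n A, ∫ s in A, |coordDeriv (ys n) s i - coordDeriv y s i| ∂leb T
      ≤ C * (leb T).real A ^ (1 - 1 / p) + ∫ s in A, ‖coordDeriv y s i‖ ∂leb T := by
    intro n A
    refine le_trans ?_ (add_le_add_left (setIntegral_norm_le_of_eLpNorm_le hp hC
      (mem_Gam_iff.1 (hys n)).2.1 (hL n) A) _)
    rw [← integral_add (integrable_coordDeriv (hys n)).norm.integrableOn hv.norm.integrableOn]
    refine integral_mono ((hvn n).sub hv).abs.integrableOn
      ((integrable_coordDeriv (hys n)).norm.add hv.norm).integrableOn fun s => ?_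
    exact (abs_sub _ _).trans (add_le_add_left (PiLp.norm_apply_le (coordDeriv (ys n) s) i) _)
  refine tendsto_integral_mul_zero_of_setIntegral (fun n => (hvn n).sub hv)
    (D := C * (leb T).real univ ^ (1 - 1 / p) + ∫ s in univ, ‖coordDeriv y s i‖ ∂leb T)
    (fun n => by simpa using hbound n univ) (fun A hA => ?_) hq hM
  have hc := fun s => Junction.tendsto_iff_coord.1 (hlim s) i
  -- The half-lines `Ioi a` generate the Borel sets, and over them the integral of the derivative is
  -- an increment, which converges pointwise.
  refine tendsto_setIntegral_zero_of_isPiSystem (S := range Ioi)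
    ((BorelSpace.measurable_eq).trans (borel_eq_generateFrom_Ioi _)) isPiSystem_Ioi
    (fun n => (hvn n).sub hv) (fun ε hε => ?_) ?_ ?_ hA
  · have h1 := tendsto_rpow_measureReal_comap (leb T) C hθ
    have h2 := hv.norm.hasFiniteIntegral.tendsto_setIntegral_nhds_zero
      (tendsto_comap (f := leb T) (x := 𝓝 0))
    have h3 := h1.add h2
    rw [add_zero] at h3
    filter_upwards [h3.eventually (gt_mem_nhds hε)] with A hA n
    exact (hbound n A).trans hA.le
  · rintro _ ⟨a, rfl⟩
    have : Tendsto (fun n => ((ys n (tFinal T)).val i - (ys n a).val i)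
        - ((y (tFinal T)).val i - (y a).val i)) atTop (𝓝 0) := by
      have := (((hc (tFinal T)).sub (hc a)).sub_const ((y (tFinal T)).val i - (y a).val i))
      rwa [sub_self] at this
    refine this.congr fun n => ?_
    simp only [Pi.sub_apply]
    rw [integral_sub (hvn n).integrableOn hv.integrableOn, setIntegral_Ioi_coordDeriv (hACn n),
      setIntegral_Ioi_coordDeriv hAC]
  · have : Tendsto (fun n => ((ys n (tFinal T)).val i - (ys n (tInit T)).val i)
        - ((y (tFinal T)).val i - (y (tInit T)).val i)) atTop (𝓝 0) := by
      have := (((hc (tFinal T)).sub (hc (tInit T))).sub_const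
        ((y (tFinal T)).val i - (y (tInit T)).val i))
      rwa [sub_self] at this
    refine this.congr fun n => ?_
    simp only [Pi.sub_apply]
    rw [integral_sub (hvn n) hv, integral_coordDeriv (hACn n), integral_coordDeriv hAC]

/-- The bound on the energy passes to the limit. -/
lemma eLpNorm_coordDeriv_le_of_tendsto (hp : 1 < p) (hC : 0 ≤ C)
    (hys : ∀ n, ys n ∈ Gam N T p)
    (hL : ∀ n, eLpNorm (coordDeriv (ys n)) (ENNReal.ofReal p) (leb T) ≤ ENNReal.ofReal C)
    (hlim : ∀ s, Tendsto (fun n => ys n s) atTop (𝓝 (y s))) :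
    eLpNorm (coordDeriv y) (ENNReal.ofReal p) (leb T) ≤ ENNReal.ofReal C := by
  have hp0 : 0 < p := by linarith
  set v := coordDeriv y with hv
  have hvm : Measurable v := measurable_coordDeriv y
  -- The dual function `‖v‖ ^ (p - 2) • v` may be unbounded, so everything is first restricted to
  -- `{‖v‖ ≤ R}`; Fatou's lemma removes the truncation.
  set E : ℕ → Set (Icc (0 : ℝ) T) := fun R => {s | ‖v s‖ ≤ R} with hE
  have hEm : ∀ R, MeasurableSet (E R) := fun R => measurableSet_le hvm.norm measurable_const
  have hconv : ∀ s, Tendsto (fun R => (E R).indicator v s) atTop (𝓝 (v s)) := by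
    intro s
    obtain ⟨R₀, hR₀⟩ := exists_nat_ge ‖v s‖
    refine tendsto_const_nhds.congr' ?_
    filter_upwards [eventually_ge_atTop R₀] with R hR
    rw [indicator_of_mem]
    exact hR₀.trans (Nat.cast_le.2 hR)
  refine (Lp.eLpNorm_lim_le_liminf_eLpNorm (f := fun R => (E R).indicator v)
    (fun R => (hvm.indicator (hEm R)).aestronglyMeasurable) v
    (Eventually.of_forall hconv)).trans ?_
  refine liminf_le_of_le (by isBoundedDefault) fun b hb => ?_
  obtain ⟨R, hbR⟩ := hb.exists
  refine hbR.trans ?_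
  have hbdd : ∀ s, ‖(E R).indicator v s‖ ≤ R := by
    intro s
    by_cases hs : s ∈ E R
    · rw [indicator_of_mem hs]
      exact hs
    · simp [indicator_of_notMem hs]
  have hmem : MemLp ((E R).indicator v) (ENNReal.ofReal p) (leb T) :=
    MemLp.of_bound (hvm.indicator (hEm R)).aestronglyMeasurable R (Eventually.of_forall hbdd)
  rw [eLpNorm_le_ofReal_iff hp hC hmem]
  set q : Fin N → Icc (0 : ℝ) T → ℝ := fun i s =>
    (E R).indicator (fun s => ‖v s‖ ^ (p - 2) * v s i) s with hq
  have hvi : ∀ i, Measurable fun s => v s i := fun i =>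
    (EuclideanSpace.proj i : EuclideanSpace ℝ (Fin N) →L[ℝ] ℝ).continuous.measurable.comp hvm
  have hqm : ∀ i, Measurable (q i) := fun i =>
    ((hvm.norm.pow_const _).mul (hvi i)).indicator (hEm R)
  -- For `p < 2` the exponent is negative, but where `v s = 0` the second factor vanishes, so the
  -- value given to `0 ^ (p - 2)` is irrelevant.
  have hpow : ∀ s, ‖v s‖ ^ (p - 2) * ‖v s‖ = ‖v s‖ ^ (p - 1) := by
    intro s
    rcases eq_or_ne ‖v s‖ 0 with h0 | h0
    · rw [h0, mul_zero, Real.zero_rpow (by linarith)]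
    · rw [← Real.rpow_add_one h0]
      congr 1
      ring
  have hpow' : ∀ s, ‖v s‖ ^ (p - 1) * ‖v s‖ = ‖v s‖ ^ p := by
    intro s
    rcases eq_or_ne ‖v s‖ 0 with h0 | h0
    · rw [h0, mul_zero, Real.zero_rpow (by linarith)]
    · rw [← Real.rpow_add_one h0, sub_add_cancel]
  have hqb : ∀ i s, |q i s| ≤ (R : ℝ) ^ (p - 1) := by
    intro i s
    have hR0 : (0 : ℝ) ≤ (R : ℝ) ^ (p - 1) := Real.rpow_nonneg R.cast_nonneg _
    by_cases hs : s ∈ E R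
    · simp only [hq, indicator_of_mem hs]
      rw [abs_mul, abs_of_nonneg (Real.rpow_nonneg (norm_nonneg _) _)]
      calc ‖v s‖ ^ (p - 2) * |v s i| ≤ ‖v s‖ ^ (p - 2) * ‖v s‖ :=
            mul_le_mul_of_nonneg_left (PiLp.norm_apply_le (v s) i)
              (Real.rpow_nonneg (norm_nonneg _) _)
        _ = ‖v s‖ ^ (p - 1) := hpow s
        _ ≤ _ := Real.rpow_le_rpow (norm_nonneg _) hs (by linarith)
    · simpa only [hq, indicator_of_notMem hs, abs_zero] using hR0
  -- For each `n` this quantity bounds the truncated energy of `v`, by the pointwise inequality `p ∑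
  -- q_i (u_i - v_i) ≤ ‖u‖ ^ p - ‖v‖ ^ p`. Weak convergence sends it to `C ^ p`.
  have hw : Tendsto (fun n => C ^ p - p * ∑ i, ∫ s, q i s * (coordDeriv (ys n) s i - v s i) ∂leb T)
      atTop (𝓝 (C ^ p)) := by
    have h1 := tendsto_finsetSum Finset.univ fun i _ =>
      tendsto_integral_mul_coordDeriv_sub hp hC hys hL hlim i (hqm i) (hqb i)
    have h2 := (h1.const_mul p).const_sub (C ^ p)
    simpa only [Finset.sum_const_zero, mul_zero, sub_zero] using h2
  refine ge_of_tendsto' hw fun n => ?_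
  have hvn := hmem.integrable_norm_rpow (by simpa using hp0) ENNReal.ofReal_ne_top
  rw [ENNReal.toReal_ofReal hp0.le] at hvn
  have hyn := Costs.integrable_rpow_coordDeriv hp (hys n)
  have hACl := absolutelyContinuous_coord_of_tendsto hp hC hys hL hlim
  have hqi : ∀ i, Integrable (fun s => q i s * (coordDeriv (ys n) s i - v s i)) (leb T) := by
    intro i
    have h1 : Integrable (fun s => coordDeriv (ys n) s i - v s i) (leb T) :=
      (integrable_piLp_iff.1 (integrable_coordDeriv (hys n)) i).sub
        (integrable_piLp_iff.1 (isWeakDeriv_coordDeriv hACl).1 i)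
    exact h1.bdd_mul (hqm i).aestronglyMeasurable (Eventually.of_forall (hqb i))
  have hCn := (eLpNorm_le_ofReal_iff hp hC (mem_Gam_iff.1 (hys n)).2).1 (hL n)
  rw [← integral_finsetSum _ fun i _ => hqi i, ← integral_const_mul]
  refine le_trans ?_ (sub_le_sub_right hCn _)
  rw [← integral_sub hyn ((integrable_finsetSum _ fun i _ => hqi i).const_mul p)]
  refine integral_mono hvn (hyn.sub ((integrable_finsetSum _ fun i _ => hqi i).const_mul p))
    fun s => ?_
  have hnn : 0 ≤ ‖coordDeriv (ys n) s‖ ^ p := Real.rpow_nonneg (norm_nonneg _) _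
  by_cases hs : s ∈ E R
  · simp only [hq, indicator_of_mem hs]
    set u := coordDeriv (ys n) s with hu
    have hin : ∑ i, v s i * u i ≤ ‖v s‖ * ‖u‖ := by
      have := real_inner_le_norm (v s) u
      rw [PiLp.inner_apply] at this
      simpa [mul_comm] using this
    have hself : ∑ i, v s i * v s i = ‖v s‖ * ‖v s‖ := by
      have := real_inner_self_eq_norm_mul_norm (v s)
      rw [PiLp.inner_apply] at this
      simpa [pow_two] using this
    have hsum : ∑ i, ‖v s‖ ^ (p - 2) * v s i * (u i - v s i)
        = ‖v s‖ ^ (p - 2) * (∑ i, v s i * u i - ∑ i, v s i * v s i) := by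
      rw [← Finset.sum_sub_distrib, Finset.mul_sum]
      exact Finset.sum_congr rfl fun i _ => by ring
    -- Cauchy–Schwarz here, then Young's inequality: together, the convexity inequality for `‖·‖ ^
    -- p` at `v s`.
    have h1 : ‖v s‖ ^ (p - 2) * (∑ i, v s i * u i - ∑ i, v s i * v s i)
        ≤ ‖v s‖ ^ (p - 1) * ‖u‖ - ‖v s‖ ^ p := by
      rw [hself, ← hpow' s, ← hpow s]
      have := mul_le_mul_of_nonneg_left hin (Real.rpow_nonneg (norm_nonneg (v s)) (p - 2))
      nlinarith
    have h2 := rpow_sub_one_mul_le hp (norm_nonneg (v s)) (norm_nonneg u)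
    rw [hsum]
    have h3 : p * (‖v s‖ ^ (p - 2) * (∑ i, v s i * u i - ∑ i, v s i * v s i))
        ≤ p * ((1 - 1 / p) * ‖v s‖ ^ p + 1 / p * ‖u‖ ^ p - ‖v s‖ ^ p) :=
      mul_le_mul_of_nonneg_left (by linarith) hp0.le
    have h4 : p * ((1 - 1 / p) * ‖v s‖ ^ p + 1 / p * ‖u‖ ^ p - ‖v s‖ ^ p)
        = ‖u‖ ^ p - ‖v s‖ ^ p := by
      field_simp
      ring
    linarith
  · simp only [hq, indicator_of_notMem hs, norm_zero, Real.zero_rpow hp0.ne', zero_mul,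
      Finset.sum_const_zero, mul_zero, sub_zero]
    exact hnn

end limits

/-! ### A lemma of Fatou type -/

/-- The functions `min (f n) h` converge to `h` almost everywhere and are dominated by `|h| + |K|`;
their integrals bound those of `f n` from below. -/
lemma eventually_integral_ge_of_eventually_ge {α : Type*} [MeasurableSpace α] {ν : Measure α}
    [IsFiniteMeasure ν] {f : ℕ → α → ℝ} {h : α → ℝ} {K : ℝ} (hf : ∀ n, Integrable (f n) ν)
    (hh : Integrable h ν) (hK : ∀ n, ∀ᵐ s ∂ν, -K ≤ f n s)
    (hlim : ∀ᵐ s ∂ν, ∀ ε > 0, ∀ᶠ n in atTop, h s - ε ≤ f n s) {ε : ℝ} (hε : 0 < ε) :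
    ∀ᶠ n in atTop, ∫ s, h s ∂ν - ε ≤ ∫ s, f n s ∂ν := by
  have key : Tendsto (fun n => ∫ s, min (f n s) (h s) ∂ν) atTop (𝓝 (∫ s, h s ∂ν)) := by
    refine tendsto_integral_of_dominated_convergence (fun s => |h s| + |K|)
      (fun n => ((hf n).inf hh).aestronglyMeasurable) (hh.abs.add (integrable_const _))
      (fun n => ?_) ?_
    · filter_upwards [hK n] with s hs
      rw [Real.norm_eq_abs, abs_le]
      have h1 := neg_abs_le (h s)
      have h2 := le_abs_self (h s)
      have h3 := le_abs_self K
      have h4 := abs_nonneg (h s)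
      have h5 := abs_nonneg K
      exact ⟨le_min (by linarith) (by linarith), (min_le_right _ _).trans (by linarith)⟩
    · filter_upwards [hlim] with s hs
      rw [Metric.tendsto_nhds]
      intro δ hδ
      filter_upwards [hs (δ / 2) (by positivity)] with n hn
      rw [Real.dist_eq, abs_lt]
      have h1 : h s - δ / 2 ≤ min (f n s) (h s) := le_min hn (by linarith)
      have h2 : min (f n s) (h s) ≤ h s := min_le_right _ _
      constructor <;> linarith
  filter_upwards [key.eventually (lt_mem_nhds (sub_lt_self _ hε))] with n hn
  exact hn.le.trans (integral_mono ((hf n).inf hh) (hf n) fun s => min_le_left _ _)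

/-! ### Coercivity and convexity of the running costs -/

lemma exists_forall_le_rpow_sub_mul {p C₀ : ℝ} (hp : 1 < p) (h0 : 0 < C₀) (q A : ℝ) :
    ∃ B, ∀ t, B ≤ t → A ≤ C₀ * (t ^ p - 1) - q * t := by
  have h1 := tendsto_rpow_atTop (by linarith : 0 < p - 1)
  obtain ⟨B, hB⟩ := eventually_atTop.1 (h1.eventually_ge_atTop ((q + 1) / C₀))
  -- Beyond `B` one has `C₀ * t ^ (p - 1) ≥ q + 1`, hence `C₀ * t ^ p - q * t ≥ t ≥ A + C₀`; the
  -- bound `1` only keeps `t` positive.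
  refine ⟨max B (max 1 (A + C₀)), fun t ht => ?_⟩
  have ht1 : B ≤ t := (le_max_left _ _).trans ht
  have ht2 : 1 ≤ t := (le_max_left _ _).trans ((le_max_right _ _).trans ht)
  have ht3 : A + C₀ ≤ t := (le_max_right _ _).trans ((le_max_right _ _).trans ht)
  have h2 := hB t ht1
  rw [div_le_iff₀ h0] at h2
  have h3 : t ^ p = t ^ (p - 1) * t := by
    rw [← Real.rpow_add_one (by linarith), sub_add_cancel]
  rw [h3]
  nlinarith

lemma exists_forall_neg_le_rpow_sub_mul {p C₀ : ℝ} (hp : 1 < p) (h0 : 0 < C₀) {q : ℝ}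
    (hq : 0 ≤ q) : ∃ K, ∀ t, 0 ≤ t → -K ≤ C₀ * (t ^ p - 1) - q * t := by
  obtain ⟨B, hB⟩ := exists_forall_le_rpow_sub_mul hp h0 q 0
  refine ⟨C₀ + q * |B|, fun t ht => ?_⟩
  rcases le_or_gt B t with h | h
  · have := mul_nonneg hq (abs_nonneg B)
    linarith [hB t h]
  · have h1 : q * t ≤ q * |B| := mul_le_mul_of_nonneg_left (h.le.trans (le_abs_self B)) hq
    have h2 := mul_nonneg h0.le (Real.rpow_nonneg ht p)
    linarith

namespace Costs

variable {N : ℕ} {c : Costs N} {p : ℝ}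

lemma HMFG1.L_add_deriv_mul_le (hc : c.HMFG1 p) (i : Fin N) (m : P1 (Junction N)) {x : ℝ}
    (hx : 0 ≤ x) (a b : ℝ) :
    c.L i m x a + deriv (fun b => c.L i m x b) a * (b - a) ≤ c.L i m x b := by
  have hconv := (hc.convex i m x hx).convexOn
  have hd := (c.differentiable_L i m hx a).hasDerivAt
  rcases lt_trichotomy a b with h | rfl | h
  · have := hconv.le_slope_of_hasDerivAt (mem_univ a) (mem_univ b) h hd
    rw [slope_def_field, le_div_iff₀ (sub_pos.2 h)] at this
    linarith
  · simp
  · have := hconv.slope_le_of_hasDerivAt (mem_univ b) (mem_univ a) h hd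
    rw [slope_def_field, div_le_iff₀ (sub_pos.2 h)] at this
    linarith

/-- The supporting lines of the running costs are asymptotically below the running costs,
uniformly in the velocity. -/
lemma HMFG1.eventually_forall_le (hc : c.HMFG1 p) (hp : 1 < p) (i : Fin N)
    {m : P1 (Junction N)} {x : ℝ} (hx : 0 ≤ x) (a : ℝ) {ms : ℕ → P1 (Junction N)} {xs : ℕ → ℝ}
    (hm : Tendsto ms atTop (𝓝 m)) (hxs : Tendsto xs atTop (𝓝 x)) (h0 : ∀ n, 0 ≤ xs n) {ε : ℝ}
    (hε : 0 < ε) :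
    ∀ᶠ n in atTop, ∀ b, c.L i m x a - ε ≤
      c.L i (ms n) (xs n) b - deriv (fun b => c.L i m x b) a * (b - a) := by
  obtain ⟨C₀, hC₀, hcoer, -⟩ := hc.coercive
  set q := deriv (fun b => c.L i m x b) a with hq
  -- For `|b| ≥ B` coercivity alone beats the supporting line. For `|b| ≤ B` the tangent inequality
  -- at the limit and compactness suffice.
  obtain ⟨B, hB⟩ := exists_forall_le_rpow_sub_mul hp hC₀ |q| (c.L i m x a - ε + |q| * |a|)
  have hK : IsCompact (Icc (-B) B) := isCompact_Icc
  have hev : ∀ᶠ z : P1 (Junction N) × ℝ in 𝓝 (m, x), ∀ b ∈ Icc (-B) B,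
      c.L i m x a - ε < c.L i z.1 (max z.2 0) b - q * (b - a) := by
    refine hK.eventually_forall_of_forall_eventually (P := fun (z : P1 (Junction N) × ℝ) b =>
      c.L i m x a - ε < c.L i z.1 (max z.2 0) b - q * (b - a)) fun b _ => ?_
    have hcont : Continuous fun z : (P1 (Junction N) × ℝ) × ℝ =>
        c.L i z.1.1 (max z.1.2 0) z.2 - q * (z.2 - a) := by
      refine Continuous.sub ?_ (by fun_prop)
      exact (c.continuous_L i).comp
        (f := fun z : (P1 (Junction N) × ℝ) × ℝ => (z.1.1, z.1.2, z.2)) (by fun_prop)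
    refine (hcont.tendsto ((m, x), b)).eventually (lt_mem_nhds ?_)
    simp only [max_eq_left hx]
    linarith [hc.L_add_deriv_mul_le i m hx a b]
  filter_upwards [(hm.prodMk_nhds hxs).eventually hev] with n hn b
  by_cases hb : b ∈ Icc (-B) B
  · have := hn b hb
    simp only [max_eq_left (h0 n)] at this
    exact this.le
  · have hb' : B ≤ |b| := by
      by_contra hcon
      exact hb (abs_le.1 (not_le.1 hcon).le)
    have h1 := hB |b| hb'
    have h2 := hcoer i (ms n) (xs n) b (h0 n)
    have h3 : q * (b - a) ≤ |q| * |b| + |q| * |a| := by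
      calc q * (b - a) ≤ |q * (b - a)| := le_abs_self _
        _ = |q| * |b - a| := abs_mul _ _
        _ ≤ |q| * (|b| + |a|) := mul_le_mul_of_nonneg_left (abs_sub _ _) (abs_nonneg _)
        _ = _ := by ring
    linarith

/-! ### Lower semicontinuity of the cost under weak convergence of the velocities. -/

section lowerSemicontinuity

variable {T C : ℝ} [hT : Fact (0 < T)]

/-- The derivative is a pointwise limit of difference quotients, each measurable by joint continuity
of the cost. -/
lemma measurable_deriv_L (c : Costs N) (hp : 1 < p) (hC : 0 ≤ C)
    (μ : ProbabilityMeasure (GamC N T p C)) (y : Traj N T) (i : Fin N) :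
    Measurable fun s => deriv (fun b => c.L i (marginal μ s) ((y s).val i) b)
      (coordDeriv y s i) := by
  have hyc : Continuous fun s => (y s).val i := (Junction.continuous_coord i).comp y.continuous
  have hv : Measurable fun s => coordDeriv y s i :=
    (EuclideanSpace.proj i : EuclideanSpace ℝ (Fin N) →L[ℝ] ℝ).continuous.measurable.comp
      (measurable_coordDeriv y)
  have hL : ∀ g : Icc (0 : ℝ) T → ℝ, Measurable g →
      Measurable fun s => c.L i (marginal μ s) ((y s).val i) (g s) := by
    intro g hg
    have h1 := (c.continuous_L i).comp_stronglyMeasurable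
      ((continuous_marginal hp hC μ).stronglyMeasurable.prodMk
        (hyc.stronglyMeasurable.prodMk hg.stronglyMeasurable))
    simpa only [max_eq_left (Junction.coord_nonneg _ i)] using h1.measurable
  set ε : ℕ → ℝ := fun n => ((n : ℝ) + 1)⁻¹ with hεd
  have hε : Tendsto ε atTop (𝓝[≠] 0) := by
    refine tendsto_nhdsWithin_iff.2 ⟨?_, Eventually.of_forall fun n => ?_⟩
    · simpa [hεd] using tendsto_one_div_add_atTop_nhds_zero_nat (𝕜 := ℝ)
    · exact (inv_pos.2 (by positivity : (0 : ℝ) < n + 1)).ne'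
  refine measurable_of_tendsto_metrizable (f := fun n s => (ε n)⁻¹ •
    (c.L i (marginal μ s) ((y s).val i) (coordDeriv y s i + ε n) -
      c.L i (marginal μ s) ((y s).val i) (coordDeriv y s i))) (fun n => ?_) ?_
  · exact ((hL _ (hv.add_const (ε n))).sub (hL _ hv)).const_mul (ε n)⁻¹
  · rw [tendsto_pi_nhds]
    intro s
    have hd := (c.differentiable_L i (marginal μ s) ((y s).coord_nonneg i)
      (coordDeriv y s i)).hasDerivAt
    exact hd.tendsto_slope_zero.comp hε

variable {μs : ℕ → ProbabilityMeasure (GamC N T p C)} {μ : ProbabilityMeasure (GamC N T p C)}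
  {ys : ℕ → Traj N T} {y : Traj N T}

/-- The slopes of the supporting lines along a trajectory, where the speed is at most `R`. -/
noncomputable def slopeAlong (c : Costs N) (μ : ProbabilityMeasure (GamC N T p C)) (y : Traj N T)
    (R : ℝ) (i : Fin N) : Icc (0 : ℝ) T → ℝ :=
  {s | ‖coordDeriv y s‖ ≤ R ∧ (0 < (y s).val i ∨ (y s).val = 0)}.indicator
    fun s => deriv (fun b => c.L i (marginal μ s) ((y s).val i) b) (coordDeriv y s i)

lemma measurable_slopeAlong (c : Costs N) (hp : 1 < p) (hC : 0 ≤ C)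
    (μ : ProbabilityMeasure (GamC N T p C)) (y : Traj N T) (R : ℝ) (i : Fin N) :
    Measurable (c.slopeAlong μ y R i) := by
  have hyc : Continuous fun s => (y s).val i := (Junction.continuous_coord i).comp y.continuous
  refine (c.measurable_deriv_L hp hC μ y i).indicator (MeasurableSet.inter ?_
    (MeasurableSet.union ?_ ?_))
  · exact measurableSet_le (measurable_coordDeriv y).norm measurable_const
  · exact (isOpen_lt continuous_const hyc).measurableSet
  · exact (isClosed_eq (Junction.continuous_val.comp y.continuous)
      continuous_const).measurableSet

lemma HMFG1.exists_abs_slopeAlong_le (hc : c.HMFG1 p) (hp : 1 < p)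
    (μ : ProbabilityMeasure (GamC N T p C)) (y : Traj N T) (R : ℝ) :
    ∃ M, 0 ≤ M ∧ ∀ i s, |c.slopeAlong μ y R i s| ≤ M := by
  obtain ⟨r, hr, hyr⟩ := exists_norm_le y
  obtain ⟨c', hc', hg⟩ := hc.growth r hr
  have hM : 0 ≤ c' * (|R| ^ (p - 1) + 1) :=
    mul_nonneg hc' (by linarith [Real.rpow_nonneg (abs_nonneg R) (p - 1)])
  refine ⟨_, hM, fun i s => ?_⟩
  unfold slopeAlong
  by_cases hs : s ∈ {s | ‖coordDeriv y s‖ ≤ R ∧ (0 < (y s).val i ∨ (y s).val = 0)}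
  · rw [indicator_of_mem hs]
    refine ((hg i (marginal μ s) _ ⟨(y s).coord_nonneg i,
      ((y s).coord_le_norm i).trans (hyr s)⟩ (coordDeriv y s i)).2).trans
      (mul_le_mul_of_nonneg_left ?_ hc')
    have h1 : |coordDeriv y s i| ≤ |R| :=
      (PiLp.norm_apply_le (coordDeriv y s) i).trans (hs.1.trans (le_abs_self R))
    have := Real.rpow_le_rpow (abs_nonneg _) h1 (by linarith : 0 ≤ p - 1)
    linarith
  · rw [indicator_of_notMem hs, abs_zero]
    exact hM

lemma slopeAlong_eq_zero {R : ℝ} {i k : Fin N} {s : Icc (0 : ℝ) T} (hi : 0 < (y s).val i)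
    (hk : k ≠ i) : c.slopeAlong μ y R k s = 0 := by
  refine indicator_of_notMem ?_ _
  rintro ⟨-, h | h⟩
  · exact absurd (Junction.coord_eq_zero_of_pos hi hk) h.ne'
  · rw [h] at hi
    simp at hi

lemma slopeAlong_eq_zero_of_lt {R : ℝ} {i : Fin N} {s : Icc (0 : ℝ) T}
    (h : R < ‖coordDeriv y s‖) : c.slopeAlong μ y R i s = 0 :=
  indicator_of_notMem (fun hs => absurd hs.1 (not_le.2 h)) _

/-- On a junction, at most one coordinate of the velocity does not vanish. -/
lemma sum_mul_coordDeriv_of_pos {s : Icc (0 : ℝ) T}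
    (h : ∀ i, HasDerivAt (coord y i) (coordDeriv y s i) s) {i : Fin N} (hi : 0 < (y s).val i)
    (q : Fin N → ℝ) : ∑ k, q k * coordDeriv y s k = q i * coordDeriv y s i := by
  refine Finset.sum_eq_single i (fun k _ hk => ?_) (by simp)
  rw [coordDeriv_eq_zero (h k) (Junction.coord_eq_zero_of_pos hi hk), mul_zero]

lemma coordDeriv_eq_zero_of_val_eq_zero {s : Icc (0 : ℝ) T}
    (h : ∀ i, HasDerivAt (coord y i) (coordDeriv y s i) s) (h0 : (y s).val = 0) (k : Fin N) :
    coordDeriv y s k = 0 :=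
  coordDeriv_eq_zero (h k) (by simp [h0])

/-- Pointwise lower semicontinuity of the running cost, corrected by a weakly null term. -/
lemma HMFG1.eventually_running_sub_ge [Nonempty (Fin N)] (hc : c.HMFG1 p) (hp : 1 < p)
    {C₀ : ℝ} (hC₀ : 0 < C₀)
    (hcoer : ∀ i m x a, 0 ≤ x → C₀ * (|a| ^ p - 1) ≤ c.L i m x a) (hstar : ∀ m, -C₀ ≤ c.Lstar m)
    {s : Icc (0 : ℝ) T}
    (hm : Tendsto (fun n => marginal (μs n) s) atTop (𝓝 (marginal μ s)))
    (hlim : Tendsto (fun n => ys n s) atTop (𝓝 (y s)))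
    (hd : ∀ i, HasDerivAt (coord y i) (coordDeriv y s i) s)
    (hdn : ∀ n i, HasDerivAt (coord (ys n) i) (coordDeriv (ys n) s i) s)
    (R : ℝ) {ε : ℝ} (hε : 0 < ε) :
    ∀ᶠ n in atTop,
      (if ‖coordDeriv y s‖ ≤ R then c.running (marginal μ s) (y s) (coordDeriv y s) else -C₀) - ε ≤
        c.running (marginal (μs n) s) (ys n s) (coordDeriv (ys n) s) -
          ∑ i, c.slopeAlong μ y R i s * (coordDeriv (ys n) s i - coordDeriv y s i) := by
  -- Where the speed exceeds `R` the slopes are zero, and only the global bound `-C₀` is claimed.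
  by_cases hR : ‖coordDeriv y s‖ ≤ R
  swap
  · rw [if_neg hR]
    refine Eventually.of_forall fun n => ?_
    have := neg_le_running hp hC₀ hcoer hstar (marginal (μs n) s) (ys n s) (coordDeriv (ys n) s)
    simp only [slopeAlong_eq_zero_of_lt (not_le.1 hR), zero_mul, Finset.sum_const_zero]
    linarith
  rw [if_pos hR]
  have hxs := Junction.tendsto_iff_coord.1 hlim
  have hkey := fun i => hc.eventually_forall_le hp i ((y s).coord_nonneg i) (coordDeriv y s i) hm
    (hxs i) (fun n => (ys n s).coord_nonneg i) hε
  rcases (y s).eq_zero_or_exists_pos with hz | ⟨i, hi⟩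
  · have hv := coordDeriv_eq_zero_of_val_eq_zero hd hz
    -- When `y s` is the vertex, `ys n s` may lie on any edge, so all `N` slopes are kept.
    have hq : ∀ i, c.slopeAlong μ y R i s =
        deriv (fun b => c.L i (marginal μ s) ((y s).val i) b) (coordDeriv y s i) := fun i =>
      indicator_of_mem (show s ∈ {s | ‖coordDeriv y s‖ ≤ R ∧
        (0 < (y s).val i ∨ (y s).val = 0)} from ⟨hR, Or.inr hz⟩) _
    have hL0 := (c.continuous_L0.tendsto _).comp hm
    rw [c.running_of_eq_zero _ hz]
    filter_upwards [eventually_all.2 hkey,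
      hL0.eventually (lt_mem_nhds (sub_lt_self _ hε))] with n hn hn0
    simp only [hv, sub_zero]
    rcases (ys n s).eq_zero_or_exists_pos with hzn | ⟨i, hin⟩
    · simp only [coordDeriv_eq_zero_of_val_eq_zero (hdn n) hzn, mul_zero, Finset.sum_const_zero,
        sub_zero]
      rw [c.running_of_eq_zero _ hzn]
      exact hn0.le
    · rw [c.running_of_pos _ hin, sum_mul_coordDeriv_of_pos (hdn n) hin, hq]
      have h1 := hn i (coordDeriv (ys n) s i)
      have h2 : c.L0 (marginal μ s) ≤ c.L i (marginal μ s) ((y s).val i) (coordDeriv y s i) := by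
        rw [hv, hz]
        exact (min_le_right _ _).trans (ciInf_le (finite_range _).bddBelow i)
      simp only [hv, sub_zero] at h1 h2 ⊢
      linarith
  · have hq : c.slopeAlong μ y R i s =
        deriv (fun b => c.L i (marginal μ s) ((y s).val i) b) (coordDeriv y s i) :=
      indicator_of_mem (show s ∈ {s | ‖coordDeriv y s‖ ≤ R ∧
        (0 < (y s).val i ∨ (y s).val = 0)} from ⟨hR, Or.inl hi⟩) _
    rw [c.running_of_pos _ hi]
    filter_upwards [hkey i, (hxs i).eventually (lt_mem_nhds hi)] with n hn hin
    rw [c.running_of_pos _ hin, Finset.sum_eq_single i]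
    · rw [hq]
      exact hn _
    · intro k _ hk
      rw [slopeAlong_eq_zero hi hk, zero_mul]
    · simp

/-- The lower bound needed for the Fatou argument: the slopes are bounded, so the linear term is
absorbed by the coercivity of order `p > 1`. -/
lemma HMFG1.exists_neg_le_running_sub [Nonempty (Fin N)] (hc : c.HMFG1 p) (hp : 1 < p)
    (μ : ProbabilityMeasure (GamC N T p C)) (y : Traj N T) {R : ℝ} (hR : 0 ≤ R) :
    ∃ K, ∀ (m : P1 (Junction N)) (z : Traj N T) (s : Icc (0 : ℝ) T),
      (∀ i, HasDerivAt (coord z i) (coordDeriv z s i) s) →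
      -K ≤ c.running m (z s) (coordDeriv z s) -
          ∑ i, c.slopeAlong μ y R i s * (coordDeriv z s i - coordDeriv y s i) := by
  obtain ⟨C₀, hC₀, hcoer, hstar⟩ := hc.coercive
  obtain ⟨M, hM, hqM⟩ := hc.exists_abs_slopeAlong_le hp μ y R
  obtain ⟨K, hK⟩ := exists_forall_neg_le_rpow_sub_mul hp hC₀ hM
  -- Here `K` serves the edges, `C₀` the vertex, and `N * (M * R)` bounds the terms with the
  -- velocity of `y`.
  refine ⟨max K C₀ + N * (M * R), fun m z s hd => ?_⟩
  have hsum : -(N * (M * R)) ≤ ∑ i, c.slopeAlong μ y R i s * coordDeriv y s i := by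
    have hterm : ∀ i ∈ Finset.univ, -(M * R) ≤ c.slopeAlong μ y R i s * coordDeriv y s i := by
      intro i _
      rcases le_or_gt ‖coordDeriv y s‖ R with h | h
      · have h1 : |c.slopeAlong μ y R i s * coordDeriv y s i| ≤ M * R := by
          rw [abs_mul]
          exact mul_le_mul (hqM i s) ((PiLp.norm_apply_le (coordDeriv y s) i).trans h)
            (abs_nonneg _) hM
        exact (abs_le.1 h1).1
      · rw [slopeAlong_eq_zero_of_lt h, zero_mul]
        exact neg_nonpos.2 (mul_nonneg hM hR)
    have := Finset.card_nsmul_le_sum _ _ _ hterm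
    simpa using this
  simp only [mul_sub, Finset.sum_sub_distrib]
  have hmK := le_max_left K C₀
  have hmC := le_max_right K C₀
  rcases (z s).eq_zero_or_exists_pos with hz | ⟨i, hi⟩
  · simp only [coordDeriv_eq_zero_of_val_eq_zero hd hz, mul_zero, Finset.sum_const_zero]
    have := neg_le_running hp hC₀ hcoer hstar m (z s) (coordDeriv z s)
    linarith
  · rw [sum_mul_coordDeriv_of_pos hd hi, c.running_of_pos _ hi]
    have h1 := hcoer i m _ (coordDeriv z s i) hi.le
    have h2 := hK |coordDeriv z s i| (abs_nonneg _)
    have h3 : c.slopeAlong μ y R i s * coordDeriv z s i ≤ M * |coordDeriv z s i| := by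
      refine (le_abs_self _).trans ?_
      rw [abs_mul]
      exact mul_le_mul_of_nonneg_right (hqM i s) (abs_nonneg _)
    linarith

/-- Lower semicontinuity of the running cost. -/
theorem HMFG1.eventually_integral_running_ge [Nonempty (Fin N)] (hc : c.HMFG1 p) (hp : 1 < p)
    (hC : 0 ≤ C) (hμ : Tendsto μs atTop (𝓝 μ)) (hys : ∀ n, ys n ∈ Gam N T p)
    (hL : ∀ n, eLpNorm (coordDeriv (ys n)) (ENNReal.ofReal p) (leb T) ≤ ENNReal.ofReal C)
    (hlim : ∀ s, Tendsto (fun n => ys n s) atTop (𝓝 (y s))) (hy : y ∈ Gam N T p)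
    {ε : ℝ} (hε : 0 < ε) :
    ∀ᶠ n in atTop, ∫ s, c.running (marginal μ s) (y s) (coordDeriv y s) ∂leb T - ε ≤
      ∫ s, c.running (marginal (μs n) s) (ys n s) (coordDeriv (ys n) s) ∂leb T := by
  obtain ⟨C₀, hC₀, hcoer, hstar⟩ := hc.coercive
  have hint := hc.integrable_running hp hC μ hy
  set h : ℝ → Icc (0 : ℝ) T → ℝ := fun R s =>
    if ‖coordDeriv y s‖ ≤ R then c.running (marginal μ s) (y s) (coordDeriv y s) else -C₀ with hh
  have hbd : ∀ R s, |h R s| ≤ |c.running (marginal μ s) (y s) (coordDeriv y s)| + C₀ := by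
    intro R s
    simp only [hh]
    split_ifs
    · linarith
    · rw [abs_neg, abs_of_pos hC₀]
      linarith [abs_nonneg (c.running (marginal μ s) (y s) (coordDeriv y s))]
  have hmeas : ∀ R, AEStronglyMeasurable (h R) (leb T) := fun R => by
    have hset : MeasurableSet {s | ‖coordDeriv y s‖ ≤ R} :=
      measurableSet_le (measurable_coordDeriv y).norm measurable_const
    have hrep : h R = fun s => {s | ‖coordDeriv y s‖ ≤ R}.indicator
        (fun s => c.running (marginal μ s) (y s) (coordDeriv y s)) s +
        {s | ‖coordDeriv y s‖ ≤ R}ᶜ.indicator (fun _ => -C₀) s := by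
      funext s
      by_cases hs : ‖coordDeriv y s‖ ≤ R
      · simp [hh, indicator, hs]
      · simp [hh, indicator, hs]
    rw [hrep]
    exact (hint.1.indicator hset).add (aestronglyMeasurable_const.indicator hset.compl)
  have hhint : ∀ R, Integrable (h R) (leb T) := fun R =>
    (hint.abs.add (integrable_const C₀)).mono' (hmeas R) (Eventually.of_forall (hbd R))
  have hconv : Tendsto (fun R : ℕ => ∫ s, h R s ∂leb T) atTop
      (𝓝 (∫ s, c.running (marginal μ s) (y s) (coordDeriv y s) ∂leb T)) := by
    refine tendsto_integral_of_dominated_convergence _ (fun R => hmeas R)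
      (hint.abs.add (integrable_const C₀)) (fun R => Eventually.of_forall (hbd R))
      (Eventually.of_forall fun s => ?_)
    obtain ⟨R₀, hR₀⟩ := exists_nat_ge ‖coordDeriv y s‖
    refine tendsto_const_nhds.congr' ?_
    filter_upwards [eventually_ge_atTop R₀] with R hR
    simp only [hh]
    rw [if_pos (hR₀.trans (Nat.cast_le.2 hR))]
  -- One third of `ε` is spent on truncating the speed, one on the Fatou argument, one on the weakly
  -- null term.
  obtain ⟨R, hR⟩ := (hconv.eventually (lt_mem_nhds
    (sub_lt_self _ (by positivity : 0 < ε / 3)))).exists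
  obtain ⟨M, -, hqM⟩ := hc.exists_abs_slopeAlong_le hp μ y R
  obtain ⟨K, hK⟩ := hc.exists_neg_le_running_sub hp μ y (R := R) R.cast_nonneg
  have hqm := c.measurable_slopeAlong hp hC μ y R
  have hqi : ∀ n i, Integrable (fun s => c.slopeAlong μ y R i s *
      (coordDeriv (ys n) s i - coordDeriv y s i)) (leb T) := fun n i =>
    Integrable.bdd_mul ((integrable_piLp_iff.1 (integrable_coordDeriv (hys n)) i).sub
      (integrable_piLp_iff.1 (integrable_coordDeriv hy) i)) (hqm i).aestronglyMeasurable
      (Eventually.of_forall (hqM i))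
  have hweak : Tendsto (fun n => ∑ i, ∫ s, c.slopeAlong μ y R i s *
      (coordDeriv (ys n) s i - coordDeriv y s i) ∂leb T) atTop (𝓝 0) := by
    have := tendsto_finsetSum Finset.univ fun i _ =>
      tendsto_integral_mul_coordDeriv_sub hp hC hys hL hlim i (hqm i) (hqM i)
    simpa only [Finset.sum_const_zero] using this
  have hrn := fun n => hc.integrable_running hp hC (μs n) (hys n)
  have hfatou := eventually_integral_ge_of_eventually_ge (ν := leb T) (K := K)
    (f := fun n s => c.running (marginal (μs n) s) (ys n s) (coordDeriv (ys n) s) -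
          ∑ i, c.slopeAlong μ y R i s * (coordDeriv (ys n) s i - coordDeriv y s i))
    (fun n => (hrn n).sub (integrable_finsetSum _ fun i _ => hqi n i)) (hhint R)
    (fun n => by
      filter_upwards [ae_hasDerivAt_coord (mem_Gam_iff.1 (hys n)).1] with s hs
      exact hK _ _ s hs)
    (by
      filter_upwards [ae_hasDerivAt_coord (mem_Gam_iff.1 hy).1,
        ae_all_iff.2 fun n => ae_hasDerivAt_coord (mem_Gam_iff.1 (hys n)).1] with s hs hsn ε hε
      exact hc.eventually_running_sub_ge hp hC₀ hcoer hstar (tendsto_marginal hC hμ s) (hlim s)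
        hs hsn R hε)
    (by positivity : 0 < ε / 3)
  filter_upwards [hfatou, hweak.eventually (lt_mem_nhds (by linarith : -(ε / 3) < 0))] with n h1 h2
  rw [integral_sub (hrn n) (integrable_finsetSum _ fun i _ => hqi n i),
    integral_finsetSum _ fun i _ => hqi n i] at h1
  linarith

/-- Lower semicontinuity of the total cost. -/
theorem HMFG1.eventually_J_ge [Nonempty (Fin N)] (hc : c.HMFG1 p) (hp : 1 < p)
    (hC : 0 ≤ C) (hμ : Tendsto μs atTop (𝓝 μ)) (hys : ∀ n, ys n ∈ Gam N T p)
    (hL : ∀ n, eLpNorm (coordDeriv (ys n)) (ENNReal.ofReal p) (leb T) ≤ ENNReal.ofReal C)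
    (hlim : ∀ s, Tendsto (fun n => ys n s) atTop (𝓝 (y s))) (hy : y ∈ Gam N T p)
    {ε : ℝ} (hε : 0 < ε) : ∀ᶠ n in atTop, c.J μ y - ε ≤ c.J (μs n) (ys n) := by
  filter_upwards [hc.eventually_integral_running_ge hp hC hμ hys hL hlim hy (half_pos hε),
    c.eventually_terminal_ge (tendsto_marginal hC hμ (tFinal T)) (hlim (tFinal T)) (half_pos hε)]
    with n h1 h2
  rw [c.J_eq μ hy, c.J_eq (μs n) (hys n)]
  linarith

end lowerSemicontinuity

end Costs

/-! ### Recovery sequences -/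

lemma EuclideanSpace.norm_le_sum_abs {N : ℕ} (α : EuclideanSpace ℝ (Fin N)) :
    ‖α‖ ≤ ∑ i, |α i| := by
  rw [EuclideanSpace.norm_eq]
  refine Real.sqrt_le_iff.2 ⟨Finset.sum_nonneg fun i _ => abs_nonneg _, ?_⟩
  simp only [Real.norm_eq_abs]
  exact Finset.sum_sq_le_sq_sum_of_nonneg fun i _ => abs_nonneg _

lemma abs_max_zero_sub_max_zero_le (a b : ℝ) : |max a 0 - max b 0| ≤ |a - b| := by
  simpa using abs_max_sub_max_le_max a 0 b 0

/-- Divide the increments by `|t - s|` and let `t → s`. -/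
lemma HasDerivAt.abs_le_of_abs_sub_le {ι : Type*} [Fintype ι] {f : ℝ → ℝ} {g : ι → ℝ → ℝ} {f' : ℝ}
    {g' : ι → ℝ} {s : ℝ} (hf : HasDerivAt f f' s) (hg : ∀ k, HasDerivAt (g k) (g' k) s)
    (h : ∀ t, |f t - f s| ≤ ∑ k, |g k t - g k s| + |t - s|) : |f'| ≤ ∑ k, |g' k| + 1 := by
  have h1 := (hasDerivAt_iff_tendsto_slope.1 hf).abs
  have h2 := (tendsto_finsetSum Finset.univ fun k _ =>
    (hasDerivAt_iff_tendsto_slope.1 (hg k)).abs).add_const 1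
  refine le_of_tendsto_of_tendsto h1 h2 ?_
  filter_upwards [self_mem_nhdsWithin] with t ht
  have hpos : 0 < |t - s| := abs_pos.2 (sub_ne_zero.2 ht)
  simp only [slope_def_field, abs_div]
  rw [← Finset.sum_div, div_add_one hpos.ne']
  exact div_le_div_of_nonneg_right (h t) hpos.le

/-! ### Dilating and folding the junction. -/

namespace Junction

variable {N : ℕ}

lemma continuous_iff_coord {X : Type*} [TopologicalSpace X] {f : X → Junction N} :
    Continuous f ↔ ∀ k, Continuous fun s => (f s).val k := by
  simp only [continuous_iff_continuousAt, ContinuousAt, tendsto_iff_coord]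
  exact forall_comm

/-- The dilation of the junction by a nonnegative factor. -/
noncomputable def dilate (l : ℝ≥0) (x : Junction N) : Junction N where
  val := (l : ℝ) • x.val
  mem := by
    obtain ⟨i, r, hr, hx⟩ := x.mem
    refine ⟨i, l * r, by positivity, ?_⟩
    rw [hx]
    ext k
    by_cases hk : k = i <;> simp [hk]

/-- The coordinates of the point obtained from `x` by folding the junction: a segment of length `ρ`
of each edge other than the `i`-th one is folded onto the `i`-th edge, which is moved outwards
by `ρ`. -/
noncomputable def foldVal (i : Fin N) (ρ : ℝ) (x : Junction N) : EuclideanSpace ℝ (Fin N) :=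
  WithLp.toLp 2 fun k => if k = i then x.val i + max (ρ - ∑ j ∈ Finset.univ.erase i, x.val j) 0
    else max (x.val k - ρ) 0

lemma sum_erase_of_pos {x : Junction N} {i j : Fin N} (hj : 0 < x.val j) (hij : j ≠ i) :
    ∑ k ∈ Finset.univ.erase i, x.val k = x.val j := by
  refine Finset.sum_eq_single j (fun k _ hk => coord_eq_zero_of_pos hj hk) fun h => ?_
  exact absurd (Finset.mem_erase.2 ⟨hij, Finset.mem_univ j⟩) h

/-- The fold moves the vertex to distance `ρ` on the `i`-th edge. A point at distance `t` on another
edge goes to distance `ρ - t` on the `i`-th edge if `t ≤ ρ`, and to distance `t - ρ` on its own edge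
otherwise. -/
lemma exists_foldVal_eq_single (i : Fin N) {ρ : ℝ} (hρ : 0 ≤ ρ) (x : Junction N) :
    ∃ j r, 0 ≤ r ∧ r ≤ ‖x.val‖ + ρ ∧ foldVal i ρ x = EuclideanSpace.single j r := by
  rcases x.eq_zero_or_exists_pos with hz | ⟨j, hj⟩
  · refine ⟨i, ρ, hρ, by simp [hz], ?_⟩
    ext k
    by_cases hk : k = i <;> simp [foldVal, hz, hk, hρ]
  · rw [norm_val_of_pos hj]
    by_cases hij : j = i
    · subst hij
      have h0 : ∑ k ∈ Finset.univ.erase j, x.val k = 0 :=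
        Finset.sum_eq_zero fun k hk => coord_eq_zero_of_pos hj (Finset.ne_of_mem_erase hk)
      refine ⟨j, x.val j + ρ, by positivity, le_rfl, ?_⟩
      ext k
      by_cases hk : k = j
      · subst hk
        simp [foldVal, h0, hρ]
      · simp [foldVal, hk, coord_eq_zero_of_pos hj hk, hρ]
    · rcases le_total (x.val j) ρ with h | h
      · refine ⟨i, ρ - x.val j, by linarith, by linarith, ?_⟩
        ext k
        by_cases hk : k = i
        · subst hk
          simp [foldVal, sum_erase_of_pos hj hij, coord_eq_zero_of_pos hj (Ne.symm hij), h]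
        · by_cases hkj : k = j
          · subst hkj
            simp [foldVal, hk, h]
          · simp [foldVal, hk, coord_eq_zero_of_pos hj hkj, hρ]
      · refine ⟨j, x.val j - ρ, by linarith, by linarith, ?_⟩
        ext k
        by_cases hk : k = i
        · subst hk
          simp [foldVal, sum_erase_of_pos hj hij, coord_eq_zero_of_pos hj (Ne.symm hij), h,
            Ne.symm hij]
        · by_cases hkj : k = j
          · subst hkj
            simp [foldVal, hk, h]
          · simp [foldVal, hk, hkj, coord_eq_zero_of_pos hj hkj, hρ]

/-- The folding map. -/
noncomputable def fold (i : Fin N) (ρ : ℝ) (hρ : 0 ≤ ρ) (x : Junction N) : Junction N where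
  val := foldVal i ρ x
  mem := by
    obtain ⟨j, r, hr, -, h⟩ := exists_foldVal_eq_single i hρ x
    exact ⟨j, r, hr, h⟩

lemma norm_fold_le (i : Fin N) {ρ : ℝ} (hρ : 0 ≤ ρ) (x : Junction N) :
    ‖(fold i ρ hρ x).val‖ ≤ ‖x.val‖ + ρ := by
  obtain ⟨j, r, hr, hle, h⟩ := exists_foldVal_eq_single i hρ x
  change ‖foldVal i ρ x‖ ≤ _
  rw [h]
  simpa [abs_of_nonneg hr] using hle

lemma fold_zero (i : Fin N) (x : Junction N) : foldVal i 0 x = x.val := by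
  have h : 0 ≤ ∑ j ∈ Finset.univ.erase i, x.val j := Finset.sum_nonneg fun j _ => x.coord_nonneg j
  ext k
  by_cases hk : k = i
  · subst hk
    simp only [foldVal, if_true, zero_sub, max_eq_right (neg_nonpos.2 h), add_zero]
  · simp [foldVal, hk, x.coord_nonneg k]

lemma foldVal_of_val_eq_zero (i : Fin N) {ρ : ℝ} (hρ : 0 ≤ ρ) {x : Junction N} (h0 : x.val = 0) :
    foldVal i ρ x = EuclideanSpace.single i ρ := by
  ext k
  by_cases hk : k = i <;> simp [foldVal, h0, hk, hρ]

lemma continuous_foldVal (i k : Fin N) {X : Type*} [TopologicalSpace X] {ρ : X → ℝ}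
    {f : X → Junction N} (hρ : Continuous ρ) (hf : Continuous f) :
    Continuous fun s => foldVal i (ρ s) (f s) k := by
  have hz : ∀ k, Continuous fun s => (f s).val k := fun k => (continuous_coord k).comp hf
  by_cases hk : k = i
  · simp only [foldVal, hk, if_true]
    exact (hz i).add ((hρ.sub (continuous_finsetSum _ fun j _ => hz j)).max continuous_const)
  · simp only [foldVal, hk, if_false]
    exact ((hz k).sub hρ).max continuous_const

/-- A joint Lipschitz bound in the point and in `ρ`, from that of `max · 0`. It controls folded
trajectories when `ρ` varies with time. -/
lemma abs_foldVal_sub_le (i k : Fin N) (ρ ρ' : ℝ) (x x' : Junction N) :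
    |foldVal i ρ x k - foldVal i ρ' x' k| ≤ ∑ j, |x.val j - x'.val j| + |ρ - ρ'| := by
  by_cases hk : k = i
  · subst hk
    simp only [foldVal, if_true]
    rw [← Finset.add_sum_erase _ _ (Finset.mem_univ k)]
    have h1 := abs_max_zero_sub_max_zero_le (ρ - ∑ j ∈ Finset.univ.erase k, x.val j)
      (ρ' - ∑ j ∈ Finset.univ.erase k, x'.val j)
    have h2 : |(ρ - ∑ j ∈ Finset.univ.erase k, x.val j)
        - (ρ' - ∑ j ∈ Finset.univ.erase k, x'.val j)|
        ≤ |ρ - ρ'| + ∑ j ∈ Finset.univ.erase k, |x.val j - x'.val j| := by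
      rw [sub_sub_sub_comm, ← Finset.sum_sub_distrib]
      exact (abs_sub _ _).trans (add_le_add_right (Finset.abs_sum_le_sum_abs _ _) _)
    rw [add_sub_add_comm]
    exact (abs_add_le _ _).trans (by linarith)
  · simp only [foldVal, if_neg hk]
    have h1 := abs_max_zero_sub_max_zero_le (x.val k - ρ) (x'.val k - ρ')
    rw [sub_sub_sub_comm] at h1
    have h2 := Finset.single_le_sum (f := fun j => |x.val j - x'.val j|)
      (fun _ _ => abs_nonneg _) (Finset.mem_univ k)
    have h3 := abs_sub (x.val k - x'.val k) (ρ - ρ')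
    simp only at h2
    linarith

end Junction

/-! ### Dilated and folded trajectories, and convergence of their costs. -/

section recovery

variable {N : ℕ} {T p C : ℝ} [hT : Fact (0 < T)]

/-- The dilation of a trajectory. -/
noncomputable def Traj.dilate (l : ℝ≥0) (z : Traj N T) : Traj N T where
  toFun s := (z s).dilate l
  continuous_toFun := Junction.continuous_iff_coord.2 fun k =>
    continuous_const.mul ((Junction.continuous_coord k).comp z.continuous)

lemma coord_dilate (l : ℝ≥0) (z : Traj N T) (i : Fin N) :
    coord (z.dilate l) i = fun t => l * coord z i t := rfl

lemma coordDeriv_dilate (l : ℝ≥0) (z : Traj N T) (s : Icc (0 : ℝ) T) :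
    coordDeriv (z.dilate l) s = (l : ℝ) • coordDeriv z s := by
  ext i
  simp [coord_dilate]

lemma dilate_mem_Gam (l : ℝ≥0) {z : Traj N T} (hz : z ∈ Gam N T p) :
    z.dilate l ∈ Gam N T p := by
  rw [mem_Gam_iff] at hz ⊢
  refine ⟨fun i => (hz.1 i).const_mul l, ?_⟩
  have : coordDeriv (z.dilate l) = (l : ℝ) • coordDeriv z := funext (coordDeriv_dilate l z)
  rw [this]
  exact hz.2.const_smul _

/-- The trajectory which starts on the `i`-th edge at distance `r` from the image of `z`, and
coincides with `z` from time `r` on. -/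
noncomputable def Traj.fold (i : Fin N) (r : ℝ) (z : Traj N T) : Traj N T where
  toFun s := Junction.fold i (max (r - s) 0) (le_max_right _ _) (z s)
  continuous_toFun := Junction.continuous_iff_coord.2 fun k =>
    Junction.continuous_foldVal i k
      ((continuous_const.sub continuous_subtype_val).max continuous_const) z.continuous

lemma val_fold (i : Fin N) (r : ℝ) (z : Traj N T) (s : Icc (0 : ℝ) T) :
    (z.fold i r s).val = Junction.foldVal i (max (r - s) 0) (z s) := rfl

lemma abs_coord_fold_sub_le (i : Fin N) (r : ℝ) (z : Traj N T) (k : Fin N) (s t : ℝ) :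
    |coord (z.fold i r) k s - coord (z.fold i r) k t|
      ≤ ∑ j, |coord z j s - coord z j t| + |s - t| := by
  refine (Junction.abs_foldVal_sub_le i k _ _ _ _).trans (add_le_add_right ?_ _)
  refine (abs_max_zero_sub_max_zero_le _ _).trans ?_
  rw [sub_sub_sub_cancel_left, abs_sub_comm]
  have := abs_projIcc_sub_projIcc hT.out.le (c := s) (d := t)
  exact this

lemma absolutelyContinuous_coord_fold (i : Fin N) (r : ℝ) {z : Traj N T}
    (hz : ∀ j, AbsolutelyContinuousOnInterval (coord z j) 0 T) (k : Fin N) :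
    AbsolutelyContinuousOnInterval (coord (z.fold i r) k) 0 T := by
  refine AbsolutelyContinuousOnInterval.of_dist_le (F := (Finset.univ : Finset (Option (Fin N))))
    (g := fun o => o.elim (fun t => t) fun j => coord z j) (fun o _ => ?_) fun s _ t _ => ?_
  · cases o with
    | none => exact absolutelyContinuousOnInterval_id 0 T
    | some j => exact hz j
  · rw [Fintype.sum_option, add_comm]
    exact abs_coord_fold_sub_le i r z k s t

/-- Each of the `N` coordinates has speed at most `N * ‖z'‖ + 1`, the `1` coming from the unit rate
at which the folding parameter decreases. -/
lemma norm_coordDeriv_fold_le (i : Fin N) (r : ℝ) {z : Traj N T} {s : Icc (0 : ℝ) T}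
    (hz : ∀ j, HasDerivAt (coord z j) (coordDeriv z s j) s)
    (hf : ∀ j, HasDerivAt (coord (z.fold i r) j) (coordDeriv (z.fold i r) s j) s) :
    ‖coordDeriv (z.fold i r) s‖ ≤ (N * N + N) * (‖coordDeriv z s‖ + 1) := by
  have h1 : ∀ k ∈ Finset.univ,
      |coordDeriv (z.fold i r) s k| ≤ N * ‖coordDeriv z s‖ + 1 := by
    intro k _
    refine ((hf k).abs_le_of_abs_sub_le hz fun t => abs_coord_fold_sub_le i r z k t s).trans ?_
    have := Finset.sum_le_card_nsmul Finset.univ (fun j => |coordDeriv z s j|) ‖coordDeriv z s‖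
      fun j _ => PiLp.norm_apply_le (coordDeriv z s) j
    simp only [Finset.card_univ, Fintype.card_fin, nsmul_eq_mul] at this
    linarith
  have h2 := (EuclideanSpace.norm_le_sum_abs _).trans (Finset.sum_le_card_nsmul _ _ _ h1)
  simp only [Finset.card_univ, Fintype.card_fin, nsmul_eq_mul] at h2
  have hN : (0 : ℝ) ≤ N := N.cast_nonneg
  nlinarith [norm_nonneg (coordDeriv z s), mul_nonneg hN (norm_nonneg (coordDeriv z s)),
    mul_nonneg hN hN]

lemma fold_mem_Gam (i : Fin N) (r : ℝ) {z : Traj N T} (hz : z ∈ Gam N T p) :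
    z.fold i r ∈ Gam N T p := by
  rw [mem_Gam_iff] at hz ⊢
  have hAC := absolutelyContinuous_coord_fold i r hz.1
  refine ⟨hAC, ?_⟩
  refine MemLp.of_le_mul (c := N * N + N) (g := fun s => ‖coordDeriv z s‖ + 1)
    (hz.2.norm.add (memLp_const 1)) (measurable_coordDeriv _).aestronglyMeasurable ?_
  filter_upwards [ae_hasDerivAt_coord hz.1, ae_hasDerivAt_coord hAC] with s h1 h2
  refine (norm_coordDeriv_fold_le i r h1 h2).trans ?_
  rw [Real.norm_of_nonneg (by positivity)]

lemma fold_apply_of_le {i : Fin N} {r : ℝ} {z : Traj N T} {s : Icc (0 : ℝ) T} (h : r ≤ s) :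
    z.fold i r s = z s := by
  ext1
  rw [val_fold, max_eq_right (by linarith), Junction.fold_zero]

lemma coordDeriv_fold_of_lt {i : Fin N} {r : ℝ} {z : Traj N T} {s : Icc (0 : ℝ) T} (h : r < s) :
    coordDeriv (z.fold i r) s = coordDeriv z s := by
  ext k
  refine Filter.EventuallyEq.deriv_eq ?_
  -- At `s = T` the neighbourhood leaves `[0,T]`, but the projected time still exceeds `r`.
  filter_upwards [lt_mem_nhds h] with t ht
  have h1 : z.fold i r (projIcc 0 T hT.out.le t) = z (projIcc 0 T hT.out.le t) := by
    refine fold_apply_of_le ?_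
    rw [coe_projIcc]
    exact le_max_of_le_right (le_min (h.le.trans s.2.2) ht.le)
  unfold coord
  rw [h1]

namespace Costs

variable {c : Costs N} {μs : ℕ → ProbabilityMeasure (GamC N T p C)}
  {μ : ProbabilityMeasure (GamC N T p C)} {zs : ℕ → Traj N T} {z : Traj N T}

/-- Dominated convergence: the `p`-growth of the cost turns the bound on speeds into an integrable
majorant, uniform in the measures for large `n`. -/
lemma HMFG1.tendsto_J [Nonempty (Fin N)] (hc : c.HMFG1 p) (hp : 1 < p) (hC : 0 ≤ C)
    (hμ : Tendsto μs atTop (𝓝 μ)) (hz : z ∈ Gam N T p) (hzs : ∀ n, zs n ∈ Gam N T p) {r K' : ℝ}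
    (hr : 0 < r) (hbd : ∀ᶠ n in atTop, ∀ s, ‖(zs n s).val‖ ≤ r)
    (hd : ∀ᶠ n in atTop, ∀ᵐ s ∂leb T, ‖coordDeriv (zs n) s‖ ≤ K' * (‖coordDeriv z s‖ + 1))
    (hrun : ∀ᵐ s ∂leb T, Tendsto (fun n => c.running (marginal (μs n) s) (zs n s)
      (coordDeriv (zs n) s)) atTop (𝓝 (c.running (marginal μ s) (z s) (coordDeriv z s))))
    (hter : Tendsto (fun n => c.terminal (marginal (μs n) (tFinal T)) (zs n (tFinal T))) atTop
      (𝓝 (c.terminal (marginal μ (tFinal T)) (z (tFinal T))))) :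
    Tendsto (fun n => c.J (μs n) (zs n)) atTop (𝓝 (c.J μ z)) := by
  simp only [c.J_eq μ hz, fun n => c.J_eq (μs n) (hzs n)]
  refine Tendsto.add ?_ hter
  obtain ⟨K, hK, hb⟩ := hc.exists_abs_running_le hp hr
  obtain ⟨B, hB⟩ := c.exists_eventually_abs_L_le hp hC hμ
  have hmem : MemLp (fun s => K' * (‖coordDeriv z s‖ + 1)) (ENNReal.ofReal p) (leb T) :=
    ((mem_Gam_iff.1 hz).2.norm.add (memLp_const 1)).const_mul K'
  have hint := hmem.integrable_norm_rpow (by simpa using (by linarith : 0 < p))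
    ENNReal.ofReal_ne_top
  rw [ENNReal.toReal_ofReal (by linarith)] at hint
  refine tendsto_integral_filter_of_dominated_convergence
    (fun s => B + K * (1 + ‖K' * (‖coordDeriv z s‖ + 1)‖ ^ p))
    (Eventually.of_forall fun n => (hc.integrable_running hp hC (μs n) (hzs n)).1) ?_
    ((integrable_const B).add (((integrable_const (1 : ℝ)).add hint).const_mul K)) hrun
  filter_upwards [hbd, hd, hB] with n h1 h2 h3
  filter_upwards [h2] with s hs
  refine (hb _ B (h3 s) _ _ (h1 s)).trans (add_le_add_right (mul_le_mul_of_nonneg_left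
    (add_le_add_right ?_ _) hK) _)
  exact Real.rpow_le_rpow (norm_nonneg _) (hs.trans (le_abs_self _)) (by linarith)

/-- The dilation by `(x_n)_i / x_i` fixes the vertex and converges to the identity, so no cost jump
is met. -/
lemma HMFG1.exists_recovery_of_pos [Nonempty (Fin N)] (hc : c.HMFG1 p) (hp : 1 < p) (hC : 0 ≤ C)
    (hμ : Tendsto μs atTop (𝓝 μ)) {xs : ℕ → Junction N} {x : Junction N}
    (hx : Tendsto xs atTop (𝓝 x)) {i : Fin N} (hi : 0 < x.val i) (hz : z ∈ GamFrom T p x) :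
    ∃ zs : ℕ → Traj N T, (∀ᶠ n in atTop, zs n ∈ GamFrom T p (xs n)) ∧
      Tendsto (fun n => c.J (μs n) (zs n)) atTop (𝓝 (c.J μ z)) := by
  have hxi := Junction.tendsto_iff_coord.1 hx i
  set l : ℕ → ℝ≥0 := fun n => ⟨(xs n).val i / x.val i,
    div_nonneg ((xs n).coord_nonneg i) hi.le⟩ with hl
  have hl1 : Tendsto (fun n => (l n : ℝ)) atTop (𝓝 1) := by
    have := hxi.div_const (x.val i)
    rwa [div_self hi.ne'] at this
  have hl2 : ∀ᶠ n in atTop, (l n : ℝ) < 2 := hl1.eventually (gt_mem_nhds one_lt_two)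
  obtain ⟨r, hr, hzr⟩ := exists_norm_le z
  have hconv : ∀ s, Tendsto (fun n => z.dilate (l n) s) atTop (𝓝 (z s)) := by
    intro s
    rw [Junction.tendsto_iff_coord]
    intro k
    have := hl1.mul_const ((z s).val k)
    rwa [one_mul] at this
  have hzero : ∀ s, (z s).val = 0 → ∀ᶠ n in atTop, (z.dilate (l n) s).val = 0 := fun s hs =>
    Eventually.of_forall fun n => by
      change (l n : ℝ) • (z s).val = 0
      rw [hs, smul_zero]
  refine ⟨fun n => z.dilate (l n), ?_, ?_⟩
  -- For large `n`, `x_n` lies on the same edge as `x`, so matching the `i`-th coordinate matches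
  -- the point.
  · filter_upwards [hxi.eventually (lt_mem_nhds hi)] with n hn
    refine ⟨dilate_mem_Gam _ hz.1, ?_⟩
    ext k
    change (l n : ℝ) * (z (tInit T)).val k = (xs n).val k
    rw [hz.2]
    by_cases hk : k = i
    · subst hk
      exact div_mul_cancel₀ _ hi.ne'
    · rw [Junction.coord_eq_zero_of_pos hi hk, Junction.coord_eq_zero_of_pos hn hk, mul_zero]
  · refine hc.tendsto_J hp hC hμ hz.1 (fun n => dilate_mem_Gam _ hz.1) (r := 2 * r) (K' := 2)
      (by positivity) ?_ ?_ (Eventually.of_forall fun s => ?_) ?_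
    · filter_upwards [hl2] with n hn s
      change ‖(l n : ℝ) • (z s).val‖ ≤ _
      rw [norm_smul, Real.norm_of_nonneg (l n).coe_nonneg]
      exact mul_le_mul hn.le (hzr s) (norm_nonneg _) zero_le_two
    · filter_upwards [hl2] with n hn
      refine Eventually.of_forall fun s => ?_
      rw [coordDeriv_dilate, norm_smul, Real.norm_of_nonneg (l n).coe_nonneg]
      exact mul_le_mul hn.le (by linarith) (norm_nonneg _) zero_le_two
    · refine c.tendsto_running (tendsto_marginal hC hμ s) (hconv s) ?_ (hzero s)
      simp only [coordDeriv_dilate]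
      have := hl1.smul_const (coordDeriv z s)
      rwa [one_smul] at this
    · exact c.tendsto_terminal (tendsto_marginal hC hμ _) (hconv _) (hzero _)

/-- No dilation moves the vertex, so `z` is folded with parameter `max (r_n - s) 0`, on an edge that
may change with `n`. The modification lasts a time `r_n → 0`. -/
lemma HMFG1.exists_recovery_of_eq_zero [Nonempty (Fin N)] (hc : c.HMFG1 p) (hp : 1 < p)
    (hC : 0 ≤ C) (hμ : Tendsto μs atTop (𝓝 μ)) {xs : ℕ → Junction N} {x : Junction N}
    (hx : Tendsto xs atTop (𝓝 x)) (hx0 : x.val = 0) (hz : z ∈ GamFrom T p x) :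
    ∃ zs : ℕ → Traj N T, (∀ᶠ n in atTop, zs n ∈ GamFrom T p (xs n)) ∧
      Tendsto (fun n => c.J (μs n) (zs n)) atTop (𝓝 (c.J μ z)) := by
  choose i r hr hxr using fun n => (xs n).mem
  have hr0 : Tendsto r atTop (𝓝 0) := by
    have := ((Junction.continuous_val.tendsto x).comp hx).norm
    rw [hx0, norm_zero] at this
    refine this.congr fun n => ?_
    simp only [Function.comp_apply]
    rw [hxr n]
    simp [hr n]
  have hrs : ∀ s : Icc (0 : ℝ) T, 0 < (s : ℝ) → ∀ᶠ n in atTop, r n < s := fun s hs =>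
    hr0.eventually (gt_mem_nhds hs)
  obtain ⟨b, hb, hzb⟩ := exists_norm_le z
  refine ⟨fun n => z.fold (i n) (r n), Eventually.of_forall fun n =>
    ⟨fold_mem_Gam _ _ hz.1, ?_⟩, ?_⟩
  · ext1
    -- At time `0` the fold carries the vertex to distance `r n` on the edge `i n`, which is `xs n`.
    have h0 : (z (tInit T)).val = 0 := by rw [hz.2, hx0]
    rw [val_fold, Junction.foldVal_of_val_eq_zero _ (le_max_right _ _) h0, hxr n]
    simp [tInit, hr n]
  · refine hc.tendsto_J hp hC hμ hz.1 (fun n => fold_mem_Gam _ _ hz.1) (r := b + 1)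
      (K' := N * N + N) (by positivity) ?_ (Eventually.of_forall fun n => ?_) ?_ ?_
    · filter_upwards [hr0.eventually (gt_mem_nhds one_pos)] with n hn s
      refine (Junction.norm_fold_le _ (le_max_right _ _) _).trans (add_le_add (hzb s) ?_)
      exact max_le (by linarith [s.2.1]) zero_le_one
    · filter_upwards [ae_hasDerivAt_coord (mem_Gam_iff.1 hz.1).1, ae_hasDerivAt_coord
        (absolutelyContinuous_coord_fold (i n) (r n) (mem_Gam_iff.1 hz.1).1)] with s h1 h2
      exact norm_coordDeriv_fold_le _ _ h1 h2
    · have hpos : ∀ᵐ s : Icc (0 : ℝ) T ∂leb T, (s : ℝ) ≠ 0 := by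
        rw [ae_leb_iff (P := fun t => t ≠ 0)]
        have : ∀ᵐ t : ℝ, t ≠ 0 := by simp [ae_iff, measure_singleton]
        exact this.mono fun t ht _ => ht
      -- At a fixed `s > 0`, the position and velocity of the folded trajectory are eventually those
      -- of `z`.
      filter_upwards [hpos] with s hs
      have hlim := c.tendsto_running (tendsto_marginal hC hμ s) (tendsto_const_nhds (x := z s))
        (tendsto_const_nhds (x := coordDeriv z s)) fun h => Eventually.of_forall fun _ => h
      refine hlim.congr' ?_
      filter_upwards [hrs s (lt_of_le_of_ne s.2.1 hs.symm)] with n hn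
      rw [fold_apply_of_le hn.le, coordDeriv_fold_of_lt hn]
    · have hlim := c.tendsto_terminal (tendsto_marginal hC hμ (tFinal T))
        (tendsto_const_nhds (x := z (tFinal T))) fun h => Eventually.of_forall fun _ => h
      refine hlim.congr' ?_
      filter_upwards [hrs (tFinal T) hT.out] with n hn
      rw [fold_apply_of_le hn.le]

lemma HMFG1.exists_recovery [Nonempty (Fin N)] (hc : c.HMFG1 p) (hp : 1 < p) (hC : 0 ≤ C)
    (hμ : Tendsto μs atTop (𝓝 μ)) {xs : ℕ → Junction N} {x : Junction N}
    (hx : Tendsto xs atTop (𝓝 x)) (hz : z ∈ GamFrom T p x) :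
    ∃ zs : ℕ → Traj N T, (∀ᶠ n in atTop, zs n ∈ GamFrom T p (xs n)) ∧
      Tendsto (fun n => c.J (μs n) (zs n)) atTop (𝓝 (c.J μ z)) := by
  rcases x.eq_zero_or_exists_pos with h0 | ⟨i, hi⟩
  · exact hc.exists_recovery_of_eq_zero hp hC hμ hx h0 hz
  · exact hc.exists_recovery_of_pos hp hC hμ hx hi hz

end Costs

end recovery

/-! ### The closed graph property. -/

theorem mainTheorem11 (N : ℕ) (hN : 1 < N) (T : ℝ) [Fact (0 < T)] (p : ℝ) (hp : 1 < p)
    (c : Costs N) (hc : c.HMFG1 p)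
    (m₀ : ProbabilityMeasure (Junction N))
    (hm₀ : Bornology.IsBounded (m₀ : Measure (Junction N)).support)
    (C : ℝ) (hC : 0 ≤ C)
    (μ : ProbabilityMeasure (GamC N T p C)) (hμ : μ ∈ ProbFrom T p C m₀)
    (x : Junction N) (hx : x ∈ (m₀ : Measure (Junction N)).support)
    (μs : ℕ → ProbabilityMeasure (GamC N T p C)) (hμs : ∀ n, μs n ∈ ProbFrom T p C m₀)
    (hμlim : Tendsto μs atTop (𝓝 μ))
    (xs : ℕ → Junction N) (hxlim : Tendsto xs atTop (𝓝 x))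
    (ys : ℕ → Traj N T) (hys : ∀ n, ys n ∈ c.optimal C (μs n) (xs n))
    (y : Icc (0 : ℝ) T → Junction N)
    (hylim : TendstoUniformly (fun n s => ys n s) y atTop) :
    ∃ Y ∈ c.optimal C μ x, ∀ s, Y s = y s := by
  have : Nonempty (Fin N) := ⟨⟨0, by omega⟩⟩
  have hlim : ∀ s, Tendsto (fun n => ys n s) atTop (𝓝 (y s)) := fun s => hylim.tendsto_at s
  let Y : Traj N T := ⟨y, hylim.continuous (Frequently.of_forall fun n => (ys n).continuous)⟩
  have hmem := fun n => mem_GamCFrom_iff.1 (hys n).1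
  have hG : ∀ n, ys n ∈ Gam N T p := fun n => (hmem n).1
  have hL := fun n => (hmem n).2.2.2
  have hLY : eLpNorm (coordDeriv Y) (ENNReal.ofReal p) (leb T) ≤ ENNReal.ofReal C :=
    eLpNorm_coordDeriv_le_of_tendsto hp hC hG hL hlim
  have hY : Y ∈ Gam N T p :=
    mem_Gam_iff.2 ⟨absolutelyContinuous_coord_of_tendsto hp hC hG hL hlim,
      (measurable_coordDeriv Y).aestronglyMeasurable, hLY.trans_lt ENNReal.ofReal_lt_top⟩
  refine ⟨Y, ⟨mem_GamCFrom_iff.2 ⟨hY, ?_, fun s => ?_, hLY⟩, fun z hz => ?_⟩, fun s => rfl⟩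
  · refine tendsto_nhds_unique (hlim (tInit T)) (hxlim.congr fun n => ?_)
    exact (hmem n).2.1.symm
  · exact le_of_tendsto' ((Junction.continuous_val.tendsto (y s)).comp (hlim s)).norm
      fun n => (hmem n).2.2.1 s
  · obtain ⟨zs, hzs, hJ⟩ := hc.exists_recovery hp hC hμlim hxlim hz
    -- Optimality of `ys n` among trajectories from `xs n` is tested against the recovery sequence
    -- of `z`.
    refine le_of_forall_pos_le_add fun ε hε => ?_
    have h1 := hc.eventually_J_ge hp hC hμlim hG hL (y := Y) hlim hY hε
    have h2 : c.J μ Y - ε ≤ c.J μ z := by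
      refine ge_of_tendsto hJ ?_
      filter_upwards [h1, hzs] with n hn1 hn2
      exact hn1.trans ((hys n).2 (zs n) hn2)
    linarith
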